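/- Let $N\ge 2$, $\ell>0$, $g,\sigma>0$, $0\le r\le 1$. Write points of $\mathbb R^{N-1}\times\mathbb R$ as $(x,y)$, put $\Sigma=\mathbb R^{N-1}$, $\Omega=\Sigma\times(0,\ell)$, and let $\hat f(\xi)=\int_\Sigma f(x)e^{-2\pi i\xi\cdot x}\,dx$ be the Fourier transform in the horizontal variable. Let $\mu(\xi)=g+\sigma(2\pi|\xi|)^{2r}$ and let $M$ be the operator $\widehat{M(h)}=\mu\hat h$. Let $\|f\|_{H^s(\Sigma)}^2=\int(1+|\xi|^2)^s|\hat f(\xi)|^2d\xi$, $\|f\|_{H^s_x(L^2_y)}^2=\int_0^\ell\int(1+|\xi|^2)^s|\hat f(\xi,y)|^2d\xi\,dy$ and $\|f\|_{L^2_y(L^1_x)}^2=\int_0^\ell\big(\int_\Sigma|f(x,y)|dx\big)^2dy$. Let $V$ be the space of $v\in H^1(\Omega;\mathbb R^N)$ with $\operatorname{div}v=0$ and $v=0$ on $\{y=0\}$, with the $H^1$ norm, embedded in its dual $V^*$ through the $L^2(\Omega)$ inner product, and let $(\mathbb Du)_{ij}=\partial_iu_j+\partial_ju_i$. A weak solution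 with initial data $(u_0,h_0)\in L^2(\Omega;\mathbb R^N)\times L^2(\Sigma)$ is a pair $(u,h)$ of real-valued functions with $u\in L^2_{loc}([0,\infty);V)$, $\partial_tu\in L^2_{loc}([0,\infty);V^*)$, $h,M(h)\in L^2_{loc}([0,\infty);L^2(\Sigma))$, $\partial_th\in L^2_{loc}([0,\infty);H^{1/2}(\Sigma))$, such that for every $T>0$ and every $v\in L^2([0,T];V)$, for a.e. $t\in[0,T]$, $$[\partial_tu,v]_{V^*,V}+\tfrac12(\mathbb Du,\mathbb Dv)_{L^2(\Omega)}+\int_{\{y=\ell\}}M(h)\,v_N\,dx=0,$$ such that $\partial_th=u_N$ on $\{y=\ell\}$ for a.e. $t>0$ in the sense of traces, and such that $u=u_0$ and $h=h_0$ at $t=0$ (as essential limits in $L^2$ as $t\to0^+$). Assume that $u_0\in L^2(\Omega;\mathbb R^N)\cap L^2_y(L^1_x)$ and $h_0\in L^2(\Sigma)\cap L^1(\Sigma)$. If $\tfrac12\le r\le1$, assume further that $h_0\in H^r(\Sigma)$. If $0\le r<\tfrac12$, assume further that $u_0\in H^{\frac{N-1}2(\frac12-r)}_x(L^2_y)$ and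 $h_0\in H^{\frac{N-1}4+\frac{N+1}2r}(\Sigma)$. Then there is a constant $K$, depending only on the initial data $(u_0,h_0)$ and on $N,\ell,g,\sigma,r$, such that every weak solution $(u,h)$ with these data has, after modification on a null set of times, $u\in C([0,\infty);L^2(\Omega))$ and $h\in C([0,\infty);L^2(\Sigma))$, with $u(0)=u_0$ and $h(0)=h_0$, and for all $t\ge0$ $$\mathcal E(t)\le K(1+t)^{-\frac{N-1}2},\qquad \mathcal E(t)=\tfrac12\int_\Omega|u(t)|^2+\tfrac12\int_\Sigma M(h(t))\,h(t)\,dx,$$ where $\int_\Sigma M(h)h\,dx$ means $\int_{\mathbb R^{N-1}}\mu(\xi)|\hat h(\xi)|^2d\xi$. -/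

import Mathlib

open MeasureTheory Set Filter Topology
open scoped ENNReal ContDiff FourierTransform

noncomputable section

namespace FluidSlab

/-! ## The slab and the basic `L²` spaces

The horizontal dimension is `d`, so the space dimension is `N = d + 1`.  Points of `ℝ^N` are written
`z = (x, y)` with `x ∈ ℝ^d` horizontal and `y ∈ ℝ` vertical. -/

/-- The horizontal cross-section `Σ = ℝ^d`, which is also its own dual group. -/
abbrev Hor (d : ℕ) : Type := EuclideanSpace ℝ (Fin d)

/-- The space `ℝ^(d+1)` of velocity vectors; the component `Fin.last d` is the vertical one. -/
abbrev Vel (d : ℕ) : Type := EuclideanSpace ℝ (Fin (d + 1))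

/-- The open slab `Ω = Σ × (0, ℓ)`. -/
def slab (d : ℕ) (ℓ : ℝ) : Set (Hor d × ℝ) := {z | 0 < z.2 ∧ z.2 < ℓ}

/-- `L²(Ω; ℝ^(d+1))`. -/
abbrev L2Slab (d : ℕ) (ℓ : ℝ) : Type := Lp (Vel d) 2 ((volume : Measure (Hor d × ℝ)).restrict (slab d ℓ))

/-- `L²(Σ)`, real valued. -/
abbrev L2Hor (d : ℕ) : Type := Lp ℝ 2 (volume : Measure (Hor d))

/-- The coordinate directions of `ℝ^d × ℝ`: the horizontal ones, then the vertical one. -/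
def dir (d : ℕ) : Fin (d + 1) → Hor d × ℝ :=
  Fin.lastCases (0, 1) (fun i => (EuclideanSpace.single i 1, 0))

/-- The partial derivative `∂_j φ` of a test function. -/
def pderiv {d : ℕ} (j : Fin (d + 1)) (φ : Hor d × ℝ → ℝ) (z : Hor d × ℝ) : ℝ :=
  fderiv ℝ φ z (dir d j)

/-- Smooth compactly supported real functions on `ℝ^d × ℝ` whose support lies in `U`. -/
structure IsTest {d : ℕ} (U : Set (Hor d × ℝ)) (φ : Hor d × ℝ → ℝ) : Prop where
  smooth : ContDiff ℝ ∞ φ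
  compact : HasCompactSupport φ
  supp : tsupport φ ⊆ U

/-! ## The space of divergence-free `H¹` fields vanishing at the bottom -/

/-- `L²` fields together with candidates for their partial derivatives: the ambient Hilbert space for
the graph of the weak gradient, with the norm `‖u‖² + ∑ⱼ ‖∂ⱼu‖²`. -/
abbrev Jet (d : ℕ) (ℓ : ℝ) : Type :=
  WithLp 2 (L2Slab d ℓ × PiLp 2 (fun _ : Fin (d + 1) => L2Slab d ℓ))

/-- `g` is the weak partial derivative `∂_j f`, tested against functions supported in `U`.
For `U = Ω` this is the usual weak derivative on `Ω`. -/
def IsWeakPartial {d : ℕ} {ℓ : ℝ} (U : Set (Hor d × ℝ)) (j : Fin (d + 1)) (f g : L2Slab d ℓ) :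
    Prop :=
  ∀ φ : Hor d × ℝ → ℝ, IsTest U φ →
    ∫ z in slab d ℓ, pderiv j φ z • f z = - ∫ z in slab d ℓ, φ z • g z

/-- Given that `g = ∂_y f` weakly in `Ω`, this says that `f` has zero trace on `{y = 0}`: integration
by parts produces no boundary term against test functions that vanish near `{y = ℓ}` but are
arbitrary near `{y = 0}`. -/
def ZeroAtBottom {d : ℕ} {ℓ : ℝ} (f g : L2Slab d ℓ) : Prop :=
  IsWeakPartial {z : Hor d × ℝ | z.2 < ℓ} (Fin.last d) f g

lemma IsTest.memLp_pderiv {d : ℕ} (ℓ : ℝ) {U : Set (Hor d × ℝ)} {φ : Hor d × ℝ → ℝ}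
    (h : IsTest U φ) (j : Fin (d + 1)) :
    MemLp (pderiv j φ) 2 ((volume : Measure (Hor d × ℝ)).restrict (slab d ℓ)) := by
  have hc : Continuous (pderiv j φ) :=
    (h.smooth.continuous_fderiv (by simp)).clm_apply continuous_const
  have hs : HasCompactSupport (pderiv j φ) := h.compact.fderiv_apply ℝ (dir d j)
  exact hc.memLp_of_hasCompactSupport hs

lemma IsTest.memLp {d : ℕ} (ℓ : ℝ) {U : Set (Hor d × ℝ)} {φ : Hor d × ℝ → ℝ} (h : IsTest U φ) :
    MemLp φ 2 ((volume : Measure (Hor d × ℝ)).restrict (slab d ℓ)) :=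
  h.smooth.continuous.memLp_of_hasCompactSupport h.compact

lemma integrable_smul_L2Slab {d : ℕ} {ℓ : ℝ} {φ : Hor d × ℝ → ℝ}
    (h : MemLp φ 2 ((volume : Measure (Hor d × ℝ)).restrict (slab d ℓ))) (f : L2Slab d ℓ) :
    Integrable (fun z => φ z • f z) ((volume : Measure (Hor d × ℝ)).restrict (slab d ℓ)) :=
  memLp_one_iff_integrable.1 ((Lp.memLp f).smul h)

lemma integral_smul_add {d : ℕ} {ℓ : ℝ} {φ : Hor d × ℝ → ℝ}
    (h : MemLp φ 2 ((volume : Measure (Hor d × ℝ)).restrict (slab d ℓ))) (f g : L2Slab d ℓ) :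
    ∫ z in slab d ℓ, φ z • (f + g) z
      = (∫ z in slab d ℓ, φ z • f z) + ∫ z in slab d ℓ, φ z • g z := by
  rw [← integral_add (integrable_smul_L2Slab h f) (integrable_smul_L2Slab h g)]
  refine integral_congr_ae ?_
  filter_upwards [Lp.coeFn_add f g] with z hz
  rw [hz, Pi.add_apply, smul_add]

lemma integral_smul_smul {d : ℕ} {ℓ : ℝ} (φ : Hor d × ℝ → ℝ) (c : ℝ) (f : L2Slab d ℓ) :
    ∫ z in slab d ℓ, φ z • (c • f) z = c • ∫ z in slab d ℓ, φ z • f z := by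
  rw [← integral_smul]
  refine integral_congr_ae ?_
  filter_upwards [Lp.coeFn_smul c f] with z hz
  rw [hz, Pi.smul_apply, smul_comm]

lemma integral_smul_zero {d : ℕ} {ℓ : ℝ} (φ : Hor d × ℝ → ℝ) :
    ∫ z in slab d ℓ, φ z • (0 : L2Slab d ℓ) z = 0 := by
  have := integral_smul_smul φ 0 (0 : L2Slab d ℓ)
  simpa using this

lemma IsWeakPartial.zero {d : ℕ} {ℓ : ℝ} (U : Set (Hor d × ℝ)) (j : Fin (d + 1)) :
    IsWeakPartial U j (0 : L2Slab d ℓ) 0 := fun φ _ => by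
  rw [integral_smul_zero, integral_smul_zero, neg_zero]

lemma IsWeakPartial.add {d : ℕ} {ℓ : ℝ} {U : Set (Hor d × ℝ)} {j : Fin (d + 1)}
    {f f' g g' : L2Slab d ℓ} (h : IsWeakPartial U j f g) (h' : IsWeakPartial U j f' g') :
    IsWeakPartial U j (f + f') (g + g') := fun φ hφ => by
  rw [integral_smul_add (hφ.memLp_pderiv ℓ j), integral_smul_add (hφ.memLp ℓ), h φ hφ, h' φ hφ,
    neg_add]

lemma IsWeakPartial.smul {d : ℕ} {ℓ : ℝ} {U : Set (Hor d × ℝ)} {j : Fin (d + 1)}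
    {f g : L2Slab d ℓ} (c : ℝ) (h : IsWeakPartial U j f g) :
    IsWeakPartial U j (c • f) (c • g) := fun φ hφ => by
  rw [integral_smul_smul, integral_smul_smul, h φ hφ, smul_neg]

/-- The divergence `∑ᵢ ∂ᵢ uᵢ`, as a function on `ℝ^d × ℝ` (only its values on `Ω` matter). -/
def divergence {d : ℕ} {ℓ : ℝ} (U : Jet d ℓ) (z : Hor d × ℝ) : ℝ :=
  ∑ i, (U.snd i) z i

/-- The space of solenoidal fields: `u ∈ H¹(Ω; ℝ^(d+1))` with `u = 0` on `{y = 0}` and `div u = 0`.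
An element is recorded as the pair `(u, ∇u)`, so the norm is the `H¹` norm. -/
def solenoidal (d : ℕ) (ℓ : ℝ) : Submodule ℝ (Jet d ℓ) where
  carrier := {U | (∀ j, IsWeakPartial (slab d ℓ) j U.fst (U.snd j)) ∧
    ZeroAtBottom U.fst (U.snd (Fin.last d)) ∧
    ∀ᵐ z ∂((volume : Measure (Hor d × ℝ)).restrict (slab d ℓ)), divergence U z = 0}
  zero_mem' := by
    refine ⟨fun j => IsWeakPartial.zero _ j, IsWeakPartial.zero _ _, ?_⟩
    filter_upwards [Lp.coeFn_zero (Vel d) 2 ((volume : Measure (Hor d × ℝ)).restrict (slab d ℓ))]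
      with z hz
    simp only [divergence, WithLp.zero_snd, PiLp.zero_apply]
    rw [hz]
    simp
  add_mem' := by
    rintro U V ⟨h1, h2, h3⟩ ⟨k1, k2, k3⟩
    refine ⟨fun j => (h1 j).add (k1 j), h2.add k2, ?_⟩
    have h : ∀ᵐ z ∂((volume : Measure (Hor d × ℝ)).restrict (slab d ℓ)), ∀ i,
        (U.snd i + V.snd i) z = U.snd i z + V.snd i z :=
      ae_all_iff.2 fun i => Lp.coeFn_add (U.snd i) (V.snd i)
    filter_upwards [h3, k3, h] with z hz kz hh
    simp only [divergence, WithLp.add_snd, PiLp.add_apply, hh] at hz kz ⊢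
    rw [Finset.sum_add_distrib, hz, kz, add_zero]
  smul_mem' := by
    rintro c U ⟨h1, h2, h3⟩
    refine ⟨fun j => (h1 j).smul c, h2.smul c, ?_⟩
    have h : ∀ᵐ z ∂((volume : Measure (Hor d × ℝ)).restrict (slab d ℓ)), ∀ i,
        (c • U.snd i) z = c • U.snd i z :=
      ae_all_iff.2 fun i => Lp.coeFn_smul c (U.snd i)
    filter_upwards [h3, h] with z hz hh
    simp only [divergence, WithLp.smul_snd, PiLp.smul_apply, hh] at hz ⊢
    rw [← Finset.smul_sum, hz, smul_zero]

/-- The inclusion of the solenoidal space into `L²(Ω)`. -/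
def toL2 (d : ℕ) (ℓ : ℝ) : solenoidal d ℓ →L[ℝ] L2Slab d ℓ :=
  (WithLp.fstL 2 ℝ (L2Slab d ℓ) (PiLp 2 (fun _ : Fin (d + 1) => L2Slab d ℓ))).comp
    (solenoidal d ℓ).subtypeL

/-- The embedding of the solenoidal space into its dual, `u ↦ (v ↦ (u, v)_{L²(Ω)})`. -/
def toDual (d : ℕ) (ℓ : ℝ) (u : solenoidal d ℓ) : StrongDual ℝ (solenoidal d ℓ) :=
  (innerSL ℝ (toL2 d ℓ u)).comp (toL2 d ℓ)

/-- The `(i, j)` entry `∂ᵢ uⱼ + ∂ⱼ uᵢ` of the symmetrized gradient. -/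
def symGrad {d : ℕ} {ℓ : ℝ} (u : solenoidal d ℓ) (i j : Fin (d + 1)) (z : Hor d × ℝ) : ℝ :=
  (u.1.snd i) z j + (u.1.snd j) z i

/-- The `L²(Ω)` inner product of the symmetrized gradients. -/
def symGradInner {d : ℕ} {ℓ : ℝ} (u v : solenoidal d ℓ) : ℝ :=
  ∫ z in slab d ℓ, ∑ i, ∑ j, symGrad u i j z * symGrad v i j z

/-- `τ ∈ L²(Σ)` is the trace on `{y = ℓ}` of the vertical component of `u`: the integration by parts
formula in `y` holds with boundary value `τ`, for all test functions supported away from `{y = 0}`. -/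
def IsTopTrace {d : ℕ} {ℓ : ℝ} (u : solenoidal d ℓ) (τ : L2Hor d) : Prop :=
  ∀ φ : Hor d × ℝ → ℝ, IsTest {z : Hor d × ℝ | 0 < z.2} φ →
    (∫ z in slab d ℓ, u.1.fst z (Fin.last d) * pderiv (Fin.last d) φ z)
        + (∫ z in slab d ℓ, (u.1.snd (Fin.last d)) z (Fin.last d) * φ z)
      = ∫ x : Hor d, τ x * φ (x, ℓ)

/-! ## Horizontal Fourier transform, Sobolev norms, the operator `M` -/

open Classical in
/-- The Fourier transform on `L²(ℝ^d)`, with kernel `e^{-2πi ξ·x}`, of a complex valued function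
(zero if the function is not in `L²`). -/
def l2Fourier {d : ℕ} (f : Hor d → ℂ) : Hor d → ℂ :=
  if hf : MemLp f 2 (volume : Measure (Hor d)) then
    (𝓕 (hf.toLp f) : Lp ℂ 2 (volume : Measure (Hor d))) else 0

/-- `ĥ` for a real valued `h`. -/
def hat {d : ℕ} (h : Hor d → ℝ) : Hor d → ℂ := l2Fourier fun x => (h x : ℂ)

/-- The squared norm of `H^s(Σ)`, `∫ (1 + |ξ|²)^s |ĥ(ξ)|² dξ`. -/
def sobolevSq {d : ℕ} (s : ℝ) (h : Hor d → ℝ) : ℝ≥0∞ :=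
  ∫⁻ ξ, ENNReal.ofReal ((1 + ‖ξ‖ ^ 2) ^ s) * ‖hat h ξ‖ₑ ^ 2

/-- The squared norm of `H^s_x(L²_y)`, `∫₀^ℓ ∫ (1 + |ξ|²)^s |û(ξ, y)|² dξ dy`. -/
def sobolevSlabSq {d : ℕ} (ℓ s : ℝ) (u : Hor d × ℝ → Vel d) : ℝ≥0∞ :=
  ∫⁻ y in Ioo 0 ℓ, ∑ i, sobolevSq s (fun x => u (x, y) i)

/-- The squared norm of `L²_y(L¹_x)`, `∫₀^ℓ (∫ |u(x, y)| dx)² dy`. -/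
def mixedSq {d : ℕ} (ℓ : ℝ) (u : Hor d × ℝ → Vel d) : ℝ≥0∞ :=
  ∫⁻ y in Ioo 0 ℓ, (∫⁻ x, ‖u (x, y)‖ₑ) ^ 2

/-- `k = M(h)`, where `M` is the Fourier multiplication operator with symbol `μ`. -/
def IsMultiplier {d : ℕ} (μ : Hor d → ℝ) (h k : L2Hor d) : Prop :=
  ∀ᵐ ξ : Hor d, hat k ξ = (μ ξ : ℂ) * hat h ξ

/-- The symbol `μ(ξ) = g + σ (2π|ξ|)^{2r}`. -/
def symbol (d : ℕ) (g σ r : ℝ) (ξ : Hor d) : ℝ := g + σ * (2 * Real.pi * ‖ξ‖) ^ (2 * r)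

/-- The energy `½ ∫_Ω |u|² + ½ ∫_Σ M(h) h`, with the second term written on the Fourier side as
`½ ∫ μ(ξ) |ĥ(ξ)|² dξ`. -/
def energy {d : ℕ} {ℓ : ℝ} (μ : Hor d → ℝ) (u : L2Slab d ℓ) (h : L2Hor d) : ℝ≥0∞ :=
  2⁻¹ * (∫⁻ z in slab d ℓ, ‖u z‖ₑ ^ 2) + 2⁻¹ * ∫⁻ ξ, ENNReal.ofReal (μ ξ) * ‖hat h ξ‖ₑ ^ 2

/-! ## Weak solutions -/

/-- `f ∈ L²_loc([0, ∞); X)`. -/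
def MemL2Loc {X : Type*} [NormedAddCommGroup X] (f : ℝ → X) : Prop :=
  ∀ T : ℝ, 0 < T → MemLp f 2 (volume.restrict (Ioc 0 T))

/-- `g` is the weak derivative of `f` on the time interval `(0, ∞)`. -/
def IsWeakTimeDeriv {X : Type*} [NormedAddCommGroup X] [NormedSpace ℝ X] (f g : ℝ → X) : Prop :=
  ∀ φ : ℝ → ℝ, ContDiff ℝ ∞ φ → HasCompactSupport φ → tsupport φ ⊆ Ioi 0 →
    ∫ t in Ioi (0 : ℝ), deriv φ t • f t = - ∫ t in Ioi (0 : ℝ), φ t • g t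

/-- `f` takes the initial value `f₀`: the essential limit of `f(t)` as `t → 0⁺` is `f₀`. -/
def HasInitialValue {X : Type*} [NormedAddCommGroup X] (f : ℝ → X) (f₀ : X) : Prop :=
  Tendsto f (𝓝 0 ⊓ ae (volume.restrict (Ioi (0 : ℝ)))) (𝓝 f₀)

/-- `(u, h)` is a weak solution with symbol `μ` and initial data `(u₀, h₀)`.  The functions `dtu`,
`dth`, `Mh` are `∂ₜu`, `∂ₜh`, `M(h)`, which are determined by `u` and `h`.  The incompressibility and
the no-slip condition are part of the membership in `solenoidal d ℓ`. -/
structure IsWeakSolutionWith {d : ℕ} {ℓ : ℝ} (μ : Hor d → ℝ) (u₀ : L2Slab d ℓ) (h₀ : L2Hor d)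
    (u : ℝ → solenoidal d ℓ) (h : ℝ → L2Hor d)
    (dtu : ℝ → StrongDual ℝ (solenoidal d ℓ)) (dth Mh : ℝ → L2Hor d) : Prop where
  memL2Loc_u : MemL2Loc u
  memL2Loc_dtu : MemL2Loc dtu
  deriv_u : IsWeakTimeDeriv (fun t => toDual d ℓ (u t)) dtu
  memL2Loc_h : MemL2Loc h
  memL2Loc_Mh : MemL2Loc Mh
  multiplier : ∀ᵐ t ∂(volume.restrict (Ioi (0 : ℝ))), IsMultiplier μ (h t) (Mh t)
  /-- `∂ₜh ∈ L²_loc([0, ∞); H^{1/2}(Σ))`, in two parts. -/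
  memL2Loc_dth : MemL2Loc dth
  sobolev_dth : ∀ T : ℝ, 0 < T → ∫⁻ t in Ioc 0 T, sobolevSq (1 / 2) (dth t) < ⊤
  deriv_h : IsWeakTimeDeriv h dth
  /-- `[∂ₜu, v] + ½ (𝔻u, 𝔻v) + ∫_{y = ℓ} M(h) v_N = 0`. -/
  momentum : ∀ T : ℝ, 0 < T → ∀ v : ℝ → solenoidal d ℓ, MemLp v 2 (volume.restrict (Ioc 0 T)) →
    ∀ᵐ t ∂(volume.restrict (Ioc 0 T)), ∀ τ : L2Hor d, IsTopTrace (v t) τ →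
      dtu t (v t) + 1 / 2 * symGradInner (u t) (v t) + ∫ x : Hor d, Mh t x * τ x = 0
  /-- `∂ₜh = u_N` on `{y = ℓ}`. -/
  kinematic : ∀ᵐ t ∂(volume.restrict (Ioi (0 : ℝ))), IsTopTrace (u t) (dth t)
  initial_u : HasInitialValue (fun t => toL2 d ℓ (u t)) u₀
  initial_h : HasInitialValue h h₀

/-- `(u, h)` is a weak solution with symbol `μ` and initial data `(u₀, h₀)`. -/
def IsWeakSolution {d : ℕ} {ℓ : ℝ} (μ : Hor d → ℝ) (u₀ : L2Slab d ℓ) (h₀ : L2Hor d)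
    (u : ℝ → solenoidal d ℓ) (h : ℝ → L2Hor d) : Prop :=
  ∃ (dtu : ℝ → StrongDual ℝ (solenoidal d ℓ)) (dth Mh : ℝ → L2Hor d),
    IsWeakSolutionWith μ u₀ h₀ u h dtu dth Mh

/-- `F` is the representative of `f` (a function of time, given up to null sets) that is continuous
on `[0, ∞)`. -/
def IsContinuousRepr {X : Type*} [NormedAddCommGroup X] (f F : ℝ → X) : Prop :=
  ContinuousOn F (Ici 0) ∧ ∀ᵐ t ∂(volume.restrict (Ioi (0 : ℝ))), F t = f t

end FluidSlab

end

/-! Write d = N - 1. The slab, the divergence, the bottom condition, the top trace and M are all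
invariant under horizontal translations. Horizontal convolution K with an even kernel therefore
commutes with the whole problem, and when the kernel's symbol is a bump on |ξ| ~ a it isolates one
frequency shell.

In a shell, testing the momentum equation with KKu gives the energy identity: ½‖Ku‖² + ½‖√μ m(D)h‖²
has derivative -½‖𝔻Ku‖², m being the bump. Korn's inequality (`norm_sq_le_dissip`) turns this into
control of Ku, but nothing damps h directly. The damping comes from a cross term ε(u, Ψh), where Ψ =
K ∘ `lift` ∘ K and `lift` extends a surface function to a divergence-free field vanishing at the
bottom. Testing with Ψh produces -ε‖√μ m(D)h‖². The price is one term in 𝔻Ku paired with the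
gradient of the lift, and one with the lift of ∂ₜh. Since ∂ₜh is the trace of u_N,
`exists_trace_bound` controls the latter by the dissipation. For small ε both are absorbed and the
modified energy is comparable to the energy, so Grönwall gives exponential decay in the shell
(`IsWeakSolutionWith.shell_decay`).

How small ε must be decides the rate. With vertical profile (y/ℓ)^(m+2) and m ~ a, the lift is a
boundary layer of width ~ 1/a at high frequency. Its squared L² norm is of order a⁻² + a⁻¹, its
dissipation of order a⁻² + a, and μ is bounded below by a multiple of 1 + a^(2r). The largest
admissible ε is then comparable to `rate r a` = min(a², 1, a^(2r-1)) (`exists_shell_rate`).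

Summing over dyadic shells bounds the energy at time t by the data weighted with exp(-c·`rate r
|ξ|`·t). For |ξ| ≤ 1 the weight is at most a heat kernel; as |û₀| and |ĥ₀| are bounded by L¹ norms,
the Gaussian mass yields (1+t)^(-d/2). For |ξ| ≥ 1 the rate is min(1, |ξ|^(2r-1)); if r < ½ it
degenerates, and trading exponential for algebraic decay costs the Sobolev weight (1+|ξ|²)^p with p
= d/2·(½ - r) (`exists_decay_weight`). The surface needs r further derivatives because its energy
carries μ.

Weak solutions are not smooth in time, so the energy identities rest on the Gelfand-triple product
rule (`IsEvolution.weakDeriv_normSq`). It is proved for an arbitrary bounded map ι : V → H, so that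
it applies equally to the localised norms. -/

noncomputable section

namespace FluidSlab

/-! ### Weak time derivatives and primitives on the half line -/

section TimeCalculus

/-- The almost everywhere filter of the positive half line. -/
abbrev posTimes : Measure ℝ := volume.restrict (Ioi (0 : ℝ))

/-- Local integrability on `[0, ∞)`. -/
def MemL1Loc {X : Type*} [NormedAddCommGroup X] (f : ℝ → X) : Prop :=
  ∀ T : ℝ, 0 < T → IntegrableOn f (Ioc 0 T)

/-- `p` agrees almost everywhere with `c + ∫₀ᵗ q`. -/
def IsPrimitive {X : Type*} [NormedAddCommGroup X] [NormedSpace ℝ X] (p q : ℝ → X) (c : X) : Prop :=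
  ∀ᵐ t ∂posTimes, p t = c + ∫ s in (0 : ℝ)..t, q s

variable {X : Type*} [NormedAddCommGroup X]

lemma MemL2Loc.memL1Loc {f : ℝ → X} (hf : MemL2Loc f) : MemL1Loc f := fun T hT =>
  (hf T hT).integrable one_le_two

lemma MemL1Loc.intervalIntegrable {f : ℝ → X} (hf : MemL1Loc f) {a b : ℝ} (ha : 0 ≤ a)
    (hb : 0 ≤ b) : IntervalIntegrable f volume a b := by
  have key : ∀ c : ℝ, 0 ≤ c → IntervalIntegrable f volume 0 c := fun c hc => by
    rcases hc.eq_or_lt with rfl | hc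
    · exact IntervalIntegrable.refl
    · exact (intervalIntegrable_iff_integrableOn_Ioc_of_le hc.le).2 (hf c hc)
  exact (key a ha).symm.trans (key b hb)

lemma MemL1Loc.locallyIntegrableOn {f : ℝ → X} (hf : MemL1Loc f) :
    LocallyIntegrableOn f (Ioi 0) := by
  intro t ht
  refine ⟨Ioc 0 (t + 1), ?_, hf _ (by have := mem_Ioi.1 ht; linarith)⟩
  refine mem_nhdsWithin_of_mem_nhds (Ioc_mem_nhds ht (by linarith))

lemma MemL1Loc.sub {f g : ℝ → X} (hf : MemL1Loc f) (hg : MemL1Loc g) :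
    MemL1Loc (fun t => f t - g t) := fun T hT => (hf T hT).sub (hg T hT)

lemma MemL1Loc.add {f g : ℝ → X} (hf : MemL1Loc f) (hg : MemL1Loc g) :
    MemL1Loc (fun t => f t + g t) := fun T hT => (hf T hT).add (hg T hT)

lemma ae_posTimes_iff {p : ℝ → Prop} : (∀ᵐ t ∂posTimes, p t) ↔ ∀ᵐ t : ℝ, 0 < t → p t :=
  ae_restrict_iff' measurableSet_Ioi

lemma ae_posTimes_of_forall_Ioc {p : ℝ → Prop}
    (h : ∀ T : ℝ, 0 < T → ∀ᵐ t ∂(volume.restrict (Ioc 0 T)), p t) : ∀ᵐ t ∂posTimes, p t := by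
  rw [ae_posTimes_iff]
  have h1 : ∀ᵐ t : ℝ, ∀ n : ℕ, t ∈ Ioc (0 : ℝ) (n + 1) → p t :=
    ae_all_iff.2 fun n => (ae_restrict_iff' measurableSet_Ioc).1 (h _ (by positivity))
  filter_upwards [h1] with t ht h0
  obtain ⟨n, hn⟩ := exists_nat_ge t
  exact ht n ⟨h0, by linarith⟩

/-- The initial filter of essential limits as `t → 0⁺`. -/
abbrev initialFilter : Filter ℝ := 𝓝 0 ⊓ ae (volume.restrict (Ioi (0 : ℝ)))

/-- Each interval (0, ε) has positive measure. This is what makes essential limits at 0⁺ unique. -/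
instance initialFilter_neBot : initialFilter.NeBot := by
  rw [initialFilter, inf_neBot_iff]
  intro s hs t ht
  obtain ⟨ε, hε, hs⟩ := Metric.mem_nhds_iff.1 hs
  by_contra hne
  have h1 : ∀ᵐ x : ℝ, ¬ x ∈ Ioo 0 ε := by
    filter_upwards [(ae_posTimes_iff (p := fun x => x ∈ t)).1 ht] with x hx h
    refine hne ⟨x, hs ?_, hx h.1⟩
    simp only [Metric.mem_ball, dist_zero_right, Real.norm_eq_abs, abs_lt]
    exact ⟨by linarith [h.1], h.2⟩
  have : volume (Ioo (0 : ℝ) ε) = 0 := by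
    rw [ae_iff] at h1
    simpa only [not_not, ofPred_mem_eq] using h1
  rw [Real.volume_Ioo, ENNReal.ofReal_eq_zero] at this
  linarith

lemma eventually_initialFilter {p : ℝ → Prop} (h : ∀ᵐ t ∂posTimes, p t) :
    ∀ᶠ t in initialFilter, p t := mem_inf_of_right h

variable [NormedSpace ℝ X]

lemma MemL1Loc.continuousOn_primitive {q : ℝ → X} (hq : MemL1Loc q) (c : X) :
    ContinuousOn (fun t => c + ∫ s in (0 : ℝ)..t, q s) (Ici 0) := by
  intro t ht
  have ht' : (0 : ℝ) ≤ t := ht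
  have h := intervalIntegral.continuousOn_primitive_interval' (a := 0)
    (hq.intervalIntegrable le_rfl (by linarith : (0 : ℝ) ≤ t + 1)) left_mem_uIcc
  rw [uIcc_of_le (by linarith)] at h
  refine (continuousWithinAt_const.add ((h t ⟨ht', by linarith⟩).mono_of_mem_nhdsWithin ?_))
  rw [← Ici_inter_Iic]
  exact inter_mem self_mem_nhdsWithin (mem_nhdsWithin_of_mem_nhds (Iic_mem_nhds (by linarith)))

lemma tendsto_initialFilter_of_continuousOn {Y : Type*} [TopologicalSpace Y] {P : ℝ → Y}
    (hP : ContinuousOn P (Ici 0)) : Tendsto P initialFilter (𝓝 (P 0)) := by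
  refine (hP 0 self_mem_Ici).tendsto.mono_left ?_
  rw [nhdsWithin]
  refine inf_le_inf le_rfl (le_principal_iff.2 ?_)
  filter_upwards [ae_restrict_mem measurableSet_Ioi] with t ht using le_of_lt (mem_Ioi.1 ht)

/-- Identifies the constant of integration: the primitive is continuous at 0, so its value there is
the essential limit. -/
lemma IsPrimitive.initial {p q : ℝ → X} {c c' : X} (hq : MemL1Loc q) (h : IsPrimitive p q c)
    (h0 : Tendsto p initialFilter (𝓝 c')) : c = c' := by
  have h1 := tendsto_initialFilter_of_continuousOn (hq.continuousOn_primitive c)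
  simp only [intervalIntegral.integral_same, add_zero] at h1
  exact tendsto_nhds_unique (h1.congr' (by
    filter_upwards [eventually_initialFilter h] with t ht using ht.symm)) h0

/-- Integration by parts for a primitive against a test function. -/
lemma integral_deriv_smul_primitive [CompleteSpace X] {g : ℝ → X} (hg : MemL1Loc g) {φ : ℝ → ℝ}
    (hφ : ContDiff ℝ ∞ φ) (hc : HasCompactSupport φ) :
    ∫ t in Ioi (0 : ℝ), deriv φ t • (∫ s in (0 : ℝ)..t, g s) = - ∫ t in Ioi (0 : ℝ), φ t • g t := by
  obtain ⟨R, hR, hball⟩ := hc.isCompact.isBounded.subset_ball_lt 0 0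
  have hzero : ∀ t, R ≤ t → φ t = 0 := fun t ht => by
    by_contra h
    have := hball (subset_tsupport _ h)
    simp only [Metric.mem_ball, dist_zero_right, Real.norm_eq_abs, abs_lt] at this
    linarith
  have hzero' : ∀ t, R ≤ t → deriv φ t = 0 := fun t ht => by
    by_contra h
    have := hball (tsupport_deriv_subset (subset_tsupport _ h))
    simp only [Metric.mem_ball, dist_zero_right, Real.norm_eq_abs, abs_lt] at this
    linarith
  have hdc : Continuous (deriv φ) := hφ.continuous_deriv (by simp)
  have hred : ∀ (a : ℝ → ℝ) (F : ℝ → X), (∀ t, R ≤ t → a t = 0) →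
      ∫ t in Ioi (0 : ℝ), a t • F t = ∫ t in Ioc 0 R, a t • F t := fun a F ha => by
    refine setIntegral_eq_of_subset_of_forall_sdiff_eq_zero measurableSet_Ioi Ioc_subset_Ioi_self ?_
    rintro t ⟨h1, h2⟩
    rw [ha t, zero_smul]
    by_contra h3
    exact h2 ⟨h1, (not_le.1 h3).le⟩
  rw [hred _ _ hzero', hred _ _ hzero]
  set ν := (volume : Measure ℝ).restrict (Ioc 0 R) with hν
  have h1 : ∀ t ∈ Ioc (0 : ℝ) R, deriv φ t • (∫ s in (0 : ℝ)..t, g s)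
      = ∫ s, (Iic t).indicator (fun s => deriv φ t • g s) s ∂ν := fun t ht => by
    rw [integral_indicator measurableSet_Iic, hν, Measure.restrict_restrict measurableSet_Iic,
      integral_smul, intervalIntegral.integral_of_le ht.1.le]
    congr 3
    ext s
    simp only [mem_Ioc, mem_inter_iff, mem_Iic]
    exact ⟨fun h => ⟨h.2, h.1, h.2.trans ht.2⟩, fun h => ⟨h.2.1, h.1⟩⟩
  rw [setIntegral_congr_fun measurableSet_Ioc h1, integral_integral_swap]
  · rw [← integral_neg]
    refine setIntegral_congr_fun measurableSet_Ioc fun s hs => ?_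
    have : ∀ t, (Iic t).indicator (fun s => deriv φ t • g s) s
        = (Ici s).indicator (fun t => deriv φ t • g s) t := fun t => by
      by_cases h : s ≤ t <;> simp [h]
    simp only [this]
    rw [integral_indicator measurableSet_Ici, Measure.restrict_restrict measurableSet_Ici,
      integral_smul_const]
    have h2 : Ici s ∩ Ioc 0 R = Icc s R := by
      ext t
      simp only [mem_inter_iff, mem_Ici, mem_Ioc, mem_Icc]
      exact ⟨fun h => ⟨h.1, h.2.2⟩, fun h => ⟨h.1, hs.1.trans_le h.1, h.2⟩⟩
    rw [h2, integral_Icc_eq_integral_Ioc, ← intervalIntegral.integral_of_le hs.2,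
      intervalIntegral.integral_deriv_eq_sub (fun x _ => (hφ.differentiable (by simp)).differentiableAt)
        (hdc.intervalIntegrable _ _), hzero R le_rfl, zero_sub, neg_smul]
  · have h3 : Integrable (fun z : ℝ × ℝ => deriv φ z.1 • g z.2) (ν.prod ν) :=
      Integrable.smul_prod ((hdc.integrableOn_Icc (a := 0) (b := R)).mono_set Ioc_subset_Icc_self)
        (hg R hR)
    have h4 : MeasurableSet {z : ℝ × ℝ | z.2 ≤ z.1} := measurableSet_le measurable_snd measurable_fst
    refine (h3.indicator h4).congr (Eventually.of_forall fun z => ?_)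
    simp [Function.uncurry, indicator]

lemma MemL1Loc.integrableOn_smul {f : ℝ → X} (hf : MemL1Loc f) {φ : ℝ → ℝ} (hφ : Continuous φ)
    (hc : HasCompactSupport φ) : IntegrableOn (fun t => φ t • f t) (Ioi 0) := by
  obtain ⟨R, hR, hball⟩ := hc.isCompact.isBounded.subset_ball_lt 0 0
  obtain ⟨C, hC⟩ := hφ.bounded_above_of_compact_support hc
  have h1 : IntegrableOn (fun t => φ t • f t) (Ioc 0 R) :=
    (hf R hR).bdd_smul C hφ.aestronglyMeasurable (Eventually.of_forall hC)
  refine h1.of_forall_sdiff_eq_zero measurableSet_Ioi fun t ht => ?_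
  have hnot : t ∉ tsupport φ := fun h => by
    have := hball h
    simp only [Metric.mem_ball, dist_zero_right, Real.norm_eq_abs, abs_lt] at this
    exact ht.2 ⟨ht.1, this.2.le⟩
  rw [image_eq_zero_of_notMem_tsupport hnot, zero_smul]

/-- A function with vanishing weak derivative is almost everywhere constant. -/
lemma exists_ae_eq_const [CompleteSpace X] {f : ℝ → X} (hf : MemL1Loc f)
    (h : ∀ φ : ℝ → ℝ, ContDiff ℝ ∞ φ → HasCompactSupport φ → tsupport φ ⊆ Ioi 0 →
      ∫ t in Ioi (0 : ℝ), deriv φ t • f t = 0) : ∃ c, ∀ᵐ t ∂posTimes, f t = c := by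
  -- A fixed test function of unit mass supported in [1, 3]; the constant will be the average of `f`
  -- against it.
  let b : ContDiffBump (2 : ℝ) := ⟨1 / 2, 1, by norm_num, by norm_num⟩
  set θ : ℝ → ℝ := b.normed volume with hθ
  have hθc : ContDiff ℝ ∞ θ := b.contDiff_normed
  have hθs : HasCompactSupport θ := b.hasCompactSupport_normed
  have hθt : tsupport θ ⊆ Icc 1 3 := by
    rw [hθ, b.tsupport_normed_eq, Real.closedBall_eq_Icc]
    norm_num
  have hθ1 : ∫ t, θ t = 1 := b.integral_normed
  refine ⟨∫ t in Ioi (0 : ℝ), θ t • f t, ?_⟩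
  set c := ∫ t in Ioi (0 : ℝ), θ t • f t with hc
  have key := IsOpen.ae_eq_zero_of_integral_contDiff_smul_eq_zero (μ := volume) (U := Ioi (0 : ℝ))
    (f := fun t => f t - c) isOpen_Ioi
    (hf.locallyIntegrableOn.sub ((locallyIntegrable_const c).locallyIntegrableOn _)) ?_
  · rw [ae_posTimes_iff]
    filter_upwards [key] with t ht h0 using sub_eq_zero.1 (ht h0)
  intro ψ hψ hψc hψt
  set m := ∫ t, ψ t with hm
  -- Subtracting the mass of ψ leaves a function of mean zero. Its primitive then vanishes beyond
  -- the support, hence is an admissible test function with derivative ρ.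
  set ρ : ℝ → ℝ := fun t => ψ t - m * θ t with hρ
  have hρc : ContDiff ℝ ∞ ρ := hψ.sub (contDiff_const.mul hθc)
  have hρi : Integrable ρ := (hψ.continuous.integrable_of_hasCompactSupport hψc).sub
    ((hθc.continuous.integrable_of_hasCompactSupport hθs).const_mul m)
  have hρ0 : ∫ t, ρ t = 0 := by
    rw [hρ, integral_sub (hψ.continuous.integrable_of_hasCompactSupport hψc)
      ((hθc.continuous.integrable_of_hasCompactSupport hθs).const_mul m),
      integral_const_mul, hθ1, ← hm]; ring
  have hK : IsCompact (tsupport ψ ∪ Icc 1 3) := hψc.isCompact.union isCompact_Icc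
  have hKpos : tsupport ψ ∪ Icc 1 3 ⊆ Ioi 0 := union_subset hψt fun t ht =>
    lt_of_lt_of_le one_pos ht.1
  have hρK : ∀ t, t ∉ tsupport ψ ∪ Icc 1 3 → ρ t = 0 := fun t ht => by
    simp only [mem_union, not_or] at ht
    simp only [hρ]
    rw [image_eq_zero_of_notMem_tsupport ht.1,
      image_eq_zero_of_notMem_tsupport (fun h => ht.2 (hθt h))]; simp
  obtain ⟨α, hα, hαK⟩ : ∃ α, 0 < α ∧ ∀ t ∈ tsupport ψ ∪ Icc 1 3, α ≤ t := by
    obtain ⟨α, h1, h2⟩ := hK.exists_isLeast ⟨1, Or.inr ⟨le_rfl, by norm_num⟩⟩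
    exact ⟨α, hKpos h1, h2⟩
  obtain ⟨β, hβK⟩ : ∃ β, ∀ t ∈ tsupport ψ ∪ Icc 1 3, t ≤ β := by
    obtain ⟨β, h1, h2⟩ := hK.exists_isGreatest ⟨1, Or.inr ⟨le_rfl, by norm_num⟩⟩
    exact ⟨β, h2⟩
  set φ : ℝ → ℝ := fun t => ∫ s in (0 : ℝ)..t, ρ s with hφ
  have hder : ∀ t, HasDerivAt φ (ρ t) t := fun t =>
    intervalIntegral.integral_hasDerivAt_right (hρc.continuous.intervalIntegrable _ _)
      (hρc.continuous.stronglyMeasurableAtFilter _ _) hρc.continuous.continuousAt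
  have hderiv : deriv φ = ρ := funext fun t => (hder t).deriv
  have hφc : ContDiff ℝ ∞ φ := by
    rw [contDiff_infty_iff_deriv, hderiv]
    exact ⟨fun t => (hder t).differentiableAt, hρc⟩
  have hφ0 : ∀ t, t ∉ Icc α β → φ t = 0 := by
    intro t ht
    rcases lt_or_ge t α with h1 | h1
    · simp only [hφ]
      refine intervalIntegral.integral_zero_ae (Eventually.of_forall fun s hs => hρK s fun h => ?_)
      have h2 := hαK s h
      rcases le_total 0 t with h3 | h3
      · rw [uIoc_of_le h3] at hs; linarith [hs.2]
      · rw [uIoc_of_ge h3] at hs; linarith [hs.2]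
    · have h2 : β < t := by
        by_contra h; exact ht ⟨h1, not_lt.1 h⟩
      have h3 : ∫ s in (0 : ℝ)..t, ρ s = ∫ s, ρ s := by
        rw [intervalIntegral.integral_of_le (hα.le.trans h1)]
        refine setIntegral_eq_integral_of_forall_compl_eq_zero fun s hs => hρK s fun h => hs ?_
        exact ⟨hα.trans_le (hαK s h), (hβK s h).trans h2.le⟩
      simp only [hφ]
      rw [h3, hρ0]
  have hφs : HasCompactSupport φ := HasCompactSupport.intro isCompact_Icc hφ0
  have hφt : tsupport φ ⊆ Ioi 0 := by
    refine (closure_minimal (fun t ht => ?_) isClosed_Icc).trans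
      (fun t (ht : t ∈ Icc α β) => hα.trans_le ht.1)
    by_contra hh
    exact ht (hφ0 t hh)
  have h0 := h φ hφc hφs hφt
  rw [hderiv] at h0
  have i1 := hf.integrableOn_smul hψ.continuous hψc
  have i2 := hf.integrableOn_smul hθc.continuous hθs
  simp only [hρ, sub_smul, mul_smul] at h0
  have h0 : ∫ t in Ioi (0 : ℝ), (ψ t • f t - m • θ t • f t) = 0 := h0
  rw [integral_sub i1 (i2.fun_smul m), integral_smul, ← hc] at h0
  have hset : ∫ t, ψ t • (f t - c) = ∫ t in Ioi (0 : ℝ), ψ t • (f t - c) := by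
    symm
    refine setIntegral_eq_integral_of_forall_compl_eq_zero fun s hs => ?_
    rw [image_eq_zero_of_notMem_tsupport (fun h => hs (hψt h)), zero_smul]
  have hset' : m = ∫ t in Ioi (0 : ℝ), ψ t := by
    symm
    refine setIntegral_eq_integral_of_forall_compl_eq_zero fun s hs => ?_
    rw [image_eq_zero_of_notMem_tsupport (fun h => hs (hψt h))]
  rw [hset]
  simp only [smul_sub]
  rw [integral_sub i1 (((hψ.continuous.integrable_of_hasCompactSupport hψc).integrableOn).smul_const c),
    integral_smul_const, ← hset', h0]

lemma MemL1Loc.primitive [CompleteSpace X] {q : ℝ → X} (hq : MemL1Loc q) :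
    MemL1Loc (fun t => ∫ s in (0 : ℝ)..t, q s) := fun T _ => by
  have h := hq.continuousOn_primitive 0
  simp only [zero_add] at h
  exact ((h.mono Icc_subset_Ici_self).integrableOn_Icc).mono_set Ioc_subset_Icc_self

/-- A function with a locally integrable weak derivative is a primitive of it. -/
lemma exists_isPrimitive [CompleteSpace X] {f g : ℝ → X} (hf : MemL1Loc f) (hg : MemL1Loc g)
    (h : IsWeakTimeDeriv f g) : ∃ c, IsPrimitive f g c := by
  obtain ⟨c, hc⟩ := exists_ae_eq_const (hf.sub hg.primitive) (fun φ h1 h2 h3 => by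
    have i1 := hf.integrableOn_smul (h1.continuous_deriv (by simp)) h2.deriv
    have i2 := hg.primitive.integrableOn_smul (h1.continuous_deriv (by simp)) h2.deriv
    simp only [smul_sub]
    rw [integral_sub i1 i2, h φ h1 h2 h3,
      integral_deriv_smul_primitive hg h1 h2, sub_self])
  refine ⟨c, ?_⟩
  filter_upwards [hc] with t ht
  rw [← ht]; abel

end TimeCalculus

/-! ### The Gelfand triple: derivative of the squared norm -/

section Gelfand

/-- Multiplication of an `L²` function by a bounded continuous scalar function. -/
lemma memLp_top_of_continuous {α : Type*} [TopologicalSpace α] [MeasurableSpace α] [OpensMeasurableSpace α]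
    {μ : Measure α} {φ : α → ℝ} [SecondCountableTopologyEither α ℝ] (hφ : Continuous φ) {C : ℝ}
    (hC : ∀ t, ‖φ t‖ ≤ C) : MemLp φ ∞ μ :=
  memLp_top_of_bound hφ.aestronglyMeasurable C (Eventually.of_forall hC)

variable {V H : Type*} [NormedAddCommGroup V] [InnerProductSpace ℝ V]
  [NormedAddCommGroup H] [InnerProductSpace ℝ H]

/-- The functional `v ↦ (ι u, ι v)` attached to `u` by an embedding `ι : V → H`. -/
def rieszDual (ι : V →L[ℝ] H) (u : V) : StrongDual ℝ V := (innerSL ℝ (ι u)).comp ι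

@[simp] lemma rieszDual_apply (ι : V →L[ℝ] H) (u v : V) :
    rieszDual ι u v = inner ℝ (ι u) (ι v) := rfl

/-- `u ∈ L²_loc(V)` has a weak time derivative `g ∈ L²_loc(V*)` in the Gelfand triple of `ι`. -/
structure IsEvolution (ι : V →L[ℝ] H) (u : ℝ → V) (g : ℝ → StrongDual ℝ V) : Prop where
  memL2Loc : MemL2Loc u
  memL2Loc_deriv : MemL2Loc g
  weakDeriv : IsWeakTimeDeriv (fun t => rieszDual ι (u t)) g

lemma rieszDual_add (ι : V →L[ℝ] H) (u v : V) :
    rieszDual ι (u + v) = rieszDual ι u + rieszDual ι v := by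
  ext w; simp [inner_add_left]

lemma rieszDual_smul (ι : V →L[ℝ] H) (c : ℝ) (u : V) :
    rieszDual ι (c • u) = c • rieszDual ι u := by
  ext w; simp [inner_smul_left]

lemma norm_rieszDual_le (ι : V →L[ℝ] H) (u : V) : ‖rieszDual ι u‖ ≤ ‖ι‖ * ‖ι‖ * ‖u‖ := by
  refine ContinuousLinearMap.opNorm_le_bound _ (by positivity) fun v => ?_
  rw [rieszDual_apply]
  refine (norm_inner_le_norm _ _).trans ?_
  calc ‖ι u‖ * ‖ι v‖ ≤ (‖ι‖ * ‖u‖) * (‖ι‖ * ‖v‖) := by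
        gcongr <;> exact ι.le_opNorm _
    _ = _ := by ring

/-- The map `u ↦ (ι u, ι ·)` as a continuous linear map. -/
def rieszDualL (ι : V →L[ℝ] H) : V →L[ℝ] StrongDual ℝ V :=
  LinearMap.mkContinuous ⟨⟨rieszDual ι, rieszDual_add ι⟩, rieszDual_smul ι⟩ (‖ι‖ * ‖ι‖)
    (norm_rieszDual_le ι)

lemma MemL2Loc.clm {X Y : Type*} [NormedAddCommGroup X] [NormedSpace ℝ X] [NormedAddCommGroup Y]
    [NormedSpace ℝ Y] (L : X →L[ℝ] Y) {f : ℝ → X} (hf : MemL2Loc f) :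
    MemL2Loc (fun t => L (f t)) := fun T hT => L.comp_memLp' (hf T hT)

lemma MemL2Loc.add {X : Type*} [NormedAddCommGroup X] {f g : ℝ → X} (hf : MemL2Loc f)
    (hg : MemL2Loc g) : MemL2Loc (fun t => f t + g t) := fun T hT => (hf T hT).add (hg T hT)

lemma IsWeakTimeDeriv.add {X : Type*} [NormedAddCommGroup X] [NormedSpace ℝ X] {f f' g g' : ℝ → X}
    (hf : MemL1Loc f) (hf' : MemL1Loc f') (hg : MemL1Loc g) (hg' : MemL1Loc g')
    (h : IsWeakTimeDeriv f g) (h' : IsWeakTimeDeriv f' g') :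
    IsWeakTimeDeriv (fun t => f t + f' t) (fun t => g t + g' t) := fun φ h1 h2 h3 => by
  have hd := h1.continuous_deriv (by simp)
  simp only [smul_add]
  rw [integral_add (hf.integrableOn_smul hd h2.deriv) (hf'.integrableOn_smul hd h2.deriv),
    integral_add (hg.integrableOn_smul h1.continuous h2) (hg'.integrableOn_smul h1.continuous h2),
    h φ h1 h2 h3, h' φ h1 h2 h3, neg_add]

lemma IsWeakTimeDeriv.clm {X Y : Type*} [NormedAddCommGroup X] [NormedSpace ℝ X] [CompleteSpace X]
    [NormedAddCommGroup Y] [NormedSpace ℝ Y] [CompleteSpace Y] (L : X →L[ℝ] Y) {f g : ℝ → X}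
    (hf : MemL1Loc f) (hg : MemL1Loc g) (h : IsWeakTimeDeriv f g) :
    IsWeakTimeDeriv (fun t => L (f t)) (fun t => L (g t)) := fun φ h1 h2 h3 => by
  have hd := h1.continuous_deriv (by simp)
  simp only [← map_smul]
  rw [L.integral_comp_comm (hf.integrableOn_smul hd h2.deriv),
    L.integral_comp_comm (hg.integrableOn_smul h1.continuous h2), h φ h1 h2 h3, map_neg]

lemma IsEvolution.add {ι : V →L[ℝ] H} {u u' : ℝ → V} {g g' : ℝ → StrongDual ℝ V}
    (h : IsEvolution ι u g) (h' : IsEvolution ι u' g') :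
    IsEvolution ι (fun t => u t + u' t) (fun t => g t + g' t) where
  memL2Loc := h.memL2Loc.add h'.memL2Loc
  memL2Loc_deriv := h.memL2Loc_deriv.add h'.memL2Loc_deriv
  weakDeriv := by
    simp only [rieszDual_add]
    exact IsWeakTimeDeriv.add (h.memL2Loc.clm (rieszDualL ι)).memL1Loc
      (h'.memL2Loc.clm (rieszDualL ι)).memL1Loc h.memL2Loc_deriv.memL1Loc
      h'.memL2Loc_deriv.memL1Loc h.weakDeriv h'.weakDeriv

/-- Translation in `L²(ℝ; X)`. -/
def timeShift {X : Type*} [NormedAddCommGroup X] (h : ℝ) (f : Lp X 2 (volume : Measure ℝ)) :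
    Lp X 2 (volume : Measure ℝ) :=
  Lp.compMeasurePreserving (fun t => t + h) (measurePreserving_add_right volume h) f

lemma coeFn_timeShift {X : Type*} [NormedAddCommGroup X] (h : ℝ)
    (f : Lp X 2 (volume : Measure ℝ)) : timeShift h f =ᵐ[volume] fun t => f (t + h) :=
  Lp.coeFn_compMeasurePreserving f _

/-- Strong continuity of translations replaces any regularisation in time: it is the only limit tool
in the proof of `IsEvolution.weakDeriv_normSq`. -/
lemma continuous_timeShift {X : Type*} [NormedAddCommGroup X] (f : Lp X 2 (volume : Measure ℝ)) :
    Continuous fun h => timeShift h f := by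
  have hc : Continuous (fun h : ℝ => (⟨fun t => t + h, by fun_prop⟩ : C(ℝ, ℝ))) :=
    ContinuousMap.continuous_of_continuous_uncurry _ (by
      change Continuous fun z : ℝ × ℝ => z.2 + z.1
      fun_prop)
  exact Continuous.compMeasurePreservingLp (μ := volume) (ν := volume) (continuous_const (y := f)) hc
    (fun h => measurePreserving_add_right volume h) (by simp)

/-- Domination by ‖G(t+s)‖² + ‖W(t)‖²; it licenses the exchange of the time integral with the
integral over the shift. -/
lemma integrable_pairing_shift (G : Lp (StrongDual ℝ V) 2 (volume : Measure ℝ))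
    (W : Lp V 2 (volume : Measure ℝ)) (h : ℝ) :
    Integrable (fun z : ℝ × ℝ => G (z.1 + z.2) (W z.1))
      ((volume : Measure ℝ).prod (volume.restrict (Ioc 0 h))) := by
  have i1 : Integrable (fun z : ℝ × ℝ => ‖G (z.1 + z.2)‖ ^ 2)
      ((volume : Measure ℝ).prod (volume.restrict (Ioc 0 h))) := by
    have h1 : Integrable (fun z : ℝ × ℝ => ‖G z.1‖ ^ 2)
        ((volume : Measure ℝ).prod (volume.restrict (Ioc 0 h))) :=
      ((Lp.memLp G).integrable_norm_pow two_ne_zero).comp_fst _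
    exact (measurePreserving_add_prod volume (volume.restrict (Ioc 0 h))).integrable_comp_of_integrable h1
  have i2 : Integrable (fun z : ℝ × ℝ => ‖W z.1‖ ^ 2)
      ((volume : Measure ℝ).prod (volume.restrict (Ioc 0 h))) :=
    ((Lp.memLp W).integrable_norm_pow two_ne_zero).comp_fst _
  refine (i1.add i2).mono' ?_ (Eventually.of_forall fun z => ?_)
  · have m1 : StronglyMeasurable fun z : ℝ × ℝ => G (z.1 + z.2) :=
      (Lp.stronglyMeasurable G).comp_measurable (measurable_fst.add measurable_snd)
    have m2 : StronglyMeasurable fun z : ℝ × ℝ => W z.1 :=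
      (Lp.stronglyMeasurable W).comp_measurable measurable_fst
    exact (isBoundedBilinearMap_apply (𝕜 := ℝ) (E := V) (F := ℝ)).continuous.comp_stronglyMeasurable
      (m1.prodMk m2) |>.aestronglyMeasurable
  · refine ((G (z.1 + z.2)).le_opNorm _).trans ?_
    simp only [Pi.add_apply]
    nlinarith [sq_nonneg (‖G (z.1 + z.2)‖ - ‖W z.1‖), sq_nonneg ‖G (z.1 + z.2)‖, sq_nonneg ‖W z.1‖]

/-- (a - b, a + b) = |a|² - |b|²: an increment of the squared norm is an increment of the
functional, which is an integral of the derivative, applied to an element of V. -/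
lemma rieszDual_sub_apply_add (ι : V →L[ℝ] H) (a b : V) :
    (rieszDual ι a - rieszDual ι b) (a + b) = ‖ι a‖ ^ 2 - ‖ι b‖ ^ 2 := by
  simp only [sub_apply, rieszDual_apply, map_add,
    real_inner_self_eq_norm_sq]
  rw [real_inner_comm (ι a) (ι b)]
  ring

/-- In a Gelfand triple, `‖ι u‖²` has weak derivative `2 ⟨g, u⟩`. -/
lemma IsEvolution.weakDeriv_normSq [CompleteSpace V] {ι : V →L[ℝ] H} {u : ℝ → V}
    {g : ℝ → StrongDual ℝ V} (h : IsEvolution ι u g) :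
    IsWeakTimeDeriv (fun t => ‖ι (u t)‖ ^ 2) (fun t => 2 * g t (u t)) := by
  intro φ hφ hφc hφt
  obtain ⟨α, hα, hαφ⟩ : ∃ α, 0 < α ∧ ∀ t, φ t ≠ 0 → α ≤ t := by
    rcases (tsupport φ).eq_empty_or_nonempty with he | hne
    · exact ⟨1, one_pos, fun t ht => by simpa [he] using subset_tsupport _ ht⟩
    · obtain ⟨α, h1, h2⟩ := hφc.isCompact.exists_isLeast hne
      exact ⟨α, hφt h1, fun t ht => h2 (subset_tsupport _ ht)⟩
  obtain ⟨β, hβ, hβφ⟩ : ∃ β, 0 < β ∧ ∀ t ∈ tsupport φ, t ≤ β := by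
    obtain ⟨R, hR, hball⟩ := hφc.isCompact.isBounded.subset_ball_lt 0 0
    refine ⟨R, hR, fun t ht => ?_⟩
    have := hball ht
    simp only [Metric.mem_ball, dist_zero_right, Real.norm_eq_abs, abs_lt] at this
    exact this.2.le
  obtain ⟨C, hC⟩ := hφ.continuous.bounded_above_of_compact_support hφc
  have hdc : Continuous (deriv φ) := hφ.continuous_deriv (by simp)
  obtain ⟨C', hC'⟩ := hdc.bounded_above_of_compact_support hφc.deriv
  set T := β + 1 with hT
  have hT0 : 0 < T := by linarith
  have mu : MemLp ((Ioc 0 T).indicator u) 2 volume :=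
    (memLp_indicator_iff_restrict measurableSet_Ioc).2 (h.memL2Loc T hT0)
  have mg : MemLp ((Ioc 0 T).indicator g) 2 volume :=
    (memLp_indicator_iff_restrict measurableSet_Ioc).2 (h.memL2Loc_deriv T hT0)
  set U := mu.toLp with hU
  set G := mg.toLp with hG
  have hUae : ∀ᵐ t, t ∈ Ioc 0 T → U t = u t := by
    filter_upwards [mu.coeFn_toLp] with t ht h1
    rw [hU, ht, indicator_of_mem h1]
  have hGae : ∀ᵐ t, t ∈ Ioc 0 T → G t = g t := by
    filter_upwards [mg.coeFn_toLp] with t ht h1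
    rw [hG, ht, indicator_of_mem h1]
  set p : ℝ → ℝ := fun t => ‖ι (U t)‖ ^ 2 with hp
  have hpi : Integrable p :=
    (ι.comp_memLp' (Lp.memLp U)).integrable_norm_pow two_ne_zero
  -- The derivative of Q at 0 is computed twice. With the shift on φ it is -∫ φ' p; with the shift
  -- on p it is a limit of increments of ‖ι u‖².
  set Q : ℝ → ℝ := fun s => ∫ t, φ (t - s) * p t with hQ
  have hQ' : ∀ s, Q s = ∫ t, φ t * p (t + s) := fun s => by
    simp only [hQ]
    rw [← integral_add_right_eq_self (fun t => φ (t - s) * p t) s]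
    simp
  have hQd : HasDerivAt Q (∫ t, -deriv φ t * p t) 0 := by
    have := hasDerivAt_integral_of_dominated_loc_of_deriv_le (μ := volume) (x₀ := (0 : ℝ))
      (F := fun s t => φ (t - s) * p t) (F' := fun s t => -deriv φ (t - s) * p t)
      (bound := fun t => C' * |p t|) (s := univ) univ_mem
      (Eventually.of_forall fun s => ((hφ.continuous.comp (by fun_prop)).aestronglyMeasurable.mul
        hpi.aestronglyMeasurable)) ?_ ?_ ?_ (hpi.abs.const_mul C') ?_
    · simpa using this.2
    · simpa using (hpi.bdd_mul (c := C) hφ.continuous.aestronglyMeasurable (Eventually.of_forall hC))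
    · simp only [sub_zero]
      exact hdc.neg.aestronglyMeasurable.mul hpi.aestronglyMeasurable
    · refine Eventually.of_forall fun t s _ => ?_
      rw [norm_mul, norm_neg, Real.norm_eq_abs (p t)]
      gcongr
      exact hC' _
    · refine Eventually.of_forall fun t s _ => ?_
      have h1 : HasDerivAt φ (deriv φ (t - s)) (t - s) :=
        (hφ.differentiable (by simp)).differentiableAt.hasDerivAt
      have h2 : HasDerivAt (fun s => t - s) (-1) s := by
        simpa using (hasDerivAt_id s).const_sub t
      convert! (h1.comp s h2).mul_const (p t) using 1
      ring
  -- the pairing with translates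
  let φL : Lp ℝ ∞ (volume : Measure ℝ) := (memLp_top_of_continuous hφ.continuous hC).toLp φ
  let mulφ : Lp V 2 (volume : Measure ℝ) →L[ℝ] Lp V 2 (volume : Measure ℝ) :=
    (ContinuousLinearMap.lsmul ℝ ℝ).holderL volume ∞ 2 2 φL
  have hmul : ∀ w : Lp V 2 (volume : Measure ℝ), mulφ w =ᵐ[volume] fun t => φ t • w t := fun w => by
    filter_upwards [ContinuousLinearMap.coeFn_holder (r := 2)
      (ContinuousLinearMap.lsmul ℝ ℝ : ℝ →L[ℝ] V →L[ℝ] V) φL w,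
      (memLp_top_of_continuous (μ := volume) hφ.continuous hC).coeFn_toLp] with t h1 h2
    refine h1.trans ?_
    rw [h2]; rfl
  let pair : Lp (StrongDual ℝ V) 2 (volume : Measure ℝ) →L[ℝ] Lp V 2 (volume : Measure ℝ) →L[ℝ] ℝ :=
    ContinuousLinearMap.lpPairing volume 2 2 (ContinuousLinearMap.id ℝ (StrongDual ℝ V))
  let W : ℝ → Lp V 2 (volume : Measure ℝ) := fun s => mulφ (timeShift s U + U)
  -- R(s, r) = ∫ ⟨G(t+s), φ(t)(U(t+r) + U(t))⟩ dt. It is jointly continuous, and at (0, 0) it is ∫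
  -- φ·2⟨g, u⟩.
  let R : ℝ × ℝ → ℝ := fun z => pair (timeShift z.1 G) (W z.2)
  have hRc : Continuous R := by
    have c1 : Continuous fun z : ℝ × ℝ => timeShift z.1 G :=
      (continuous_timeShift G).comp continuous_fst
    have c2 : Continuous fun z : ℝ × ℝ => W z.2 :=
      mulφ.continuous.comp (((continuous_timeShift U).comp continuous_snd).add continuous_const)
    exact (pair.continuous.comp c1).clm_apply c2
  have hR : ∀ s r, R (s, r) = ∫ t, G (t + s) (W r t) := fun s r => by
    simp only [R, pair]
    rw [ContinuousLinearMap.lpPairing_eq_integral]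
    refine integral_congr_ae ?_
    filter_upwards [coeFn_timeShift s G] with t ht
    rw [ht]; rfl
  have hWae : ∀ r, ∀ᵐ t, W r t = φ t • (U (t + r) + U t) := fun r => by
    filter_upwards [hmul (timeShift r U + U), Lp.coeFn_add (timeShift r U) U,
      coeFn_timeShift r U] with t h1 h2 h3
    simp only [W]
    rw [h1, h2, Pi.add_apply, h3]
  obtain ⟨c, hc⟩ := exists_isPrimitive (h.memL2Loc.clm (rieszDualL ι)).memL1Loc
    h.memL2Loc_deriv.memL1Loc h.weakDeriv
  have hgood : ∀ᵐ t, t ∈ Ioc 0 T → rieszDual ι (U t) = c + ∫ s in (0 : ℝ)..t, g s := by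
    filter_upwards [hUae, ae_posTimes_iff.1 hc] with t h1 h2 h3
    rw [h1 h3]; exact h2 h3.1
  -- Expand |a|² - |b|² as (a - b, a + b), write the first factor as ∫₀ʳ g(t+s) ds, and use Fubini
  -- in (t, s). The difference quotient of Q is then a mean of R over [0, r].
  have hincr : ∀ r, 0 < r → r < 1 → Q r - Q 0 = ∫ s in (0 : ℝ)..r, R (s, r) := by
    intro r hr0 hr1
    have hsw := integral_integral_swap (f := fun t s => G (t + s) (W r t))
      (μ := volume) (ν := volume.restrict (Ioc 0 r)) (integrable_pairing_shift G (W r) r)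
    rw [intervalIntegral.integral_of_le hr0.le]
    simp only [hR]
    rw [← hsw, hQ', hQ', ← integral_sub]
    · refine integral_congr_ae ?_
      have hsh : ∀ᵐ t, t + r ∈ Ioc 0 T → rieszDual ι (U (t + r)) = c + ∫ s in (0 : ℝ)..(t + r), g s :=
        (measurePreserving_add_right volume r).quasiMeasurePreserving.ae hgood
      filter_upwards [hWae r, hgood, hsh] with t h1 h2 h3
      simp only [h1, add_zero]
      by_cases h0 : φ t = 0
      · simp [h0]
      have ht0 : α ≤ t := hαφ t h0
      have ht1 : t ≤ β := hβφ t (subset_tsupport _ h0)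
      have e1 := h2 ⟨by linarith, by linarith⟩
      have e2 := h3 ⟨by linarith, by linarith⟩
      have ig : ∀ a b : ℝ, 0 ≤ a → 0 ≤ b → IntervalIntegrable g volume a b := fun a b ha hb =>
        h.memL2Loc_deriv.memL1Loc.intervalIntegrable ha hb
      have e3 : rieszDual ι (U (t + r)) - rieszDual ι (U t) = ∫ s in t..(t + r), g s := by
        rw [e1, e2, ← intervalIntegral.integral_interval_sub_left (ig 0 (t + r) le_rfl (by linarith))
          (ig 0 t le_rfl (by linarith))]
        abel
      have e4 := rieszDual_sub_apply_add ι (U (t + r)) (U t)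
      have e5 : ∫ s in t..(t + r), g s = ∫ s in Ioc 0 r, G (t + s) := by
        rw [← intervalIntegral.integral_of_le hr0.le,
          intervalIntegral.integral_comp_add_left (fun s => G s) t, add_zero]
        refine intervalIntegral.integral_congr_ae ?_
        filter_upwards [hGae] with s hs h4
        rw [uIoc_of_le (by linarith)] at h4
        exact (hs ⟨by linarith [h4.1], by linarith [h4.2]⟩).symm
      have iG : Integrable (fun s => G (t + s)) (volume.restrict (Ioc 0 r)) := by
        have h5 : MemLp (fun s => G (t + s)) 2 volume :=
          (Lp.memLp G).comp_measurePreserving (measurePreserving_add_left volume t)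
        exact (h5.restrict (Ioc 0 r)).integrable one_le_two
      rw [← ContinuousLinearMap.integral_apply iG, ← e5, ← e3, map_smul, e4]
      simp only [hp, smul_eq_mul]
      ring
    · exact (hpi.comp_add_right r).bdd_mul (c := C) hφ.continuous.aestronglyMeasurable
        (Eventually.of_forall hC)
    · simpa using hpi.bdd_mul (c := C) hφ.continuous.aestronglyMeasurable (Eventually.of_forall hC)
  have hlim : Tendsto (fun r => r⁻¹ * (Q r - Q 0)) (𝓝[>] 0) (𝓝 (R (0, 0))) := by
    rw [Metric.tendsto_nhds]
    intro ε hε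
    obtain ⟨δ, hδ, hδR⟩ := Metric.continuous_iff.1 hRc (0, 0) (ε / 2) (by positivity)
    have : Ioo 0 (min δ 1) ∈ 𝓝[>] (0 : ℝ) := Ioo_mem_nhdsGT (by positivity)
    filter_upwards [this] with r hr
    have hr1 : r < 1 := hr.2.trans_le (min_le_right _ _)
    have hrδ : r < δ := hr.2.trans_le (min_le_left _ _)
    rw [hincr r hr.1 hr1, Real.dist_eq]
    have e1 : r⁻¹ * (∫ s in (0 : ℝ)..r, R (s, r)) - R (0, 0)
        = r⁻¹ * ∫ s in (0 : ℝ)..r, (R (s, r) - R (0, 0)) := by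
      rw [intervalIntegral.integral_sub (f := fun s => R (s, r)) ((hRc.comp (Continuous.prodMk_left r)).intervalIntegrable _ _)
        intervalIntegrable_const, intervalIntegral.integral_const]
      have := hr.1.ne'
      simp only [sub_zero, smul_eq_mul]
      field_simp
    rw [e1, abs_mul, abs_of_pos (inv_pos.2 hr.1)]
    have e2 := intervalIntegral.norm_integral_le_of_norm_le_const (a := 0) (b := r) (C := ε / 2)
      (f := fun s => R (s, r) - R (0, 0)) (fun s hs => by
        rw [uIoc_of_le hr.1.le] at hs
        rw [← dist_eq_norm]
        refine (hδR (s, r) ?_).le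
        rw [Prod.dist_eq, max_lt_iff]
        simp only [Real.dist_eq, sub_zero]
        rw [abs_of_pos hs.1, abs_of_pos hr.1]
        exact ⟨by linarith [hs.2], hrδ⟩)
    rw [Real.norm_eq_abs, sub_zero, abs_of_pos hr.1] at e2
    calc r⁻¹ * |∫ s in (0 : ℝ)..r, (R (s, r) - R (0, 0))| ≤ r⁻¹ * (ε / 2 * r) := by
          gcongr; exact (inv_pos.2 hr.1).le
      _ = ε / 2 := by have := hr.1.ne'; field_simp
      _ < ε := by linarith
  have hlim' : Tendsto (fun r => r⁻¹ * (Q r - Q 0)) (𝓝[>] 0) (𝓝 (∫ t, -deriv φ t * p t)) := by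
    have := hasDerivAt_iff_tendsto_slope.1 hQd
    refine (this.mono_left (nhdsWithin_mono _ fun x (hx : 0 < x) => hx.ne')).congr fun r => ?_
    simp [slope_def_field, div_eq_inv_mul]
  have hfin := tendsto_nhds_unique hlim hlim'
  rw [hR] at hfin
  have hL : ∫ t in Ioi (0 : ℝ), deriv φ t • ‖ι (u t)‖ ^ 2 = ∫ t, deriv φ t * p t := by
    rw [← integral_indicator measurableSet_Ioi]
    refine integral_congr_ae ?_
    filter_upwards [hUae] with t ht
    by_cases h0 : deriv φ t = 0
    · simp [indicator, h0]
    have h1 := tsupport_deriv_subset (subset_tsupport _ h0)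
    rw [indicator_of_mem (hφt h1)]
    simp only [hp, smul_eq_mul]
    rw [ht ⟨hφt h1, by linarith [hβφ t h1]⟩]
  have hRr : ∫ t in Ioi (0 : ℝ), φ t • (2 * g t (u t)) = ∫ t, G (t + 0) (W 0 t) := by
    rw [← integral_indicator measurableSet_Ioi]
    refine integral_congr_ae ?_
    filter_upwards [hUae, hGae, hWae 0] with t ht hg hw
    simp only [hw, add_zero]
    by_cases h0 : φ t = 0
    · simp [indicator, h0]
    have h1 := subset_tsupport _ h0
    have h2 : t ∈ Ioc 0 T := ⟨hφt h1, by linarith [hβφ t h1]⟩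
    rw [indicator_of_mem (hφt h1), ht h2, hg h2, map_smul, map_add, smul_eq_mul, smul_eq_mul]
    ring
  rw [hL, hRr, hfin]
  simp only [neg_mul, integral_neg, neg_neg]

end Gelfand

/-! ### Algebra of primitives and Grönwall -/

section Primitive

variable {X : Type*} [NormedAddCommGroup X] [NormedSpace ℝ X]

lemma IsPrimitive.add {p p' q q' : ℝ → X} {c c' : X} (hq : MemL1Loc q) (hq' : MemL1Loc q')
    (h : IsPrimitive p q c) (h' : IsPrimitive p' q' c') :
    IsPrimitive (fun t => p t + p' t) (fun t => q t + q' t) (c + c') := by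
  filter_upwards [h, h', ae_restrict_mem measurableSet_Ioi] with t h1 h2 ht
  rw [h1, h2, intervalIntegral.integral_add (hq.intervalIntegrable le_rfl (le_of_lt ht))
    (hq'.intervalIntegrable le_rfl (le_of_lt ht))]
  abel

lemma IsPrimitive.const_smul {p q : ℝ → X} {c : X} (a : ℝ) (h : IsPrimitive p q c) :
    IsPrimitive (fun t => a • p t) (fun t => a • q t) (a • c) := by
  filter_upwards [h] with t h1
  rw [h1, intervalIntegral.integral_smul, smul_add]

lemma MemL1Loc.const_smul {q : ℝ → X} (a : ℝ) (h : MemL1Loc q) :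
    MemL1Loc (fun t => a • q t) := fun T hT => (h T hT).fun_smul a

lemma IsPrimitive.congr {p p' q q' : ℝ → X} {c : X} (hp : ∀ᵐ t ∂posTimes, p t = p' t)
    (hq : ∀ᵐ t ∂posTimes, q t = q' t) (h : IsPrimitive p q c) : IsPrimitive p' q' c := by
  filter_upwards [h, hp, ae_restrict_mem measurableSet_Ioi] with t h1 h2 ht
  rw [← h2, h1, intervalIntegral.integral_congr_ae]
  filter_upwards [ae_posTimes_iff.1 hq] with s hs hs'
  rw [uIoc_of_le (le_of_lt ht)] at hs'
  exact hs hs'.1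

/-- Grönwall's inequality for a primitive. -/
lemma IsPrimitive.le_exp {p q : ℝ → ℝ} {c p₀ lam : ℝ} (hq : MemL1Loc q) (h : IsPrimitive p q c)
    (hle : ∀ᵐ t ∂posTimes, q t ≤ -lam * p t) (h0 : Tendsto p initialFilter (𝓝 p₀)) :
    ∀ᵐ t ∂posTimes, p t ≤ p₀ * Real.exp (-lam * t) := by
  have hc := h.initial hq h0
  set P : ℝ → ℝ := fun t => c + ∫ s in (0 : ℝ)..t, q s with hP
  have hPc : ContinuousOn P (Ici 0) := hq.continuousOn_primitive c
  have hle' : ∀ᵐ t ∂posTimes, q t ≤ -lam * P t := by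
    filter_upwards [h, hle] with t h1 h2
    rwa [h1] at h2
  have key : ∀ t, 0 ≤ t → P t ≤ p₀ * Real.exp (-lam * t) := by
    intro t ht
    have := le_gronwallBound_of_liminf_deriv_right_le (f := P) (f' := fun x => -lam * P x)
      (δ := p₀) (K := -lam) (ε := 0) (a := 0) (b := t) (hPc.mono Icc_subset_Ici_self) ?_ ?_ ?_
      t ⟨ht, le_rfl⟩
    · simpa [gronwallBound_ε0] using this
    -- The bound on `q` holds only almost everywhere, so P need not be differentiable at x. Its
    -- right difference quotients are averages of `q`, and near x these stay below any r exceeding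
    -- -λP(x); that suffices for the liminf form of Grönwall.
    · intro x hx r hr
      have hx0 : 0 ≤ x := hx.1
      have hcw : ContinuousWithinAt (fun y => -lam * P y) (Ioi x) x :=
        ((hPc x hx0).mono (fun y (hy : x < y) => hx0.trans hy.le)).const_mul _
      obtain ⟨r', hr1, hr2⟩ := exists_between hr
      have hev : ∀ᶠ y in 𝓝[>] x, -lam * P y < r' := hcw.eventually (gt_mem_nhds hr1)
      obtain ⟨b, hb, hbs⟩ := mem_nhdsGT_iff_exists_Ioo_subset.1 hev
      refine Eventually.frequently ?_
      filter_upwards [Ioo_mem_nhdsGT hb] with z hz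
      have hz0 : 0 ≤ z := hx0.trans hz.1.le
      have e1 : P z - P x = ∫ s in x..z, q s := by
        rw [← intervalIntegral.integral_interval_sub_left (hq.intervalIntegrable le_rfl hz0)
          (hq.intervalIntegrable le_rfl hx0)]
        simp only [hP]; ring
      have e2 : ∫ s in x..z, q s ≤ ∫ _ in x..z, r' := by
        refine intervalIntegral.integral_mono_ae_restrict hz.1.le
          (hq.intervalIntegrable hx0 hz0) intervalIntegrable_const ?_
        rw [← restrict_Ioc_eq_restrict_Icc]
        refine (ae_restrict_iff' measurableSet_Ioc).2 ?_
        filter_upwards [ae_posTimes_iff.1 hle'] with s hs hs'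
        exact (hs (hx0.trans_lt hs'.1)).trans (hbs ⟨hs'.1, hs'.2.trans_lt hz.2⟩ : _ < _).le
      rw [intervalIntegral.integral_const, smul_eq_mul] at e2
      have hpos : 0 < z - x := sub_pos.2 hz.1
      rw [e1]
      calc (z - x)⁻¹ * ∫ s in x..z, q s ≤ (z - x)⁻¹ * ((z - x) * r') := by
            gcongr
        _ = r' := by field_simp
        _ < r := hr2
    · simp [hP, hc]
    · intro x _; simp
  filter_upwards [h, ae_restrict_mem measurableSet_Ioi] with t h1 ht
  rw [h1]; exact key t (le_of_lt ht)

end Primitive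

/-! ### The Gelfand triple: product rule and continuity in time -/

section Gelfand

variable {V H : Type*} [NormedAddCommGroup V] [InnerProductSpace ℝ V] [CompleteSpace V]
  [NormedAddCommGroup H] [InnerProductSpace ℝ H] {ι : V →L[ℝ] H}

lemma memL1Loc_apply {u : ℝ → V} {g : ℝ → StrongDual ℝ V} (hu : MemL2Loc u) (hg : MemL2Loc g) :
    MemL1Loc (fun t => g t (u t)) := fun T hT => by
  have h1 := (hu T hT).integrable_norm_pow two_ne_zero
  have h2 := (hg T hT).integrable_norm_pow two_ne_zero
  refine (h1.add h2).mono' ?_ (Eventually.of_forall fun t => ?_)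
  · exact (isBoundedBilinearMap_apply (𝕜 := ℝ) (E := V) (F := ℝ)).continuous.comp_aestronglyMeasurable
      ((hg T hT).1.prodMk (hu T hT).1)
  · refine ((g t).le_opNorm _).trans ?_
    simp only [Pi.add_apply]
    nlinarith [sq_nonneg (‖g t‖ - ‖u t‖), sq_nonneg ‖g t‖, sq_nonneg ‖u t‖]

lemma MemL2Loc.normSq {X : Type*} [NormedAddCommGroup X] {f : ℝ → X} (hf : MemL2Loc f) :
    MemL1Loc (fun t => ‖f t‖ ^ 2) := fun T hT => (hf T hT).integrable_norm_pow two_ne_zero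

lemma IsEvolution.exists_isPrimitive_normSq {u : ℝ → V} {g : ℝ → StrongDual ℝ V}
    (h : IsEvolution ι u g) :
    ∃ c, IsPrimitive (fun t => ‖ι (u t)‖ ^ 2) (fun t => 2 * g t (u t)) c :=
  exists_isPrimitive (h.memL2Loc.clm ι).normSq
    ((memL1Loc_apply h.memL2Loc h.memL2Loc_deriv).const_smul 2) h.weakDeriv_normSq

/-- Product rule in a Gelfand triple. -/
lemma IsEvolution.exists_isPrimitive_inner {u u' : ℝ → V} {g g' : ℝ → StrongDual ℝ V}
    (h : IsEvolution ι u g) (h' : IsEvolution ι u' g') :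
    ∃ c, IsPrimitive (fun t => (inner ℝ (ι (u t)) (ι (u' t)) : ℝ))
      (fun t => g t (u' t) + g' t (u t)) c := by
  obtain ⟨c1, h1⟩ := h.exists_isPrimitive_normSq
  obtain ⟨c2, h2⟩ := h'.exists_isPrimitive_normSq
  obtain ⟨c3, h3⟩ := (h.add h').exists_isPrimitive_normSq
  have m1 := (memL1Loc_apply h.memL2Loc h.memL2Loc_deriv).const_smul 2
  have m2 := (memL1Loc_apply h'.memL2Loc h'.memL2Loc_deriv).const_smul 2
  have m3 := (memL1Loc_apply (h.add h').memL2Loc (h.add h').memL2Loc_deriv).const_smul 2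
  have k12 := (IsPrimitive.add m1 m2 h1 h2)
  have k := (IsPrimitive.add m3 ((m1.add m2).const_smul (-1)) h3 (k12.const_smul (-1))).const_smul
    (1 / 2)
  refine ⟨_, k.congr (Eventually.of_forall fun t => ?_) (Eventually.of_forall fun t => ?_)⟩
  · simp only [map_add, smul_eq_mul]
    rw [norm_add_sq_real]
    ring
  · simp only [map_add, smul_eq_mul, add_apply]
    ring

lemma IsEvolution.memL1Loc_inner {u u' : ℝ → V} {g g' : ℝ → StrongDual ℝ V}
    (h : IsEvolution ι u g) (h' : IsEvolution ι u' g') :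
    MemL1Loc (fun t => g t (u' t) + g' t (u t)) :=
  (memL1Loc_apply h'.memL2Loc h.memL2Loc_deriv).add (memL1Loc_apply h.memL2Loc h'.memL2Loc_deriv)

lemma exists_ae_mem_Ioo {G : Set ℝ} (hG : ∀ᵐ t ∂posTimes, t ∈ G) {a b : ℝ} (ha : 0 ≤ a)
    (hab : a < b) : ∃ t ∈ G, t ∈ Ioo a b := by
  by_contra! hne
  have h1 : ∀ᵐ x : ℝ, ¬ x ∈ Ioo a b := by
    filter_upwards [(ae_posTimes_iff (p := fun x => x ∈ G)).1 hG] with x hx h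
    exact hne x (hx (ha.trans_lt h.1)) h
  have : volume (Ioo a b) = 0 := by
    rw [ae_iff] at h1
    simpa only [not_not, ofPred_mem_eq] using h1
  rw [Real.volume_Ioo, ENNReal.ofReal_eq_zero] at this
  linarith

/-- In a Gelfand triple, a function with weak derivative in `L²_loc(V*)` is continuous into `H`. -/
lemma IsEvolution.exists_continuousRepr [CompleteSpace H] {u : ℝ → V} {g : ℝ → StrongDual ℝ V}
    (h : IsEvolution ι u g) {u₀ : H} (h0 : HasInitialValue (fun t => ι (u t)) u₀) :
    ∃ U : ℝ → H, IsContinuousRepr (fun t => ι (u t)) U ∧ U 0 = u₀ := by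
  obtain ⟨c1, h1⟩ := h.exists_isPrimitive_normSq
  obtain ⟨c2, h2⟩ := exists_isPrimitive (h.memL2Loc.clm (rieszDualL ι)).memL1Loc
    h.memL2Loc_deriv.memL1Loc h.weakDeriv
  have m1 := memL1Loc_apply h.memL2Loc h.memL2Loc_deriv
  have m2 : MemL1Loc (fun t => 2 * g t (u t)) := m1.const_smul 2
  have mg := h.memL2Loc_deriv.memL1Loc
  set G : Set ℝ := {t | 0 < t ∧ ‖ι (u t)‖ ^ 2 = c1 + ∫ s in (0 : ℝ)..t, 2 * g s (u s) ∧
    rieszDual ι (u t) = c2 + ∫ s in (0 : ℝ)..t, g s} with hG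
  have hGae : ∀ᵐ t ∂posTimes, t ∈ G := by
    filter_upwards [h1, h2, ae_restrict_mem measurableSet_Ioi] with t a1 a2 a3
    exact ⟨a3, a1, a2⟩
  set e : ℝ → ℝ := fun t => ‖u t‖ ^ 2 + ‖g t‖ ^ 2 with he
  have me : MemL1Loc e := h.memL2Loc.normSq.add h.memL2Loc_deriv.normSq
  -- At good times both the squared norm and the functional are exact primitives. Expanding the
  -- square combines them, without any density of V in H.
  have hdiff : ∀ s ∈ G, ∀ t ∈ G, ‖ι (u t) - ι (u s)‖ ^ 2 = 2 * ∫ τ in s..t, g τ (u τ - u s) := by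
    intro s hs t ht
    have ig := mg.intervalIntegrable hs.1.le ht.1.le
    have i1 := m1.intervalIntegrable hs.1.le ht.1.le
    have a1 : ‖ι (u t)‖ ^ 2 - ‖ι (u s)‖ ^ 2 = 2 * ∫ τ in s..t, g τ (u τ) := by
      rw [ht.2.1, hs.2.1, ← intervalIntegral.integral_const_mul,
        ← intervalIntegral.integral_interval_sub_left
          (m2.intervalIntegrable le_rfl ht.1.le) (m2.intervalIntegrable le_rfl hs.1.le)]
      ring
    have a2 : rieszDual ι (u t) - rieszDual ι (u s) = ∫ τ in s..t, g τ := by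
      rw [ht.2.2, hs.2.2, ← intervalIntegral.integral_interval_sub_left
          (mg.intervalIntegrable le_rfl ht.1.le) (mg.intervalIntegrable le_rfl hs.1.le)]
      abel
    have a3 : (rieszDual ι (u t) - rieszDual ι (u s)) (u s) = ∫ τ in s..t, g τ (u s) := by
      rw [a2, ContinuousLinearMap.intervalIntegral_apply ig]
    have a4 : IntervalIntegrable (fun τ => g τ (u s)) volume s t :=
      ⟨ig.1.apply_continuousLinearMap _, ig.2.apply_continuousLinearMap _⟩
    simp only [map_sub]
    rw [intervalIntegral.integral_sub i1 a4, ← a3, mul_sub, ← a1]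
    simp only [sub_apply, rieszDual_apply, norm_sub_sq_real, real_inner_self_eq_norm_sq]
    ring
  have hbound : ∀ a b : ℝ, 0 ≤ a → a < b → ∀ t ∈ G, t ∈ Icc a b → ∀ t' ∈ G, t' ∈ Icc a b →
      dist (ι (u t)) (ι (u t')) ≤ 2 * √(2 * ∫ s in a..b, e s) := by
    intro a b ha hab
    have hb : 0 ≤ b := ha.trans hab.le
    have iu := (h.memL2Loc.normSq).intervalIntegrable ha hb
    have ig2 := (h.memL2Loc_deriv.normSq).intervalIntegrable ha hb
    have hμ : (volume.restrict (Ioc a b)) ≠ 0 := by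
      rw [Ne, Measure.restrict_eq_zero, Real.volume_Ioc, ENNReal.ofReal_eq_zero]
      linarith
    have hN : (volume.restrict (Ioc a b)) Gᶜ = 0 := by
      have : ∀ᵐ t ∂(volume.restrict (Ioc a b)), t ∈ G :=
        ae_mono (Measure.restrict_mono_set _ fun t ht => ha.trans_lt ht.1) hGae
      exact this
    -- `hdiff` involves ‖u s‖ in V, which is not bounded uniformly in s. A good time where ‖u s‖² is
    -- at most its average over (a, b] makes (b - a)‖u s‖² ≤ ∫‖u‖², so every contribution is bounded
    -- by ∫ e.
    obtain ⟨s, hsN, hs⟩ := exists_notMem_null_le_average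
      (μ := volume.restrict (Ioc a b)) (N := Gᶜ ∪ (Ioc a b)ᶜ) (f := fun t => ‖u t‖ ^ 2) hμ iu.1
      (measure_union_null hN (ae_restrict_mem measurableSet_Ioc))
    simp only [mem_union, mem_compl_iff, not_or, not_not] at hsN
    obtain ⟨hsG, hsI⟩ := hsN
    have hs' : (b - a) * ‖u s‖ ^ 2 ≤ ∫ t in a..b, ‖u t‖ ^ 2 := by
      rw [setAverage_eq, smul_eq_mul] at hs
      have hv : volume.real (Ioc a b) = b - a := by
        rw [measureReal_def, Real.volume_Ioc, ENNReal.toReal_ofReal (by linarith)]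
      rw [hv, ← intervalIntegral.integral_of_le hab.le] at hs
      have hpos : 0 < b - a := by linarith
      calc (b - a) * ‖u s‖ ^ 2 ≤ (b - a) * ((b - a)⁻¹ * ∫ t in a..b, ‖u t‖ ^ 2) := by gcongr
        _ = _ := by field_simp
    have hone : ∀ t ∈ G, t ∈ Icc a b → dist (ι (u t)) (ι (u s)) ≤ √(2 * ∫ s in a..b, e s) := by
      intro t ht htI
      refine Real.le_sqrt_of_sq_le ?_
      rw [dist_eq_norm, hdiff s hsG t ht]
      gcongr 2 * ?_
      have b1 : ∀ τ, ‖g τ (u τ - u s)‖ ≤ ‖g τ‖ ^ 2 + (1 / 2) * ‖u τ‖ ^ 2 + (1 / 2) * ‖u s‖ ^ 2 := fun τ => by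
        refine ((g τ).le_opNorm _).trans ?_
        have := norm_sub_le (u τ) (u s)
        nlinarith [sq_nonneg (‖g τ‖ - ‖u τ‖), sq_nonneg (‖g τ‖ - ‖u s‖), norm_nonneg (g τ),
          mul_le_mul_of_nonneg_left this (norm_nonneg (g τ))]
      have ib : IntervalIntegrable (fun τ => ‖g τ‖ ^ 2 + (1 / 2) * ‖u τ‖ ^ 2 + (1 / 2) * ‖u s‖ ^ 2)
          volume a b := (ig2.add (iu.const_mul _)).add intervalIntegrable_const
      calc ∫ τ in s..t, g τ (u τ - u s) ≤ ‖∫ τ in s..t, g τ (u τ - u s)‖ := le_abs_self _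
        _ ≤ ∫ τ in uIoc s t, ‖g τ (u τ - u s)‖ := intervalIntegral.norm_integral_le_integral_norm_uIoc
        _ ≤ ∫ τ in uIoc s t, (‖g τ‖ ^ 2 + (1 / 2) * ‖u τ‖ ^ 2 + (1 / 2) * ‖u s‖ ^ 2) := by
            refine integral_mono_of_nonneg (Eventually.of_forall fun τ => norm_nonneg _) ?_
              (Eventually.of_forall b1)
            refine IntegrableOn.mono_set (t := Ioc a b) ib.1 ?_
            rw [uIoc]
            exact Ioc_subset_Ioc (le_min hsI.1.le htI.1) (max_le hsI.2 htI.2)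
        _ ≤ ∫ τ in Ioc a b, (‖g τ‖ ^ 2 + (1 / 2) * ‖u τ‖ ^ 2 + (1 / 2) * ‖u s‖ ^ 2) := by
            refine setIntegral_mono_set ib.1 (Eventually.of_forall fun τ => by positivity) ?_
            rw [uIoc]
            exact (Ioc_subset_Ioc (le_min hsI.1.le htI.1) (max_le hsI.2 htI.2)).eventuallyLE
        _ = ∫ τ in a..b, (‖g τ‖ ^ 2 + (1 / 2) * ‖u τ‖ ^ 2 + (1 / 2) * ‖u s‖ ^ 2) :=
            (intervalIntegral.integral_of_le hab.le).symm
        _ = (∫ τ in a..b, ‖g τ‖ ^ 2) + (1 / 2) * (∫ τ in a..b, ‖u τ‖ ^ 2)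
              + (1 / 2) * ((b - a) * ‖u s‖ ^ 2) := by
            rw [intervalIntegral.integral_add (ig2.add (iu.const_mul _)) intervalIntegrable_const,
              intervalIntegral.integral_add ig2 (iu.const_mul _),
              intervalIntegral.integral_const_mul, intervalIntegral.integral_const, smul_eq_mul]
            ring
        _ ≤ ∫ s in a..b, e s := by
            simp only [he]
            rw [intervalIntegral.integral_add iu ig2]
            linarith
    intro t ht htI t' ht' htI'
    calc dist (ι (u t)) (ι (u t')) ≤ dist (ι (u t)) (ι (u s)) + dist (ι (u t')) (ι (u s)) :=
          dist_triangle_right _ _ _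
      _ ≤ _ := by linarith [hone t ht htI, hone t' ht' htI']
  have hcl : Ici (0 : ℝ) ⊆ closure G := by
    intro t ht
    rw [Metric.mem_closure_iff]
    intro ε hε
    obtain ⟨s, hs, hs'⟩ := exists_ae_mem_Ioo hGae (a := t) (b := t + ε) ht (by linarith)
    refine ⟨s, hs, ?_⟩
    rw [Real.dist_eq, abs_sub_comm, abs_of_pos (by linarith [hs'.1])]
    linarith [hs'.2]
  have hcont := me.continuousOn_primitive 0
  simp only [zero_add] at hcont
  -- Along good times the values are Cauchy, because ∫ e over a shrinking interval tends to 0. The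
  -- lower end is truncated at 0 so that t = 0 is covered too.
  have hlim : ∀ t ∈ Ici (0 : ℝ), ∃ y, Tendsto (fun t => ι (u t)) (𝓝[G] t) (𝓝 y) := by
    intro t ht
    have ht' : (0 : ℝ) ≤ t := ht
    have : (𝓝[G] t).NeBot := mem_closure_iff_nhdsWithin_neBot.1 (hcl ht)
    refine cauchy_map_iff_exists_tendsto.1 ?_
    refine Metric.cauchy_iff.2 ⟨inferInstance, fun ε hε => ?_⟩
    set Λ : ℝ → ℝ := fun t => ∫ s in (0 : ℝ)..t, e s with hΛ
    obtain ⟨δ, hδ, hδΛ⟩ := Metric.continuousOn_iff.1 hcont t ht (ε ^ 2 / 32) (by positivity)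
    set a := max (t - δ / 2) 0 with ha
    set b := t + δ / 2 with hb
    have ha0 : 0 ≤ a := le_max_right _ _
    have hat : a ≤ t := max_le (by linarith) ht'
    have hat' : t - δ / 2 ≤ a := le_max_left _ _
    have hab : a < b := by linarith
    have h3 : ∫ s in a..b, e s < ε ^ 2 / 16 := by
      have e1 : ∫ s in a..b, e s = Λ b - Λ a := by
        rw [hΛ, intervalIntegral.integral_interval_sub_left
          (me.intervalIntegrable le_rfl (ha0.trans hab.le)) (me.intervalIntegrable le_rfl ha0)]
      have e2 := hδΛ a ha0 (by rw [Real.dist_eq, abs_lt]; constructor <;> linarith)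
      have e3 := hδΛ b (ha0.trans hab.le) (by rw [Real.dist_eq, abs_lt]; constructor <;> linarith)
      rw [Real.dist_eq, abs_lt] at e2 e3
      rw [e1]
      linarith [e2.1, e3.2]
    refine ⟨(fun t => ι (u t)) '' (G ∩ Ioo (t - δ / 2) (t + δ / 2)), image_mem_map ?_, ?_⟩
    · exact inter_mem self_mem_nhdsWithin (mem_nhdsWithin_of_mem_nhds
        (Ioo_mem_nhds (by linarith) (by linarith)))
    · rintro _ ⟨x, hx, rfl⟩ _ ⟨y, hy, rfl⟩
      have hx' : x ∈ Icc a b := ⟨max_le hx.2.1.le hx.1.1.le, hx.2.2.le⟩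
      have hy' : y ∈ Icc a b := ⟨max_le hy.2.1.le hy.1.1.le, hy.2.2.le⟩
      refine (hbound a b ha0 hab x hx.1 hx' y hy.1 hy').trans_lt ?_
      have : √(2 * ∫ s in a..b, e s) < ε / 2 := by
        rw [Real.sqrt_lt' (by positivity)]
        nlinarith
      linarith
  have hrep : IsContinuousRepr (fun t => ι (u t)) (extendFrom G (fun t => ι (u t))) := by
    refine ⟨continuousOn_extendFrom hcl hlim, ?_⟩
    filter_upwards [hGae] with t ht
    obtain ⟨y, hy⟩ := hlim t (le_of_lt ht.1)
    -- The limit within G includes the point t itself, so at a good time the extension returns the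
    -- original value.
    have h4 : Tendsto (fun t => ι (u t)) (pure t) (𝓝 y) :=
      hy.mono_left (pure_le_nhdsWithin ht)
    rw [extendFrom_eq (hcl (le_of_lt ht.1)) hy]
    have h5 := tendsto_nhds_unique h4 (tendsto_pure_nhds (fun t => ι (u t)) t)
    exact h5
  refine ⟨_, hrep, ?_⟩
  refine tendsto_nhds_unique ((tendsto_initialFilter_of_continuousOn hrep.1).congr'
    (eventually_initialFilter hrep.2)) h0

end Gelfand

/-! ### Averages of translations, abstractly -/

section Translations

/-- A strongly continuous family of contractions indexed by `ℝ^d`. -/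
structure TranslationFamily (d : ℕ) (X : Type*) [NormedAddCommGroup X] [NormedSpace ℝ X] where
  /-- The operators. -/
  op : Hor d → X →L[ℝ] X
  norm_op_le : ∀ a x, ‖op a x‖ ≤ ‖x‖
  continuous_op : ∀ x, Continuous fun a => op a x

variable {d : ℕ} {X Y : Type*} [NormedAddCommGroup X] [NormedSpace ℝ X] [NormedAddCommGroup Y]
  [NormedSpace ℝ Y]

lemma TranslationFamily.integrable (T : TranslationFamily d X) (k : SchwartzMap (Hor d) ℝ) (x : X) :
    Integrable (fun a => k a • T.op a x) := by
  refine (k.integrable (μ := volume)).smul_bdd ‖x‖ (T.continuous_op x).aestronglyMeasurable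
    (Eventually.of_forall fun a => T.norm_op_le a x)

/-- The average `∫ k(a) T_a da` of a family of translations. -/
def TranslationFamily.avg (T : TranslationFamily d X) (k : SchwartzMap (Hor d) ℝ) : X →L[ℝ] X :=
  LinearMap.mkContinuous
    { toFun := fun x => ∫ a, k a • T.op a x
      map_add' := fun x y => by
        rw [← integral_add (T.integrable k x) (T.integrable k y)]
        simp
      map_smul' := fun c x => by
        rw [RingHom.id_apply, ← integral_smul]
        refine integral_congr_ae (Eventually.of_forall fun a => ?_)
        simp only [map_smul]
        rw [smul_comm] } (∫ a, ‖k a‖) fun x => by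
    refine (norm_integral_le_integral_norm _).trans ?_
    rw [← integral_mul_const]
    refine integral_mono (T.integrable k x).norm ((k.integrable (μ := volume)).norm.mul_const _)
      fun a => ?_
    simp only [norm_smul]
    gcongr
    exact T.norm_op_le a x

lemma TranslationFamily.avg_apply (T : TranslationFamily d X) (k : SchwartzMap (Hor d) ℝ) (x : X) :
    T.avg k x = ∫ a, k a • T.op a x := rfl

/-- Convolution is a Bochner integral of translations, so anything bounded and
translation-equivariant commutes with it. Every compatibility of convolution with gradients,
components and tensor products comes from here. -/
lemma TranslationFamily.map_avg [CompleteSpace X] [CompleteSpace Y] (T : TranslationFamily d X)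
    (T' : TranslationFamily d Y) (L : X →L[ℝ] Y) (h : ∀ a x, L (T.op a x) = T'.op a (L x))
    (k : SchwartzMap (Hor d) ℝ) (x : X) : L (T.avg k x) = T'.avg k (L x) := by
  rw [avg_apply, avg_apply, ← L.integral_comp_comm (T.integrable k x)]
  simp [h]

lemma TranslationFamily.functional_avg [CompleteSpace X] [CompleteSpace Y]
    (T : TranslationFamily d X) (L : X →L[ℝ] Y) (k : SchwartzMap (Hor d) ℝ) (x : X) :
    L (T.avg k x) = ∫ a, k a • L (T.op a x) := by
  rw [avg_apply, ← L.integral_comp_comm (T.integrable k x)]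
  simp

/-- The adjoint of translation by a is translation by -a, and evenness of k absorbs the sign.
Self-adjointness is what lets a test field KKv produce localised quadratic forms. -/
lemma TranslationFamily.inner_avg_left {E : Type*} [NormedAddCommGroup E] [InnerProductSpace ℝ E]
    [CompleteSpace E] (T : TranslationFamily d E)
    (hT : ∀ a x y, (inner ℝ (T.op a x) y : ℝ) = inner ℝ x (T.op (-a) y))
    (k : SchwartzMap (Hor d) ℝ) (hk : ∀ a, k (-a) = k a) (x y : E) :
    (inner ℝ (T.avg k x) y : ℝ) = inner ℝ x (T.avg k y) := by
  have h1 : (inner ℝ (T.avg k x) y : ℝ) = ∫ a, k a * inner ℝ y (T.op a x) := by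
    rw [real_inner_comm, avg_apply, ← integral_inner (T.integrable k x)]
    simp [inner_smul_right]
  have h2 : (inner ℝ x (T.avg k y) : ℝ) = ∫ a, k a * inner ℝ x (T.op a y) := by
    rw [avg_apply, ← integral_inner (T.integrable k y)]
    simp [inner_smul_right]
  rw [h1, h2, ← integral_neg_eq_self]
  congr 1 with a
  rw [hk, real_inner_comm, hT, neg_neg]

end Translations

/-! ### Horizontal translations on the slab and on its cross-section -/

section LpTranslations

variable {d : ℕ} {ℓ : ℝ}

/-- The horizontal shift of `ℝ^d × ℝ`. -/
def slabShift (a : Hor d) (z : Hor d × ℝ) : Hor d × ℝ := z + (a, 0)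

@[simp] lemma slabShift_neg_slabShift (a : Hor d) (z : Hor d × ℝ) :
    slabShift (-a) (slabShift a z) = z := by
  ext <;> simp [slabShift]

@[simp] lemma slabShift_slabShift_neg (a : Hor d) (z : Hor d × ℝ) :
    slabShift a (slabShift (-a) z) = z := by
  ext <;> simp [slabShift]

/-- The Lebesgue measure of the slab. -/
abbrev slabVol (d : ℕ) (ℓ : ℝ) : Measure (Hor d × ℝ) := (volume : Measure (Hor d × ℝ)).restrict (slab d ℓ)

/-- `L²(Ω)`, real valued. -/
abbrev L2Scalar (d : ℕ) (ℓ : ℝ) : Type := Lp ℝ 2 (slabVol d ℓ)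

lemma measurableSet_slab (d : ℕ) (ℓ : ℝ) : MeasurableSet (slab d ℓ) :=
  (measurableSet_lt measurable_const measurable_snd).inter
    (measurableSet_lt measurable_snd measurable_const)

lemma measurePreserving_slabShift (a : Hor d) :
    MeasurePreserving (slabShift a) (slabVol d ℓ) (slabVol d ℓ) := by
  have : (volume : Measure (Hor d × ℝ)).IsAddHaarMeasure := by
    rw [Measure.volume_eq_prod]; infer_instance
  have h := (measurePreserving_add_right (volume : Measure (Hor d × ℝ)) (a, 0)).restrict_preimage
    (measurableSet_slab d ℓ)
  have h2 : (fun z => z + (a, (0 : ℝ))) ⁻¹' (slab d ℓ) = slab d ℓ := by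
    ext z; simp [slab]
  rwa [h2] at h

lemma measurableEmbedding_slabShift (a : Hor d) : MeasurableEmbedding (slabShift a) :=
  (MeasurableEquiv.addRight (a, (0 : ℝ))).measurableEmbedding

/-- Horizontal translations of `L²(Ω; E)`. -/
def slabTranslation (d : ℕ) (ℓ : ℝ) (E : Type*) [NormedAddCommGroup E] [NormedSpace ℝ E] :
    TranslationFamily d (Lp E 2 (slabVol d ℓ)) where
  op a := (Lp.compMeasurePreservingₗᵢ ℝ (slabShift a) (measurePreserving_slabShift a)).toContinuousLinearMap
  norm_op_le a x := (LinearIsometry.norm_map _ x).le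
  continuous_op x := by
    have hc : Continuous (fun a : Hor d => (⟨slabShift a, by unfold slabShift; fun_prop⟩ :
        C(Hor d × ℝ, Hor d × ℝ))) :=
      ContinuousMap.continuous_of_continuous_uncurry _ (by
        change Continuous fun z : Hor d × (Hor d × ℝ) => z.2 + (z.1, (0 : ℝ))
        fun_prop)
    exact Continuous.compMeasurePreservingLp (μ := slabVol d ℓ) (ν := slabVol d ℓ)
      (continuous_const (y := x)) hc (fun a => measurePreserving_slabShift a) (by simp)

/-- Translations of `L²(Σ)`. -/
def horTranslation (d : ℕ) (E : Type*) [NormedAddCommGroup E] [NormedSpace ℝ E] :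
    TranslationFamily d (Lp E 2 (volume : Measure (Hor d))) where
  op a := (Lp.compMeasurePreservingₗᵢ ℝ (fun x => x + a)
    (measurePreserving_add_right volume a)).toContinuousLinearMap
  norm_op_le a x := (LinearIsometry.norm_map _ x).le
  continuous_op x := by
    have hc : Continuous (fun a : Hor d => (⟨fun x => x + a, by fun_prop⟩ : C(Hor d, Hor d))) :=
      ContinuousMap.continuous_of_continuous_uncurry _ (by
        change Continuous fun z : Hor d × Hor d => z.2 + z.1
        fun_prop)
    exact Continuous.compMeasurePreservingLp (μ := volume) (ν := volume)
      (continuous_const (y := x)) hc (fun a => measurePreserving_add_right volume a) (by simp)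

variable {E F : Type*} [NormedAddCommGroup E] [NormedSpace ℝ E] [NormedAddCommGroup F] [NormedSpace ℝ F]

lemma coeFn_slabTranslation (a : Hor d) (f : Lp E 2 (slabVol d ℓ)) :
    (slabTranslation d ℓ E).op a f =ᵐ[slabVol d ℓ] fun z => f (slabShift a z) :=
  Lp.coeFn_compMeasurePreserving f (measurePreserving_slabShift a)

lemma coeFn_horTranslation (a : Hor d) (f : Lp E 2 (volume : Measure (Hor d))) :
    (horTranslation d E).op a f =ᵐ[volume] fun x => f (x + a) :=
  Lp.coeFn_compMeasurePreserving f (measurePreserving_add_right volume a)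

lemma norm_slabTranslation (a : Hor d) (f : Lp E 2 (slabVol d ℓ)) :
    ‖(slabTranslation d ℓ E).op a f‖ = ‖f‖ := LinearIsometry.norm_map _ f

lemma slabTranslation_compLp (L : E →L[ℝ] F) (a : Hor d) (f : Lp E 2 (slabVol d ℓ)) :
    L.compLpL 2 (slabVol d ℓ) ((slabTranslation d ℓ E).op a f)
      = (slabTranslation d ℓ F).op a (L.compLpL 2 (slabVol d ℓ) f) := by
  refine Lp.ext ?_
  have h1 := (measurePreserving_slabShift (ℓ := ℓ) a).quasiMeasurePreserving.ae
    (L.coeFn_compLpL (μ := slabVol d ℓ) (p := 2) f)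
  filter_upwards [L.coeFn_compLpL (μ := slabVol d ℓ) (p := 2) ((slabTranslation d ℓ E).op a f),
    coeFn_slabTranslation a f, coeFn_slabTranslation a (L.compLpL 2 (slabVol d ℓ) f), h1]
    with z h2 h3 h4 h5
  rw [h2, h3, h4, h5]

lemma integral_slabShift_smul (a : Hor d) (φ : Hor d × ℝ → ℝ) (f : Lp E 2 (slabVol d ℓ)) :
    ∫ z in slab d ℓ, φ z • (slabTranslation d ℓ E).op a f z
      = ∫ z in slab d ℓ, φ (slabShift (-a) z) • f z := by
  rw [← (measurePreserving_slabShift (ℓ := ℓ) a).integral_comp (measurableEmbedding_slabShift a)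
    (fun z => φ (slabShift (-a) z) • f z)]
  refine integral_congr_ae ?_
  filter_upwards [coeFn_slabTranslation a f] with z hz
  rw [hz, slabShift_neg_slabShift]

lemma inner_slabTranslation {E : Type*} [NormedAddCommGroup E] [InnerProductSpace ℝ E] (a : Hor d)
    (f g : Lp E 2 (slabVol d ℓ)) :
    (inner ℝ ((slabTranslation d ℓ E).op a f) g : ℝ) = inner ℝ f ((slabTranslation d ℓ E).op (-a) g) := by
  rw [L2.inner_def, L2.inner_def,
    ← (measurePreserving_slabShift (ℓ := ℓ) (-a)).integral_comp (measurableEmbedding_slabShift (-a))]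
  refine integral_congr_ae ?_
  have h1 := (measurePreserving_slabShift (ℓ := ℓ) (-a)).quasiMeasurePreserving.ae
    (coeFn_slabTranslation a f)
  filter_upwards [coeFn_slabTranslation (-a) g, h1] with z h2 h3
  rw [h2, h3, slabShift_slabShift_neg]

lemma inner_horTranslation (a : Hor d) (f g : L2Hor d) :
    (inner ℝ ((horTranslation d ℝ).op a f) g : ℝ) = inner ℝ f ((horTranslation d ℝ).op (-a) g) := by
  have hm := measurePreserving_add_right (volume : Measure (Hor d)) (-a)
  rw [L2.inner_def, L2.inner_def, ← hm.integral_comp (MeasurableEquiv.addRight (-a)).measurableEmbedding]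
  refine integral_congr_ae ?_
  have h1 := hm.quasiMeasurePreserving.ae (coeFn_horTranslation a f)
  filter_upwards [coeFn_horTranslation (-a) g, h1] with z h2 h3
  rw [h2, h3]
  simp

end LpTranslations

/-! ### Completeness and horizontal convolution of solenoidal fields -/

section Solenoidal

variable {d : ℕ} {ℓ : ℝ}

/-- The `i`-th component of a field. -/
def compL (d : ℕ) (ℓ : ℝ) (i : Fin (d + 1)) : L2Slab d ℓ →L[ℝ] L2Scalar d ℓ :=
  (EuclideanSpace.proj i : Vel d →L[ℝ] ℝ).compLpL 2 (slabVol d ℓ)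

lemma coeFn_compL (i : Fin (d + 1)) (f : L2Slab d ℓ) :
    compL d ℓ i f =ᵐ[slabVol d ℓ] fun z => f z i :=
  (EuclideanSpace.proj i : Vel d →L[ℝ] ℝ).coeFn_compLpL f

lemma compL_slabTranslation (i : Fin (d + 1)) (a : Hor d) (f : L2Slab d ℓ) :
    compL d ℓ i ((slabTranslation d ℓ (Vel d)).op a f) = (slabTranslation d ℓ ℝ).op a (compL d ℓ i f) :=
  slabTranslation_compLp _ a f

/-- Integration against an `L²` function. -/
def testL {E : Type*} [NormedAddCommGroup E] [NormedSpace ℝ E] [CompleteSpace E] {φ : Hor d × ℝ → ℝ}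
    (h : MemLp φ 2 (slabVol d ℓ)) : Lp E 2 (slabVol d ℓ) →L[ℝ] E :=
  ContinuousLinearMap.lpPairing (slabVol d ℓ) 2 2 (ContinuousLinearMap.lsmul ℝ ℝ) (h.toLp φ)

lemma testL_apply {E : Type*} [NormedAddCommGroup E] [NormedSpace ℝ E] [CompleteSpace E]
    {φ : Hor d × ℝ → ℝ} (h : MemLp φ 2 (slabVol d ℓ)) (f : Lp E 2 (slabVol d ℓ)) :
    testL h f = ∫ z in slab d ℓ, φ z • f z := by
  rw [testL, ContinuousLinearMap.lpPairing_eq_integral]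
  refine integral_congr_ae ?_
  filter_upwards [h.coeFn_toLp] with z hz
  rw [hz]; rfl

/-- The gradient component `∂ⱼ u` as a continuous linear map on jets. -/
def jetGrad (d : ℕ) (ℓ : ℝ) (j : Fin (d + 1)) : Jet d ℓ →L[ℝ] L2Slab d ℓ :=
  (PiLp.proj 2 (fun _ : Fin (d + 1) => L2Slab d ℓ) j : _ →L[ℝ] L2Slab d ℓ).comp
    (WithLp.sndL 2 ℝ (L2Slab d ℓ) (PiLp 2 (fun _ : Fin (d + 1) => L2Slab d ℓ)))

@[simp] lemma jetGrad_apply (j : Fin (d + 1)) (U : Jet d ℓ) : jetGrad d ℓ j U = U.snd j := rfl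

/-- The value of a jet as a continuous linear map. -/
def jetVal (d : ℕ) (ℓ : ℝ) : Jet d ℓ →L[ℝ] L2Slab d ℓ :=
  WithLp.fstL 2 ℝ (L2Slab d ℓ) (PiLp 2 (fun _ : Fin (d + 1) => L2Slab d ℓ))

@[simp] lemma jetVal_apply (U : Jet d ℓ) : jetVal d ℓ U = U.fst := rfl

/-- Recasts the pointwise constraint as the kernel of a bounded operator, which makes closedness and
translation invariance immediate. -/
lemma divergence_eq_zero_iff (U : Jet d ℓ) :
    (∀ᵐ z ∂(slabVol d ℓ), divergence U z = 0) ↔ ∑ i, compL d ℓ i (U.snd i) = 0 := by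
  have h : ∀ᵐ z ∂(slabVol d ℓ), (∑ i, compL d ℓ i (U.snd i) : L2Scalar d ℓ) z = divergence U z := by
    have h1 : ∀ᵐ z ∂(slabVol d ℓ), ∀ i, compL d ℓ i (U.snd i) z = (U.snd i) z i :=
      ae_all_iff.2 fun i => coeFn_compL i (U.snd i)
    filter_upwards [Lp.coeFn_finsetSum Finset.univ (fun i => compL d ℓ i (U.snd i)), h1] with z h2 h3
    rw [h2, divergence, Finset.sum_apply]
    exact Finset.sum_congr rfl fun i _ => h3 i
  constructor
  · intro h'
    refine Lp.ext ?_
    filter_upwards [h, h', Lp.coeFn_zero ℝ 2 (slabVol d ℓ)] with z h1 h2 h3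
    rw [h1, h2, h3]; rfl
  · intro h'
    filter_upwards [h, Lp.coeFn_zero ℝ 2 (slabVol d ℓ)] with z h1 h2
    rw [← h1, h', h2]; rfl

lemma isClosed_isWeakPartial (U : Set (Hor d × ℝ)) (j : Fin (d + 1)) :
    IsClosed {w : Jet d ℓ | IsWeakPartial U j w.fst (w.snd j)} := by
  have : {w : Jet d ℓ | IsWeakPartial U j w.fst (w.snd j)}
      = ⋂ (φ : Hor d × ℝ → ℝ) (h : IsTest U φ), {w | testL (h.memLp_pderiv ℓ j) (jetVal d ℓ w)
        = - testL (h.memLp ℓ) (jetGrad d ℓ j w)} := by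
    ext w
    simp only [mem_ofPred_eq, mem_iInter, testL_apply]
    rfl
  rw [this]
  exact isClosed_iInter fun φ => isClosed_iInter fun h => isClosed_eq
    ((testL _).continuous.comp (jetVal d ℓ).continuous)
    ((testL _).continuous.comp (jetGrad d ℓ j).continuous).neg

/-- Each defining condition is an equation between bounded functionals or operators. The resulting
completeness is needed for Bochner integrals valued in the solenoidal space, hence for convolving
such fields without leaving it. -/
lemma isClosed_solenoidal (d : ℕ) (ℓ : ℝ) : IsClosed (solenoidal d ℓ : Set (Jet d ℓ)) := by
  have : (solenoidal d ℓ : Set (Jet d ℓ))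
      = (⋂ j, {w : Jet d ℓ | IsWeakPartial (slab d ℓ) j w.fst (w.snd j)}) ∩
        ({w : Jet d ℓ | IsWeakPartial {z : Hor d × ℝ | z.2 < ℓ} (Fin.last d) w.fst (w.snd (Fin.last d))} ∩
        {w : Jet d ℓ | ∑ i, compL d ℓ i (jetGrad d ℓ i w) = 0}) := by
    ext w
    simp only [jetGrad_apply, mem_inter_iff, mem_iInter, mem_ofPred_eq, ← divergence_eq_zero_iff]
    rfl
  rw [this]
  refine (isClosed_iInter fun j => isClosed_isWeakPartial _ j).inter
    ((isClosed_isWeakPartial _ _).inter (isClosed_eq ?_ continuous_const))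
  exact continuous_finsetSum _ fun i _ => (compL d ℓ i).continuous.comp (jetGrad d ℓ i).continuous

instance : CompleteSpace (solenoidal d ℓ) := (isClosed_solenoidal d ℓ).completeSpace_coe

lemma IsTest.slabShift {U : Set (Hor d × ℝ)} {φ : Hor d × ℝ → ℝ} (h : IsTest U φ) (a : Hor d)
    (hU : ∀ z, slabShift a z ∈ U → z ∈ U) : IsTest U (fun z => φ (slabShift a z)) where
  smooth := h.smooth.comp (by unfold FluidSlab.slabShift; fun_prop)
  compact := h.compact.comp_homeomorph (Homeomorph.addRight (a, (0 : ℝ)))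
  supp := by
    have h1 : tsupport (fun z => φ (FluidSlab.slabShift a z)) ⊆ (FluidSlab.slabShift a) ⁻¹' tsupport φ :=
      closure_minimal (fun z hz => subset_tsupport _ hz)
        ((isClosed_tsupport φ).preimage (by unfold FluidSlab.slabShift; fun_prop))
    exact h1.trans fun z hz => hU z (h.supp hz)

lemma pderiv_slabShift (j : Fin (d + 1)) (φ : Hor d × ℝ → ℝ) (a : Hor d) (z : Hor d × ℝ) :
    pderiv j (fun z => φ (slabShift a z)) z = pderiv j φ (slabShift a z) := by
  simp only [pderiv, slabShift]
  rw [fderiv_comp_add_right]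

/-- The translation is moved to the test function, which stays admissible because U is invariant
horizontally. -/
lemma IsWeakPartial.translate {U : Set (Hor d × ℝ)} {j : Fin (d + 1)} {f g : L2Slab d ℓ}
    (h : IsWeakPartial U j f g) (hU : ∀ a z, slabShift a z ∈ U → z ∈ U) (a : Hor d) :
    IsWeakPartial U j ((slabTranslation d ℓ (Vel d)).op a f) ((slabTranslation d ℓ (Vel d)).op a g) := by
  intro φ hφ
  rw [integral_slabShift_smul, integral_slabShift_smul, ← h _ (hφ.slabShift (-a) (hU (-a)))]
  simp only [pderiv_slabShift]

/-- The translate of a jet. -/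
def jetTranslate (a : Hor d) (U : Jet d ℓ) : Jet d ℓ :=
  WithLp.toLp 2 ((slabTranslation d ℓ (Vel d)).op a U.fst,
    WithLp.toLp 2 fun j => (slabTranslation d ℓ (Vel d)).op a (U.snd j))

@[simp] lemma jetTranslate_fst (a : Hor d) (U : Jet d ℓ) :
    (jetTranslate a U).fst = (slabTranslation d ℓ (Vel d)).op a U.fst := rfl

@[simp] lemma jetTranslate_snd (a : Hor d) (U : Jet d ℓ) (j : Fin (d + 1)) :
    (jetTranslate a U).snd j = (slabTranslation d ℓ (Vel d)).op a (U.snd j) := rfl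

lemma jetTranslate_mem {U : Jet d ℓ} (hU : U ∈ solenoidal d ℓ) (a : Hor d) :
    jetTranslate a U ∈ solenoidal d ℓ := by
  refine ⟨fun j => (hU.1 j).translate ?_ a, hU.2.1.translate ?_ a, ?_⟩
  · intro a z hz; simpa [FluidSlab.slabShift, slab] using hz
  · intro a z hz; simpa [FluidSlab.slabShift] using hz
  · rw [divergence_eq_zero_iff]
    have h := (divergence_eq_zero_iff U).1 hU.2.2
    simp only [jetTranslate_snd, compL_slabTranslation]
    rw [← map_sum, h, map_zero]

lemma jet_norm_sq (U : Jet d ℓ) : ‖U‖ ^ 2 = ‖U.fst‖ ^ 2 + ∑ j, ‖U.snd j‖ ^ 2 := by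
  rw [WithLp.prod_norm_sq_eq_of_L2, PiLp.norm_sq_eq_of_L2]

lemma norm_jetTranslate (a : Hor d) (U : Jet d ℓ) : ‖jetTranslate a U‖ = ‖U‖ := by
  have : ‖jetTranslate a U‖ ^ 2 = ‖U‖ ^ 2 := by
    simp only [jet_norm_sq, jetTranslate_fst, jetTranslate_snd, norm_slabTranslation]
  exact (sq_eq_sq₀ (norm_nonneg _) (norm_nonneg _)).1 this

/-- Horizontal translations of solenoidal fields. -/
def solTranslation (d : ℕ) (ℓ : ℝ) : TranslationFamily d (solenoidal d ℓ) where
  op a := LinearMap.mkContinuous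
    { toFun := fun u => ⟨jetTranslate a u.1, jetTranslate_mem u.2 a⟩
      map_add' := fun u v => Subtype.ext <| by
        simp only [jetTranslate, Submodule.coe_add, WithLp.add_fst, WithLp.add_snd, PiLp.add_apply,
          map_add]
        rfl
      map_smul' := fun c u => Subtype.ext <| by
        simp only [jetTranslate, Submodule.coe_smul, WithLp.smul_fst, WithLp.smul_snd,
          PiLp.smul_apply, map_smul]
        rfl } 1 fun u => by
      rw [one_mul]; exact (norm_jetTranslate a u.1).le
  norm_op_le a u := (norm_jetTranslate a u.1).le
  continuous_op u := by
    refine Continuous.subtype_mk (p := fun w => w ∈ solenoidal d ℓ) ?_ _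
    refine (WithLp.prod_continuous_toLp 2 _ _).comp (Continuous.prodMk ?_ ?_)
    · exact (slabTranslation d ℓ (Vel d)).continuous_op _
    · refine (PiLp.continuous_toLp 2 _).comp (continuous_pi fun j => ?_)
      exact (slabTranslation d ℓ (Vel d)).continuous_op _

/-- The partial derivative of a solenoidal field. -/
def gradL (d : ℕ) (ℓ : ℝ) (j : Fin (d + 1)) : solenoidal d ℓ →L[ℝ] L2Slab d ℓ :=
  (jetGrad d ℓ j).comp (solenoidal d ℓ).subtypeL

@[simp] lemma gradL_apply (j : Fin (d + 1)) (u : solenoidal d ℓ) : gradL d ℓ j u = u.1.snd j := rfl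

@[simp] lemma toL2_apply (u : solenoidal d ℓ) : toL2 d ℓ u = u.1.fst := rfl

/-- Horizontal convolution of solenoidal fields. -/
def solConv (ℓ : ℝ) (k : SchwartzMap (Hor d) ℝ) : solenoidal d ℓ →L[ℝ] solenoidal d ℓ :=
  (solTranslation d ℓ).avg k

/-- Horizontal convolution on `L²(Ω; E)`. -/
def slabConv (ℓ : ℝ) (E : Type*) [NormedAddCommGroup E] [NormedSpace ℝ E]
    (k : SchwartzMap (Hor d) ℝ) : Lp E 2 (slabVol d ℓ) →L[ℝ] Lp E 2 (slabVol d ℓ) :=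
  (slabTranslation d ℓ E).avg k

/-- Convolution on `L²(Σ)`. -/
def horConv (k : SchwartzMap (Hor d) ℝ) : L2Hor d →L[ℝ] L2Hor d := (horTranslation d ℝ).avg k

lemma toL2_solConv (k : SchwartzMap (Hor d) ℝ) (u : solenoidal d ℓ) :
    toL2 d ℓ (solConv ℓ k u) = slabConv ℓ (Vel d) k (toL2 d ℓ u) :=
  TranslationFamily.map_avg _ _ (toL2 d ℓ) (fun _ _ => rfl) k u

lemma gradL_solConv (k : SchwartzMap (Hor d) ℝ) (j : Fin (d + 1)) (u : solenoidal d ℓ) :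
    gradL d ℓ j (solConv ℓ k u) = slabConv ℓ (Vel d) k (gradL d ℓ j u) :=
  TranslationFamily.map_avg _ _ (gradL d ℓ j) (fun _ _ => rfl) k u

lemma compL_slabConv (k : SchwartzMap (Hor d) ℝ) (i : Fin (d + 1)) (f : L2Slab d ℓ) :
    compL d ℓ i (slabConv ℓ (Vel d) k f) = slabConv ℓ ℝ k (compL d ℓ i f) :=
  TranslationFamily.map_avg _ _ (compL d ℓ i) (fun a f => compL_slabTranslation i a f) k f

lemma inner_slabConv {E : Type*} [NormedAddCommGroup E] [InnerProductSpace ℝ E] [CompleteSpace E]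
    {k : SchwartzMap (Hor d) ℝ} (hk : ∀ a, k (-a) = k a) (f g : Lp E 2 (slabVol d ℓ)) :
    (inner ℝ (slabConv ℓ E k f) g : ℝ) = inner ℝ f (slabConv ℓ E k g) :=
  TranslationFamily.inner_avg_left _ inner_slabTranslation k hk f g

lemma inner_horConv {k : SchwartzMap (Hor d) ℝ} (hk : ∀ a, k (-a) = k a) (f g : L2Hor d) :
    (inner ℝ (horConv k f) g : ℝ) = inner ℝ f (horConv k g) :=
  TranslationFamily.inner_avg_left _ inner_horTranslation k hk f g

/-- The `(i, j)` entry of the symmetrized gradient in `L²(Ω)`. -/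
def symGradL (d : ℕ) (ℓ : ℝ) (i j : Fin (d + 1)) : solenoidal d ℓ →L[ℝ] L2Scalar d ℓ :=
  (compL d ℓ j).comp (gradL d ℓ i) + (compL d ℓ i).comp (gradL d ℓ j)

lemma symGradL_apply (i j : Fin (d + 1)) (u : solenoidal d ℓ) :
    symGradL d ℓ i j u = compL d ℓ j (u.1.snd i) + compL d ℓ i (u.1.snd j) := rfl

lemma coeFn_symGradL (i j : Fin (d + 1)) (u : solenoidal d ℓ) :
    symGradL d ℓ i j u =ᵐ[slabVol d ℓ] symGrad u i j := by
  rw [symGradL_apply]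
  filter_upwards [Lp.coeFn_add (compL d ℓ j (u.1.snd i)) (compL d ℓ i (u.1.snd j)),
    coeFn_compL j (u.1.snd i), coeFn_compL i (u.1.snd j)] with z h1 h2 h3
  rw [h1, Pi.add_apply, h2, h3]; rfl

lemma symGradInner_eq (u v : solenoidal d ℓ) :
    symGradInner u v = ∑ i, ∑ j, (inner ℝ (symGradL d ℓ i j u) (symGradL d ℓ i j v) : ℝ) := by
  have h : ∀ i j, (inner ℝ (symGradL d ℓ i j u) (symGradL d ℓ i j v) : ℝ)
      = ∫ z in slab d ℓ, symGrad u i j z * symGrad v i j z := fun i j => by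
    rw [L2.inner_def]
    refine integral_congr_ae ?_
    filter_upwards [coeFn_symGradL i j u, coeFn_symGradL i j v] with z h1 h2
    rw [h1, h2]
    simp [mul_comm]
  have hi : ∀ i j, Integrable (fun z => symGrad u i j z * symGrad v i j z) (slabVol d ℓ) := fun i j => by
    have := MemLp.integrable_mul (Lp.memLp (symGradL d ℓ i j u)) (Lp.memLp (symGradL d ℓ i j v))
    refine this.congr ?_
    filter_upwards [coeFn_symGradL i j u, coeFn_symGradL i j v] with z h1 h2
    simp [h1, h2]
  rw [symGradInner, integral_finsetSum _ fun i _ => integrable_finsetSum _ fun j _ => hi i j]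
  refine Finset.sum_congr rfl fun i _ => ?_
  rw [integral_finsetSum _ fun j _ => hi i j]
  exact Finset.sum_congr rfl fun j _ => (h i j).symm

lemma symGradL_solConv (k : SchwartzMap (Hor d) ℝ) (i j : Fin (d + 1)) (u : solenoidal d ℓ) :
    symGradL d ℓ i j (solConv ℓ k u) = slabConv ℓ ℝ k (symGradL d ℓ i j u) := by
  simp only [symGradL, add_apply, ContinuousLinearMap.comp_apply, gradL_solConv,
    compL_slabConv, map_add]

/-- With v = Ku this turns the viscous term tested against KKu into the dissipation of Ku. -/
lemma symGradInner_solConv {k : SchwartzMap (Hor d) ℝ} (hk : ∀ a, k (-a) = k a)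
    (u v : solenoidal d ℓ) :
    symGradInner u (solConv ℓ k v) = symGradInner (solConv ℓ k u) v := by
  simp only [symGradInner_eq, symGradL_solConv, inner_slabConv hk]

/-- The squared norm of the symmetrized gradient. -/
def dissip (u : solenoidal d ℓ) : ℝ := ∑ i, ∑ j, ‖symGradL d ℓ i j u‖ ^ 2

lemma symGradInner_self (u : solenoidal d ℓ) : symGradInner u u = dissip u := by
  simp only [symGradInner_eq, real_inner_self_eq_norm_sq, dissip]

end Solenoidal

/-! ### L² norms by duality with test functions -/

section Density

variable {E : Type*} [NormedAddCommGroup E] [NormedSpace ℝ E] [FiniteDimensional ℝ E]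
  [MeasurableSpace E] [BorelSpace E] {μ : Measure E} [IsLocallyFiniteMeasure μ] {U : Set E}

lemma norm_sq_eq_integral {α : Type*} [MeasurableSpace α] {μ : Measure α} (f : Lp ℝ 2 μ) :
    ‖f‖ ^ 2 = ∫ z, f z ^ 2 ∂μ := by
  rw [← real_inner_self_eq_norm_sq, L2.inner_def]
  simp [pow_two]

lemma inner_toLp_eq_integral {α : Type*} [MeasurableSpace α] {μ : Measure α} {ψ : α → ℝ}
    (hψ : MemLp ψ 2 μ) (f : Lp ℝ 2 μ) : (inner ℝ (hψ.toLp ψ) f : ℝ) = ∫ z, ψ z * f z ∂μ := by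
  rw [L2.inner_def]
  refine integral_congr_ae ?_
  filter_upwards [hψ.coeFn_toLp] with z hz
  rw [hz]
  simp [mul_comm]

/-- The classes of the test functions supported in `U`. -/
def testSubmodule (μ : Measure E) [IsLocallyFiniteMeasure μ] (U : Set E) : Submodule ℝ (Lp ℝ 2 μ) where
  carrier := {x | ∃ ψ : E → ℝ, ContDiff ℝ ∞ ψ ∧ HasCompactSupport ψ ∧ tsupport ψ ⊆ U ∧ x =ᵐ[μ] ψ}
  zero_mem' := ⟨0, contDiff_const, HasCompactSupport.zero, by simp [tsupport], Lp.coeFn_zero _ _ _⟩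
  add_mem' := by
    rintro x y ⟨ψ, h1, h2, h3, h4⟩ ⟨χ, k1, k2, k3, k4⟩
    refine ⟨ψ + χ, h1.add k1, h2.add k2, (tsupport_add _ _).trans (union_subset h3 k3), ?_⟩
    filter_upwards [Lp.coeFn_add x y, h4, k4] with z a b c
    rw [a, Pi.add_apply, b, c]; rfl
  smul_mem' := by
    rintro c x ⟨ψ, h1, h2, h3, h4⟩
    refine ⟨c • ψ, contDiff_const.smul h1, h2.smul_left (f := fun _ => c), ?_, ?_⟩
    · exact (closure_mono (Function.support_const_smul_subset c ψ)).trans h3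
    · filter_upwards [Lp.coeFn_smul c x, h4] with z a b
      rw [a, Pi.smul_apply, b]; rfl

/-- An `L²` function is bounded by its pairings with test functions. -/
lemma norm_le_of_forall_test (hU : IsOpen U) (hμU : μ Uᶜ = 0) (f : Lp ℝ 2 μ) {C : ℝ} (hC : 0 ≤ C)
    (h : ∀ ψ : E → ℝ, ContDiff ℝ ∞ ψ → HasCompactSupport ψ → tsupport ψ ⊆ U →
      ∀ hψ : MemLp ψ 2 μ, ∫ z, ψ z * f z ∂μ ≤ C * ‖hψ.toLp ψ‖) : ‖f‖ ≤ C := by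
  set S := testSubmodule μ U with hS
  -- A function orthogonal to all test functions supported in U vanishes almost everywhere on U, and
  -- the complement of U is null.
  have hdense : S.topologicalClosure = ⊤ := by
    rw [Submodule.topologicalClosure_eq_top_iff, Submodule.eq_bot_iff]
    intro x hx
    have h1 : ∀ᵐ z ∂μ, z ∈ U → x z = 0 := by
      refine hU.ae_eq_zero_of_integral_contDiff_smul_eq_zero
        ((Lp.memLp x).locallyIntegrable one_le_two |>.locallyIntegrableOn _) fun ψ a b c => ?_
      have hψ : MemLp ψ 2 μ := a.continuous.memLp_of_hasCompactSupport b
      have := (Submodule.mem_orthogonal S x).1 hx (hψ.toLp ψ) ⟨ψ, a, b, c, hψ.coeFn_toLp⟩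
      rwa [inner_toLp_eq_integral] at this
    refine Lp.ext ?_
    have h2 : ∀ᵐ z ∂μ, z ∈ U := hμU
    filter_upwards [h1, h2, Lp.coeFn_zero ℝ 2 μ] with z a b c
    rw [a b, c]; rfl
  have hall : ∀ x : Lp ℝ 2 μ, (inner ℝ x f : ℝ) ≤ C * ‖x‖ := by
    intro x
    have hx : x ∈ S.topologicalClosure := by rw [hdense]; trivial
    rw [← SetLike.mem_coe, Submodule.topologicalClosure_coe] at hx
    refine closure_minimal (s := (S : Set (Lp ℝ 2 μ)))
      (t := {x : Lp ℝ 2 μ | (inner ℝ x f : ℝ) ≤ C * ‖x‖}) ?_ ?_ hx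
    · rintro y ⟨ψ, a, b, c, e⟩
      have hψ : MemLp ψ 2 μ := a.continuous.memLp_of_hasCompactSupport b
      have : y = hψ.toLp ψ := Lp.ext (e.trans hψ.coeFn_toLp.symm)
      rw [mem_ofPred_eq, this, inner_toLp_eq_integral]
      exact h ψ a b c hψ
    · exact isClosed_le (continuous_id.inner continuous_const) (continuous_const.mul continuous_norm)
  have := hall f
  rw [real_inner_self_eq_norm_sq] at this
  nlinarith [norm_nonneg f]

end Density

/-! ### Products of a vertical profile and a surface function -/

section Tensor

variable {d : ℕ} {ℓ : ℝ}

lemma slabVol_eq_prod (d : ℕ) (ℓ : ℝ) :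
    slabVol d ℓ = (volume : Measure (Hor d)).prod ((volume : Measure ℝ).restrict (Ioo 0 ℓ)) := by
  have h : slab d ℓ = univ ×ˢ Ioo 0 ℓ := by ext z; simp [slab]
  rw [slabVol, h, Measure.volume_eq_prod, ← Measure.prod_restrict, Measure.restrict_univ]

lemma memLp_tensor {p : ℝ → ℝ} (hp : Continuous p) {f : Hor d → ℝ} (hf : MemLp f 2 volume) :
    MemLp (fun z : Hor d × ℝ => p z.2 * f z.1) 2 (slabVol d ℓ) := by
  have hpi : MemLp p 2 ((volume : Measure ℝ).restrict (Ioo 0 ℓ)) := by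
    rw [memLp_two_iff_integrable_sq hp.aestronglyMeasurable]
    exact ((hp.pow 2).integrableOn_Icc).mono_set Ioo_subset_Icc_self
  rw [slabVol_eq_prod, memLp_two_iff_integrable_sq]
  · refine (Integrable.mul_prod hf.integrable_sq hpi.integrable_sq).congr
      (Eventually.of_forall fun z => ?_)
    simp only; ring
  · exact (hp.aestronglyMeasurable.comp_snd).mul hf.1.comp_fst

/-- The tensor product `p(y) f(x)`. -/
def tensor (ℓ : ℝ) {p : ℝ → ℝ} (hp : Continuous p) (f : L2Hor d) : L2Scalar d ℓ :=
  (memLp_tensor hp (Lp.memLp f)).toLp _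

lemma coeFn_tensor {p : ℝ → ℝ} (hp : Continuous p) (f : L2Hor d) :
    tensor ℓ hp f =ᵐ[slabVol d ℓ] fun z => p z.2 * f z.1 :=
  MemLp.coeFn_toLp _

lemma ae_slabVol_fst {P : Hor d → Prop} (h : ∀ᵐ x, P x) : ∀ᵐ z ∂(slabVol d ℓ), P z.1 := by
  rw [slabVol_eq_prod]
  exact Measure.quasiMeasurePreserving_fst.ae h

lemma norm_tensor_sq {p : ℝ → ℝ} (hp : Continuous p) (f : L2Hor d) :
    ‖tensor ℓ hp f‖ ^ 2 = (∫ y in Ioo 0 ℓ, p y ^ 2) * ‖f‖ ^ 2 := by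
  have h1 : ‖tensor ℓ hp f‖ ^ 2 = ∫ z, f z.1 ^ 2 * p z.2 ^ 2 ∂(slabVol d ℓ) := by
    rw [norm_sq_eq_integral]
    refine integral_congr_ae ?_
    filter_upwards [coeFn_tensor (ℓ := ℓ) hp f] with z hz
    rw [hz]; ring
  rw [h1, slabVol_eq_prod, integral_prod_mul (fun x => f x ^ 2) (fun y => p y ^ 2),
    norm_sq_eq_integral, mul_comm]

/-- The tensor product with a fixed profile as a continuous linear map. -/
def tensorL (d : ℕ) (ℓ : ℝ) {p : ℝ → ℝ} (hp : Continuous p) : L2Hor d →L[ℝ] L2Scalar d ℓ :=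
  LinearMap.mkContinuous
    { toFun := tensor ℓ hp
      map_add' := fun f g => by
        refine Lp.ext ?_
        filter_upwards [coeFn_tensor (ℓ := ℓ) hp f, coeFn_tensor (ℓ := ℓ) hp g,
          coeFn_tensor (ℓ := ℓ) hp (f + g), Lp.coeFn_add (tensor ℓ hp f) (tensor ℓ hp g),
          ae_slabVol_fst (Lp.coeFn_add f g)] with z a b c e k
        rw [c, e, Pi.add_apply, a, b, k, Pi.add_apply, mul_add]
      map_smul' := fun c f => by
        refine Lp.ext ?_
        filter_upwards [coeFn_tensor (ℓ := ℓ) hp f, coeFn_tensor (ℓ := ℓ) hp (c • f),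
          Lp.coeFn_smul c (tensor ℓ hp f), ae_slabVol_fst (Lp.coeFn_smul c f)] with z a b e k
        rw [RingHom.id_apply, b, e, Pi.smul_apply, a, k, Pi.smul_apply]
        simp only [smul_eq_mul]; ring } (√(∫ y in Ioo 0 ℓ, p y ^ 2)) fun f => by
    refine abs_le_of_sq_le_sq' ?_ (by positivity) |>.2
    rw [mul_pow, Real.sq_sqrt (integral_nonneg fun y => sq_nonneg _)]
    exact (norm_tensor_sq hp f).le

lemma tensorL_apply {p : ℝ → ℝ} (hp : Continuous p) (f : L2Hor d) :
    tensorL d ℓ hp f = tensor ℓ hp f := rfl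

lemma norm_sq_eq_sum_compL (f : L2Slab d ℓ) : ‖f‖ ^ 2 = ∑ i, ‖compL d ℓ i f‖ ^ 2 := by
  have h1 : ‖f‖ ^ 2 = ∫ z, ∑ i, compL d ℓ i f z ^ 2 ∂(slabVol d ℓ) := by
    rw [← real_inner_self_eq_norm_sq, L2.inner_def]
    refine integral_congr_ae ?_
    filter_upwards [ae_all_iff.2 fun i => coeFn_compL i f] with z hz
    rw [real_inner_self_eq_norm_sq, EuclideanSpace.norm_sq_eq]
    exact Finset.sum_congr rfl fun i _ => by rw [hz i, Real.norm_eq_abs, sq_abs]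
  rw [h1, integral_finsetSum _ fun i _ => (Lp.memLp (compL d ℓ i f)).integrable_sq]
  exact Finset.sum_congr rfl fun i _ => (norm_sq_eq_integral _).symm

end Tensor

/-! ### Korn's inequality in the slab -/

section Korn

variable {d : ℕ} {ℓ : ℝ}

lemma IsWeakPartial.component {U : Set (Hor d × ℝ)} {j : Fin (d + 1)} {f g : L2Slab d ℓ}
    (h : IsWeakPartial U j f g) (i : Fin (d + 1)) {φ : Hor d × ℝ → ℝ} (hφ : IsTest U φ) :
    ∫ z in slab d ℓ, pderiv j φ z * compL d ℓ i f z = - ∫ z in slab d ℓ, φ z * compL d ℓ i g z := by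
  have h1 := congrArg (EuclideanSpace.proj i : Vel d →L[ℝ] ℝ) (h φ hφ)
  rw [map_neg, ← ContinuousLinearMap.integral_comp_comm _
    (integrable_smul_L2Slab (hφ.memLp_pderiv ℓ j) f),
    ← ContinuousLinearMap.integral_comp_comm _ (integrable_smul_L2Slab (hφ.memLp ℓ) g)] at h1
  have e1 : ∫ z in slab d ℓ, pderiv j φ z * compL d ℓ i f z
      = ∫ z in slab d ℓ, (EuclideanSpace.proj i : Vel d →L[ℝ] ℝ) (pderiv j φ z • f z) := by
    refine integral_congr_ae ?_
    filter_upwards [coeFn_compL i f] with z hz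
    rw [hz]; simp
  have e2 : ∫ z in slab d ℓ, φ z * compL d ℓ i g z
      = ∫ z in slab d ℓ, (EuclideanSpace.proj i : Vel d →L[ℝ] ℝ) (φ z • g z) := by
    refine integral_congr_ae ?_
    filter_upwards [coeFn_compL i g] with z hz
    rw [hz]; simp
  rw [e1, e2, h1]

lemma isWeakPartial_of_component {U : Set (Hor d × ℝ)} {j : Fin (d + 1)} {f g : L2Slab d ℓ}
    (h : ∀ i, ∀ φ : Hor d × ℝ → ℝ, IsTest U φ →
      ∫ z in slab d ℓ, pderiv j φ z * compL d ℓ i f z = - ∫ z in slab d ℓ, φ z * compL d ℓ i g z) :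
    IsWeakPartial U j f g := by
  intro φ hφ
  ext i
  have e : ∀ (χ : Hor d × ℝ → ℝ) (_ : MemLp χ 2 (slabVol d ℓ)) (f : L2Slab d ℓ),
      (∫ z in slab d ℓ, χ z • f z) i = ∫ z in slab d ℓ, χ z * compL d ℓ i f z := fun χ hχ f => by
    have := ContinuousLinearMap.integral_comp_comm (EuclideanSpace.proj i : Vel d →L[ℝ] ℝ)
      (integrable_smul_L2Slab hχ f)
    refine this.symm.trans ?_
    refine integral_congr_ae ?_
    filter_upwards [coeFn_compL i f] with z hz
    rw [hz]; simp
  rw [PiLp.neg_apply, e _ (hφ.memLp_pderiv ℓ j), e _ (hφ.memLp ℓ), h i φ hφ]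

@[simp] lemma dir_last : dir d (Fin.last d) = (0, 1) := by simp [dir]

@[simp] lemma dir_castSucc (i : Fin d) : dir d i.castSucc = (EuclideanSpace.single i 1, 0) := by
  simp [dir]

/-- Horizontal weak derivatives need no boundary condition at the bottom. -/
lemma IsWeakPartial.extend_bottom {i : Fin d} {f g : L2Slab d ℓ}
    (h : IsWeakPartial (slab d ℓ) i.castSucc f g) :
    IsWeakPartial {z : Hor d × ℝ | z.2 < ℓ} i.castSucc f g := by
  intro φ hφ
  -- A cut-off in y alone, vanishing for y ≤ 1/(n+1) and tending to 1. Being constant in x it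
  -- commutes with ∂ᵢ, so the limit leaves no boundary term; with ∂_y it would.
  let η : ℕ → ℝ → ℝ := fun n y => Real.smoothTransition ((n + 1 : ℝ) * y - 1)
  have hηs : ∀ n, ContDiff ℝ ∞ (η n) := fun n =>
    Real.smoothTransition.contDiff.comp (by fun_prop)
  have hη0 : ∀ (n : ℕ) (y : ℝ), y < ((n : ℝ) + 1)⁻¹ → η n y = 0 := fun n y hy => by
    refine Real.smoothTransition.zero_of_nonpos ?_
    have : (0 : ℝ) < n + 1 := by positivity
    have := mul_lt_mul_of_pos_left hy this
    rw [mul_inv_cancel₀ (by positivity)] at this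
    linarith
  have hη1 : ∀ y, 0 < y → ∀ᶠ n : ℕ in atTop, η n y = 1 := fun y hy => by
    obtain ⟨m, hm⟩ := exists_nat_ge (2 / y)
    filter_upwards [eventually_ge_atTop m] with n hn
    refine Real.smoothTransition.one_of_one_le ?_
    have h1 : (2 / y) ≤ (n : ℝ) := hm.trans (by exact_mod_cast hn)
    rw [div_le_iff₀ hy] at h1
    nlinarith
  have hηb : ∀ n y, |η n y| ≤ 1 := fun n y => by
    rw [abs_of_nonneg (Real.smoothTransition.nonneg _)]
    exact Real.smoothTransition.le_one _
  have htest : ∀ n, IsTest (slab d ℓ) (fun z => η n z.2 * φ z) := fun n => by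
    refine ⟨((hηs n).comp contDiff_snd).mul hφ.smooth, hφ.compact.mul_left, ?_⟩
    have h1 : tsupport (fun z : Hor d × ℝ => η n z.2 * φ z)
        ⊆ tsupport φ ∩ {z | ((n : ℝ) + 1)⁻¹ ≤ z.2} := by
      refine closure_minimal (fun z hz => ⟨subset_tsupport _ ?_, ?_⟩)
        ((isClosed_tsupport φ).inter (isClosed_le continuous_const continuous_snd))
      · exact right_ne_zero_of_mul hz
      · by_contra hlt
        exact left_ne_zero_of_mul hz (hη0 n z.2 (not_le.1 hlt))
    refine h1.trans fun z hz => ⟨lt_of_lt_of_le (by positivity) hz.2, hφ.supp hz.1⟩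
  have hpd : ∀ n z, pderiv i.castSucc (fun z => η n z.2 * φ z) z = η n z.2 * pderiv i.castSucc φ z := by
    intro n z
    simp only [pderiv]
    have d1 : HasFDerivAt (fun z : Hor d × ℝ => η n z.2)
        ((fderiv ℝ (η n) z.2).comp (ContinuousLinearMap.snd ℝ (Hor d) ℝ)) z :=
      (((hηs n).differentiable (by simp)).differentiableAt.hasFDerivAt).comp z hasFDerivAt_snd
    have d2 : HasFDerivAt φ (fderiv ℝ φ z) z :=
      ((hφ.smooth.differentiable (by simp)).differentiableAt).hasFDerivAt
    rw [(d1.fun_mul d2).fderiv]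
    simp
  have hlim : ∀ (χ : Hor d × ℝ → ℝ) (f : L2Slab d ℓ), MemLp χ 2 (slabVol d ℓ) →
      Tendsto (fun n : ℕ => ∫ z in slab d ℓ, (η n z.2 * χ z) • f z) atTop
        (𝓝 (∫ z in slab d ℓ, χ z • f z)) := by
    intro χ f hχ
    have hi := integrable_smul_L2Slab hχ f
    refine tendsto_integral_of_dominated_convergence (fun z => ‖χ z • f z‖) (fun n => ?_) hi.norm ?_ ?_
    · have := ((hηs n).continuous.comp continuous_snd).aestronglyMeasurable (μ := slabVol d ℓ)
      refine (this.smul hi.1).congr (Eventually.of_forall fun z => ?_)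
      simp [mul_smul]
    · refine fun n => Eventually.of_forall fun z => ?_
      rw [mul_smul, norm_smul]
      exact mul_le_of_le_one_left (norm_nonneg _) (hηb n _)
    · filter_upwards [ae_restrict_mem (measurableSet_slab d ℓ)] with z hz
      refine tendsto_const_nhds.congr' ?_
      filter_upwards [hη1 z.2 hz.1] with n hn
      rw [hn, one_mul]
  refine tendsto_nhds_unique (hlim _ f (hφ.memLp_pderiv ℓ _)) ?_
  refine ((hlim φ g (hφ.memLp ℓ)).neg).congr fun n => ?_
  rw [← h _ (htest n)]
  simp only [hpd]

/-- The integral of a test function along a ray. -/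
def rayIntegral (ℓ : ℝ) (e : Hor d × ℝ) (ψ : Hor d × ℝ → ℝ) (z : Hor d × ℝ) : ℝ :=
  ∫ s in (0 : ℝ)..ℓ, ψ (z + s • e)

/-- The ray integral is the convolution of ψ with the image of Lebesgue measure on (0, ℓ] under s ↦
-s·e, so smoothness is that of a convolution with a compactly supported smooth function. -/
lemma contDiff_rayIntegral (hℓ : 0 < ℓ) (e : Hor d × ℝ) {ψ : Hor d × ℝ → ℝ} (hψ : ContDiff ℝ ∞ ψ)
    (hc : HasCompactSupport ψ) : ContDiff ℝ ∞ (rayIntegral ℓ e ψ) := by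
  let ν : Measure (Hor d × ℝ) := (volume.restrict (Ioc 0 ℓ)).map (fun s : ℝ => -(s • e))
  have hm : Measurable (fun s : ℝ => -(s • e)) := by fun_prop
  have : IsFiniteMeasure ν := Measure.isFiniteMeasure_map _ _
  have h := hc.contDiff_convolution_right (𝕜 := ℝ) (μ := ν) (n := ⊤)
    (ContinuousLinearMap.mul ℝ ℝ) (f := fun _ => (1 : ℝ)) (integrable_const 1).locallyIntegrable hψ
  have e1 : convolution (fun _ => (1 : ℝ)) ψ (ContinuousLinearMap.mul ℝ ℝ) ν = rayIntegral ℓ e ψ := by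
    ext z
    rw [convolution_def, rayIntegral, intervalIntegral.integral_of_le hℓ.le]
    rw [integral_map hm.aemeasurable]
    · simp
    · have := hψ.continuous
      exact Continuous.aestronglyMeasurable (by simp only [ContinuousLinearMap.mul_apply', one_mul]; fun_prop)
  rwa [e1] at h

lemma fderiv_rayIntegral (hℓ : 0 < ℓ) (e : Hor d × ℝ) {ψ : Hor d × ℝ → ℝ} (hψ : ContDiff ℝ ∞ ψ)
    (hc : HasCompactSupport ψ) (z : Hor d × ℝ) :
    fderiv ℝ (rayIntegral ℓ e ψ) z e = ψ (z + ℓ • e) - ψ z := by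
  have hcont : Continuous fun s : ℝ => ψ (z + s • e) := by have := hψ.continuous; fun_prop
  have h1 : HasDerivAt (fun t : ℝ => rayIntegral ℓ e ψ (z + t • e)) (fderiv ℝ (rayIntegral ℓ e ψ) z e) 0 := by
    have a : HasFDerivAt (rayIntegral ℓ e ψ) (fderiv ℝ (rayIntegral ℓ e ψ) z) (z + (0 : ℝ) • e) := by
      rw [zero_smul, add_zero]
      exact ((contDiff_rayIntegral hℓ e hψ hc).differentiable (by simp)).differentiableAt.hasFDerivAt
    have b : HasDerivAt (fun t : ℝ => z + t • e) e 0 := by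
      simpa using ((hasDerivAt_id (0 : ℝ)).smul_const e).const_add z
    exact a.comp_hasDerivAt 0 b
  let P : ℝ → ℝ := fun t => ∫ s in (0 : ℝ)..t, ψ (z + s • e)
  have hP : ∀ t, HasDerivAt P (ψ (z + t • e)) t := fun t =>
    intervalIntegral.integral_hasDerivAt_right (hcont.intervalIntegrable _ _)
      (hcont.stronglyMeasurableAtFilter _ _) hcont.continuousAt
  have h2 : (fun t : ℝ => rayIntegral ℓ e ψ (z + t • e)) = fun t => P (ℓ + t) - P t := by
    ext t
    simp only [rayIntegral, P]
    have e1 : ∀ s : ℝ, z + t • e + s • e = z + (s + t) • e := fun s => by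
      rw [add_assoc, ← add_smul, add_comm t s]
    simp only [e1]
    rw [intervalIntegral.integral_comp_add_right (fun s => ψ (z + s • e)) t, zero_add,
      intervalIntegral.integral_interval_sub_left (hcont.intervalIntegrable _ _)
        (hcont.intervalIntegrable _ _)]
  have h3 : HasDerivAt (fun t : ℝ => P (ℓ + t) - P t) (ψ (z + ℓ • e) - ψ z) 0 := by
    have a : HasDerivAt (fun t : ℝ => P (ℓ + t)) (ψ (z + ℓ • e)) 0 := by
      have := (hP (ℓ + 0)).comp_const_add ℓ 0
      simpa using this
    have b := hP 0
    rw [zero_smul, add_zero] at b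
    exact a.sub b
  rw [h2] at h1
  exact h1.unique h3

/-- Integrating along e moves the support only downwards. It may cross y = 0, which the bottom
condition permits, but never reaches y = ℓ. -/
lemma isTest_rayIntegral (hℓ : 0 < ℓ) {e : Hor d × ℝ} (he : 0 ≤ e.2) {ψ : Hor d × ℝ → ℝ}
    (hψ : IsTest (slab d ℓ) ψ) : IsTest {z : Hor d × ℝ | z.2 < ℓ} (rayIntegral ℓ e ψ) := by
  set K : Set (Hor d × ℝ) := (fun w : (Hor d × ℝ) × ℝ => w.1 - w.2 • e) '' (tsupport ψ ×ˢ Icc 0 ℓ)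
  have hK : IsCompact K := (hψ.compact.isCompact.prod isCompact_Icc).image (by fun_prop)
  have hz : ∀ z, z ∉ K → rayIntegral ℓ e ψ z = 0 := by
    intro z hz
    refine intervalIntegral.integral_zero_ae (Eventually.of_forall fun s hs => ?_)
    by_contra hne
    rw [uIoc_of_le hℓ.le] at hs
    exact hz ⟨(z + s • e, s), ⟨subset_tsupport _ hne, hs.1.le, hs.2⟩, by simp⟩
  refine ⟨contDiff_rayIntegral hℓ e hψ.smooth hψ.compact, HasCompactSupport.intro hK hz, ?_⟩
  have hsub : tsupport (rayIntegral ℓ e ψ) ⊆ K := closure_minimal (fun z hz' => by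
    by_contra h; exact hz' (hz z h)) hK.isClosed
  refine hsub.trans ?_
  rintro _ ⟨w, ⟨h1, h2⟩, rfl⟩
  have := (hψ.supp h1).2
  have h3 := mul_nonneg h2.1 he
  simp only [mem_ofPred_eq, Prod.snd_sub, Prod.smul_snd, smul_eq_mul]
  linarith

lemma sq_intervalIntegral_le (hℓ : 0 < ℓ) {q : ℝ → ℝ} (hq : Continuous q) :
    (∫ s in (0 : ℝ)..ℓ, q s) ^ 2 ≤ ℓ * ∫ s in (0 : ℝ)..ℓ, q s ^ 2 := by
  set I := ∫ s in (0 : ℝ)..ℓ, q s with hI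
  have h1 : 0 ≤ ∫ s in (0 : ℝ)..ℓ, (q s - I / ℓ) ^ 2 :=
    intervalIntegral.integral_nonneg hℓ.le fun s _ => sq_nonneg _
  have h2 : ∫ s in (0 : ℝ)..ℓ, (q s - I / ℓ) ^ 2
      = (∫ s in (0 : ℝ)..ℓ, q s ^ 2) - 2 * (I / ℓ) * I + ℓ * (I / ℓ) ^ 2 := by
    have e : ∀ s, (q s - I / ℓ) ^ 2 = q s ^ 2 - 2 * (I / ℓ) * q s + (I / ℓ) ^ 2 := fun s => by ring
    simp only [e]
    rw [intervalIntegral.integral_add ((by fun_prop : Continuous fun s => q s ^ 2 - 2 * (I / ℓ) * q s).intervalIntegrable _ _)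
      intervalIntegrable_const, intervalIntegral.integral_sub ((by fun_prop : Continuous fun s => q s ^ 2).intervalIntegrable _ _)
      ((hq.const_mul _).intervalIntegrable _ _), intervalIntegral.integral_const_mul,
      intervalIntegral.integral_const, ← hI]
    simp
  rw [h2] at h1
  have h3 : ℓ * ((∫ s in (0 : ℝ)..ℓ, q s ^ 2) - 2 * (I / ℓ) * I + ℓ * (I / ℓ) ^ 2)
      = ℓ * (∫ s in (0 : ℝ)..ℓ, q s ^ 2) - I ^ 2 := by field_simp; ring
  nlinarith [mul_nonneg hℓ.le h1]

lemma norm_toLp_sq_ofReal {α : Type*} [MeasurableSpace α] {μ : Measure α} {ψ : α → ℝ}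
    (hψ : MemLp ψ 2 μ) :
    ENNReal.ofReal (‖hψ.toLp ψ‖ ^ 2) = ∫⁻ z, ENNReal.ofReal (ψ z ^ 2) ∂μ := by
  rw [norm_sq_eq_integral, ← ofReal_integral_eq_lintegral_ofReal hψ.integrable_sq
    (Eventually.of_forall fun z => sq_nonneg _)]
  congr 1
  refine integral_congr_ae ?_
  filter_upwards [hψ.coeFn_toLp] with z hz
  rw [hz]

/-- Cauchy–Schwarz in s costs one factor ℓ. After enlarging the domain to the whole space,
translation invariance makes the remaining s-integral cost the other. -/
lemma norm_rayIntegral_le (hℓ : 0 < ℓ) {e : Hor d × ℝ} {ψ : Hor d × ℝ → ℝ}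
    (hψ : IsTest (slab d ℓ) ψ) (h1 : MemLp ψ 2 (slabVol d ℓ))
    (h2 : MemLp (rayIntegral ℓ e ψ) 2 (slabVol d ℓ)) : ‖h2.toLp _‖ ≤ ℓ * ‖h1.toLp _‖ := by
  refine abs_le_of_sq_le_sq' ?_ (by positivity) |>.2
  rw [← ENNReal.ofReal_le_ofReal_iff (by positivity), norm_toLp_sq_ofReal]
  have hψc := hψ.smooth.continuous
  have : (volume : Measure (Hor d × ℝ)).IsAddHaarMeasure := by
    rw [Measure.volume_eq_prod]; infer_instance
  calc ∫⁻ z, ENNReal.ofReal (rayIntegral ℓ e ψ z ^ 2) ∂(slabVol d ℓ)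
      ≤ ∫⁻ z, ENNReal.ofReal ℓ * ∫⁻ s in Ioc 0 ℓ, ENNReal.ofReal (ψ (z + s • e) ^ 2) ∂volume := by
        refine (lintegral_mono fun z => ?_).trans (lintegral_mono' Measure.restrict_le_self le_rfl)
        have hq : Continuous fun s : ℝ => ψ (z + s • e) := by fun_prop
        have hq2 : Continuous fun s : ℝ => ψ (z + s • e) ^ 2 := by fun_prop
        rw [← ofReal_integral_eq_lintegral_ofReal hq2.integrableOn_Ioc
          (Eventually.of_forall fun z => sq_nonneg _), ← ENNReal.ofReal_mul hℓ.le,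
          ← intervalIntegral.integral_of_le hℓ.le]
        exact ENNReal.ofReal_le_ofReal (sq_intervalIntegral_le hℓ hq)
    _ = ENNReal.ofReal ℓ * ∫⁻ s in Ioc 0 ℓ, ∫⁻ z, ENNReal.ofReal (ψ (z + s • e) ^ 2) := by
        rw [lintegral_const_mul' _ _ ENNReal.ofReal_ne_top, lintegral_lintegral_swap]
        have : Continuous fun w : (Hor d × ℝ) × ℝ => ψ (w.1 + w.2 • e) ^ 2 := by fun_prop
        exact (ENNReal.continuous_ofReal.comp this).measurable.aemeasurable
    _ = ENNReal.ofReal ℓ * (ENNReal.ofReal ℓ * ∫⁻ z, ENNReal.ofReal (ψ z ^ 2)) := by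
        congr 1
        have : ∀ s : ℝ, ∫⁻ z, ENNReal.ofReal (ψ (z + s • e) ^ 2) = ∫⁻ z, ENNReal.ofReal (ψ z ^ 2) :=
          fun s => lintegral_add_right_eq_self (fun z => ENNReal.ofReal (ψ z ^ 2)) (s • e)
        simp only [this]
        rw [lintegral_const, Measure.restrict_apply_univ, Real.volume_Ioc, sub_zero, mul_comm]
    _ = ENNReal.ofReal ((ℓ * ‖h1.toLp ψ‖) ^ 2) := by
        rw [mul_pow, ENNReal.ofReal_mul (by positivity), norm_toLp_sq_ofReal, ← mul_assoc,
          ← ENNReal.ofReal_mul hℓ.le, ← pow_two]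
        congr 1
        symm
        refine setLIntegral_eq_of_support_subset ?_
        intro z hz
        refine hψ.supp (subset_tsupport _ fun h0 => hz ?_)
        simp [h0]

/-- Poincaré's inequality along a direction transversal to the slab. -/
lemma norm_le_of_directional (hℓ : 0 < ℓ) {e : Hor d × ℝ} (he : e.2 = 1) {f g : L2Scalar d ℓ}
    (h : ∀ φ : Hor d × ℝ → ℝ, IsTest {z : Hor d × ℝ | z.2 < ℓ} φ →
      ∫ z in slab d ℓ, fderiv ℝ φ z e * f z = - ∫ z in slab d ℓ, φ z * g z) : ‖f‖ ≤ ℓ * ‖g‖ := by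
  have hopen : IsOpen (slab d ℓ) :=
    (isOpen_lt continuous_const continuous_snd).inter (isOpen_lt continuous_snd continuous_const)
  refine norm_le_of_forall_test (U := slab d ℓ) hopen ?_ f (by positivity) fun ψ a b c hψ => ?_
  · rw [Measure.restrict_apply hopen.measurableSet.compl, compl_inter_self, measure_empty]
  have ht : IsTest (slab d ℓ) ψ := ⟨a, b, c⟩
  have hr := isTest_rayIntegral hℓ (by rw [he]; exact zero_le_one) (e := e) ht
  have h1 := h _ hr
  -- The ray integral is a potential for -ψ in the slab: the other end z + ℓe lies above height ℓ,
  -- where ψ vanishes. Pairing f with ψ thus becomes pairing its directional derivative with the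
  -- potential.
  have h2 : ∫ z in slab d ℓ, fderiv ℝ (rayIntegral ℓ e ψ) z e * f z = - ∫ z in slab d ℓ, ψ z * f z := by
    rw [← integral_neg]
    refine setIntegral_congr_fun (measurableSet_slab d ℓ) fun z hz => ?_
    have h0 : ψ (z + ℓ • e) = 0 := by
      refine image_eq_zero_of_notMem_tsupport fun hm => ?_
      have := (c hm).2
      simp only [Prod.snd_add, Prod.smul_snd, he, smul_eq_mul, mul_one] at this
      linarith [hz.1]
    simp only [fderiv_rayIntegral hℓ e a b, h0]
    ring
  rw [h2] at h1
  have h3 := neg_inj.1 h1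
  have hrm : MemLp (rayIntegral ℓ e ψ) 2 (slabVol d ℓ) := hr.memLp ℓ
  rw [h3, ← inner_toLp_eq_integral hrm]
  calc (inner ℝ (hrm.toLp _) g : ℝ) ≤ ‖hrm.toLp _‖ * ‖g‖ := real_inner_le_norm _ _
    _ ≤ (ℓ * ‖hψ.toLp ψ‖) * ‖g‖ := by gcongr; exact norm_rayIntegral_le hℓ ht hψ hrm
    _ = _ := by ring

lemma norm_symGradL_le (u : solenoidal d ℓ) (i j : Fin (d + 1)) :
    ‖symGradL d ℓ i j u‖ ≤ √(dissip u) := by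
  refine Real.le_sqrt_of_sq_le ?_
  have h1 : ‖symGradL d ℓ i j u‖ ^ 2 ≤ ∑ j, ‖symGradL d ℓ i j u‖ ^ 2 :=
    Finset.single_le_sum (f := fun j => ‖symGradL d ℓ i j u‖ ^ 2) (fun j _ => sq_nonneg _) (Finset.mem_univ j)
  exact h1.trans (Finset.single_le_sum (f := fun i => ∑ j, ‖symGradL d ℓ i j u‖ ^ 2)
    (fun i _ => Finset.sum_nonneg fun j _ => sq_nonneg _) (Finset.mem_univ i))

lemma dissip_nonneg (u : solenoidal d ℓ) : 0 ≤ dissip u :=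
  Finset.sum_nonneg fun _ _ => Finset.sum_nonneg fun _ _ => sq_nonneg _

lemma norm_gradL_last_le (u : solenoidal d ℓ) :
    ‖compL d ℓ (Fin.last d) (u.1.snd (Fin.last d))‖ ≤ √(dissip u) := by
  have h := norm_symGradL_le u (Fin.last d) (Fin.last d)
  rw [symGradL_apply, ← two_smul ℝ, norm_smul] at h
  simp only [Real.norm_ofNat] at h
  nlinarith [norm_nonneg (compL d ℓ (Fin.last d) (u.1.snd (Fin.last d)))]

lemma norm_last_le (hℓ : 0 < ℓ) (u : solenoidal d ℓ) :
    ‖compL d ℓ (Fin.last d) u.1.fst‖ ≤ ℓ * √(dissip u) := by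
  have h := norm_le_of_directional (e := dir d (Fin.last d)) hℓ (by simp)
    (f := compL d ℓ (Fin.last d) u.1.fst) (g := compL d ℓ (Fin.last d) (u.1.snd (Fin.last d)))
    (fun φ hφ => u.2.2.1.component (Fin.last d) hφ)
  exact h.trans (by gcongr; exact norm_gradL_last_le u)

lemma integral_test_add {φ : Hor d × ℝ → ℝ} (hφ : MemLp φ 2 (slabVol d ℓ)) (f g : L2Scalar d ℓ) :
    ∫ z in slab d ℓ, φ z * (f + g) z
      = (∫ z in slab d ℓ, φ z * f z) + ∫ z in slab d ℓ, φ z * g z := by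
  simp only [← smul_eq_mul, ← testL_apply hφ, map_add]

/-- The point of Korn's inequality here: along e = eᵢ + e_N, ∂ₑ(uᵢ + u_N) = ∂ᵢuᵢ + (∂ᵢu_N + ∂_N uᵢ)
+ ∂_N u_N involves only entries of the symmetrized gradient. Poincaré along e bounds uᵢ + u_N, and
`norm_last_le` removes u_N. -/
lemma norm_castSucc_le (hℓ : 0 < ℓ) (u : solenoidal d ℓ) (i : Fin d) :
    ‖compL d ℓ i.castSucc u.1.fst‖ ≤ 4 * ℓ * √(dissip u) := by
  set F := compL d ℓ i.castSucc u.1.fst with hF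
  set G := compL d ℓ (Fin.last d) u.1.fst with hG
  set A := compL d ℓ i.castSucc (u.1.snd i.castSucc) with hA
  set B := compL d ℓ (Fin.last d) (u.1.snd (Fin.last d)) with hB
  -- The slanted Poincaré inequality uses test functions that are nonzero at y = 0, so the
  -- horizontal derivative must be available against them as well.
  have hh := (u.2.1 i.castSucc).extend_bottom
  have hv := u.2.2.1
  have key := norm_le_of_directional (e := dir d i.castSucc + dir d (Fin.last d)) hℓ (by simp)
    (f := F + G) (g := A + (symGradL d ℓ i.castSucc (Fin.last d) u + B)) (fun φ hφ => by
      have m1 := hφ.memLp_pderiv ℓ i.castSucc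
      have m2 := hφ.memLp_pderiv ℓ (Fin.last d)
      have m := hφ.memLp ℓ
      have e0 : ∀ z, fderiv ℝ φ z (dir d i.castSucc + dir d (Fin.last d))
          = pderiv i.castSucc φ z + pderiv (Fin.last d) φ z := fun z => map_add _ _ _
      have e1 : ∫ z in slab d ℓ, fderiv ℝ φ z (dir d i.castSucc + dir d (Fin.last d)) * (F + G) z
          = (∫ z in slab d ℓ, pderiv i.castSucc φ z * (F + G) z)
            + ∫ z in slab d ℓ, pderiv (Fin.last d) φ z * (F + G) z := by
        simp only [e0, add_mul]
        exact integral_add (m1.integrable_mul (Lp.memLp _)) (m2.integrable_mul (Lp.memLp _))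
      rw [e1, integral_test_add m1, integral_test_add m2, integral_test_add m, integral_test_add m,
        symGradL_apply, integral_test_add m, hh.component i.castSucc hφ, hh.component (Fin.last d) hφ,
        hv.component i.castSucc hφ, hv.component (Fin.last d) hφ]
      ring)
  have hAle : ‖A‖ ≤ √(dissip u) := by
    have h := norm_symGradL_le u i.castSucc i.castSucc
    rw [symGradL_apply, ← two_smul ℝ, norm_smul] at h
    simp only [Real.norm_ofNat] at h
    nlinarith [norm_nonneg A]
  have hBle : ‖B‖ ≤ √(dissip u) := norm_gradL_last_le u
  have hCle := norm_symGradL_le u i.castSucc (Fin.last d)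
  have hGle : ‖G‖ ≤ ℓ * √(dissip u) := norm_last_le hℓ u
  have h1 : ‖F + G‖ ≤ ℓ * (3 * √(dissip u)) := by
    refine key.trans ?_
    gcongr
    refine (norm_add_le _ _).trans ?_
    have := norm_add_le (symGradL d ℓ i.castSucc (Fin.last d) u) B
    linarith
  calc ‖F‖ = ‖(F + G) - G‖ := by rw [add_sub_cancel_right]
    _ ≤ ‖F + G‖ + ‖G‖ := norm_sub_le _ _
    _ ≤ _ := by linarith

/-- Korn's inequality in its `L²` form. -/
lemma norm_sq_le_dissip (hℓ : 0 < ℓ) (u : solenoidal d ℓ) :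
    ‖toL2 d ℓ u‖ ^ 2 ≤ (16 * (d + 1) * ℓ ^ 2) * dissip u := by
  have h : ∀ i : Fin (d + 1), ‖compL d ℓ i u.1.fst‖ ≤ 4 * ℓ * √(dissip u) := by
    intro i
    refine Fin.lastCases ?_ (fun i => norm_castSucc_le hℓ u i) i
    refine (norm_last_le hℓ u).trans ?_
    have := mul_nonneg hℓ.le (Real.sqrt_nonneg (dissip u))
    linarith
  rw [toL2_apply, norm_sq_eq_sum_compL]
  calc ∑ i, ‖compL d ℓ i u.1.fst‖ ^ 2 ≤ ∑ _i : Fin (d + 1), (4 * ℓ * √(dissip u)) ^ 2 :=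
        Finset.sum_le_sum fun i _ => by gcongr; exact h i
    _ = _ := by
        rw [Finset.sum_const, Finset.card_univ, Fintype.card_fin, nsmul_eq_mul, mul_pow,
          Real.sq_sqrt (dissip_nonneg u)]
        push_cast; ring

end Korn

/-! ### The trace on the top boundary -/

section Trace

variable {d : ℕ} {ℓ : ℝ}

lemma memLp_trace {φ : Hor d × ℝ → ℝ} (h1 : Continuous φ) (h2 : HasCompactSupport φ) (ℓ : ℝ) :
    MemLp (fun x : Hor d => φ (x, ℓ)) 2 volume := by
  have hc : Continuous fun x : Hor d => φ (x, ℓ) := by fun_prop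
  refine hc.memLp_of_hasCompactSupport (HasCompactSupport.intro (K := Prod.fst '' tsupport φ)
    (h2.isCompact.image continuous_fst) fun x hx => ?_)
  exact image_eq_zero_of_notMem_tsupport fun h => hx ⟨_, h, rfl⟩

/-- For each test function the trace identity is an equality of bounded functionals of u and of τ;
in this form it survives averaging over translations (`IsTopTrace.conv`). -/
lemma isTopTrace_iff (u : solenoidal d ℓ) (τ : L2Hor d) :
    IsTopTrace u τ ↔ ∀ (φ : Hor d × ℝ → ℝ) (h : IsTest {z : Hor d × ℝ | 0 < z.2} φ),
      (inner ℝ ((h.memLp_pderiv ℓ (Fin.last d)).toLp _) (compL d ℓ (Fin.last d) u.1.fst) : ℝ)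
        + inner ℝ ((h.memLp ℓ).toLp _) (compL d ℓ (Fin.last d) (u.1.snd (Fin.last d)))
      = inner ℝ ((memLp_trace h.smooth.continuous h.compact ℓ).toLp _) τ := by
  refine forall₂_congr fun φ h => ?_
  rw [inner_toLp_eq_integral, inner_toLp_eq_integral, inner_toLp_eq_integral]
  have e1 : ∫ z in slab d ℓ, u.1.fst z (Fin.last d) * pderiv (Fin.last d) φ z
      = ∫ z in slab d ℓ, pderiv (Fin.last d) φ z * compL d ℓ (Fin.last d) u.1.fst z := by
    refine integral_congr_ae ?_
    filter_upwards [coeFn_compL (Fin.last d) u.1.fst] with z hz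
    rw [hz, mul_comm]
  have e2 : ∫ z in slab d ℓ, (u.1.snd (Fin.last d)) z (Fin.last d) * φ z
      = ∫ z in slab d ℓ, φ z * compL d ℓ (Fin.last d) (u.1.snd (Fin.last d)) z := by
    refine integral_congr_ae ?_
    filter_upwards [coeFn_compL (Fin.last d) (u.1.snd (Fin.last d))] with z hz
    rw [hz, mul_comm]
  have e3 : ∫ x : Hor d, τ x * φ (x, ℓ) = ∫ x : Hor d, φ (x, ℓ) * τ x := by
    simp only [mul_comm]
  rw [e1, e2, e3]

lemma IsTopTrace.translate {u : solenoidal d ℓ} {τ : L2Hor d} (h : IsTopTrace u τ) (a : Hor d) :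
    IsTopTrace ((solTranslation d ℓ).op a u) ((horTranslation d ℝ).op a τ) := by
  intro φ hφ
  have hφ' : IsTest {z : Hor d × ℝ | 0 < z.2} fun z => φ (slabShift (-a) z) :=
    hφ.slabShift (-a) (fun z hz => by simpa [FluidSlab.slabShift] using hz)
  have key := h _ hφ'
  have e : ∀ (χ : Hor d × ℝ → ℝ) (f : L2Slab d ℓ),
      ∫ z in slab d ℓ, (slabTranslation d ℓ (Vel d)).op a f z (Fin.last d) * χ z
      = ∫ z in slab d ℓ, f z (Fin.last d) * χ (slabShift (-a) z) := fun χ f => by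
    have h1 := integral_slabShift_smul (ℓ := ℓ) a χ (compL d ℓ (Fin.last d) f)
    rw [← compL_slabTranslation] at h1
    refine Eq.trans (integral_congr_ae ?_) (h1.trans (integral_congr_ae ?_))
    · filter_upwards [coeFn_compL (Fin.last d) ((slabTranslation d ℓ (Vel d)).op a f)] with z hz
      rw [hz, smul_eq_mul, mul_comm]
    · filter_upwards [coeFn_compL (Fin.last d) f] with z hz
      rw [hz, smul_eq_mul, mul_comm]
  have e1 := e (pderiv (Fin.last d) φ) u.1.fst
  have e2 := e φ (u.1.snd (Fin.last d))
  have e3 : ∫ x : Hor d, (horTranslation d ℝ).op a τ x * φ (x, ℓ)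
      = ∫ x : Hor d, τ x * φ (slabShift (-a) (x, ℓ)) := by
    rw [← integral_add_right_eq_self (fun x => τ x * φ (slabShift (-a) (x, ℓ))) a]
    refine integral_congr_ae ?_
    filter_upwards [coeFn_horTranslation a τ] with x hx
    rw [hx]
    simp [FluidSlab.slabShift]
  simp only [pderiv_slabShift] at key
  exact (congrArg₂ (· + ·) e1 e2).trans (key.trans e3.symm)

lemma IsTopTrace.conv {u : solenoidal d ℓ} {τ : L2Hor d} (h : IsTopTrace u τ)
    (k : SchwartzMap (Hor d) ℝ) : IsTopTrace (solConv ℓ k u) (horConv k τ) := by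
  rw [isTopTrace_iff]
  intro φ hφ
  let A : solenoidal d ℓ →L[ℝ] ℝ :=
    (innerSL ℝ ((hφ.memLp_pderiv ℓ (Fin.last d)).toLp _)).comp
        ((compL d ℓ (Fin.last d)).comp (toL2 d ℓ))
      + (innerSL ℝ ((hφ.memLp ℓ).toLp _)).comp ((compL d ℓ (Fin.last d)).comp (gradL d ℓ (Fin.last d)))
  let B : L2Hor d →L[ℝ] ℝ := innerSL ℝ ((memLp_trace hφ.smooth.continuous hφ.compact ℓ).toLp _)
  change A (solConv ℓ k u) = B (horConv k τ)
  rw [solConv, horConv, TranslationFamily.functional_avg, TranslationFamily.functional_avg]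
  congr 1 with a
  congr 1
  exact (isTopTrace_iff _ _).1 (h.translate a) φ hφ

/-- The trace on the top is controlled by the dissipation. -/
lemma exists_trace_bound (d : ℕ) (hℓ : 0 < ℓ) : ∃ C : ℝ, 0 < C ∧ ∀ (u : solenoidal d ℓ) (τ : L2Hor d),
    IsTopTrace u τ → ‖τ‖ ≤ C * √(dissip u) := by
  -- η is supported in y > 0 with η(ℓ) = 1. Testing with η(y)ψ(x) recovers ∫ ψτ from u_N and ∂_N u_N
  -- alone, both bounded by the dissipation.
  obtain ⟨η, h1, h2, h3, -, h5⟩ := exists_contDiff_tsupport_subset (n := ⊤) (Ioi_mem_nhds hℓ)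
  have hd : Continuous (deriv η) := h3.continuous_deriv (by simp)
  set a := √(∫ y in Ioo 0 ℓ, η y ^ 2) with ha
  set b := √(∫ y in Ioo 0 ℓ, deriv η y ^ 2) with hb
  -- The summand 1 only makes the constant strictly positive.
  refine ⟨b * ℓ + a + 1, by positivity, fun u τ h => ?_⟩
  refine norm_le_of_forall_test (U := univ) isOpen_univ (by simp) τ (by positivity)
    fun ψ p1 p2 _ hψ => ?_
  have ht : IsTest {z : Hor d × ℝ | 0 < z.2} (fun z => η z.2 * ψ z.1) := by
    refine ⟨(h3.comp contDiff_snd).mul (p1.comp contDiff_fst), ?_, ?_⟩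
    · refine HasCompactSupport.intro (K := tsupport ψ ×ˢ tsupport η)
        (p2.isCompact.prod h2.isCompact) fun z hz => ?_
      by_contra hne
      exact hz ⟨subset_tsupport _ (right_ne_zero_of_mul hne), subset_tsupport _ (left_ne_zero_of_mul hne)⟩
    · refine (closure_minimal (fun z hz => ?_) ((isClosed_tsupport η).preimage continuous_snd)).trans
        (fun z hz => h1 hz)
      exact subset_tsupport _ (left_ne_zero_of_mul hz)
  have key := (isTopTrace_iff u τ).1 h _ ht
  have hpd : ∀ z, pderiv (Fin.last d) (fun z : Hor d × ℝ => η z.2 * ψ z.1) z = deriv η z.2 * ψ z.1 := by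
    intro z
    simp only [pderiv, dir_last]
    have d1 : HasFDerivAt (fun z : Hor d × ℝ => η z.2)
        ((fderiv ℝ η z.2).comp (ContinuousLinearMap.snd ℝ (Hor d) ℝ)) z :=
      ((h3.differentiable (by simp)).differentiableAt.hasFDerivAt).comp z hasFDerivAt_snd
    have d2 : HasFDerivAt (fun z : Hor d × ℝ => ψ z.1)
        ((fderiv ℝ ψ z.1).comp (ContinuousLinearMap.fst ℝ (Hor d) ℝ)) z :=
      ((p1.differentiable (by simp)).differentiableAt.hasFDerivAt).comp z hasFDerivAt_fst
    rw [(d1.fun_mul d2).fderiv]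
    simp [mul_comm]
  have n1 : ‖(ht.memLp_pderiv ℓ (Fin.last d)).toLp _‖ = b * ‖hψ.toLp ψ‖ := by
    have : (ht.memLp_pderiv ℓ (Fin.last d)).toLp _ = tensor ℓ hd (hψ.toLp ψ) := by
      refine Lp.ext ?_
      filter_upwards [(ht.memLp_pderiv ℓ (Fin.last d)).coeFn_toLp, coeFn_tensor (ℓ := ℓ) hd (hψ.toLp ψ),
        ae_slabVol_fst hψ.coeFn_toLp] with z q1 q2 q3
      rw [q1, q2, q3, hpd]
    rw [this, ← Real.sqrt_sq (norm_nonneg (tensor ℓ hd (hψ.toLp ψ))), norm_tensor_sq,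
      Real.sqrt_mul (integral_nonneg fun y => sq_nonneg _), Real.sqrt_sq (norm_nonneg _)]
  have n2 : ‖(ht.memLp ℓ).toLp _‖ = a * ‖hψ.toLp ψ‖ := by
    have : (ht.memLp ℓ).toLp _ = tensor ℓ h3.continuous (hψ.toLp ψ) := by
      refine Lp.ext ?_
      filter_upwards [(ht.memLp ℓ).coeFn_toLp, coeFn_tensor (ℓ := ℓ) h3.continuous (hψ.toLp ψ),
        ae_slabVol_fst hψ.coeFn_toLp] with z q1 q2 q3
      rw [q1, q2, q3]
    rw [this, ← Real.sqrt_sq (norm_nonneg (tensor ℓ _ (hψ.toLp ψ))), norm_tensor_sq,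
      Real.sqrt_mul (integral_nonneg fun y => sq_nonneg _), Real.sqrt_sq (norm_nonneg _)]
  have n3 : ∫ x, ψ x * τ x
      = inner ℝ ((memLp_trace ht.smooth.continuous ht.compact ℓ).toLp _) τ := by
    rw [inner_toLp_eq_integral]
    simp [h5]
  rw [n3, ← key]
  have i1 := real_inner_le_norm ((ht.memLp_pderiv ℓ (Fin.last d)).toLp _) (compL d ℓ (Fin.last d) u.1.fst)
  have i2 := real_inner_le_norm ((ht.memLp ℓ).toLp _) (compL d ℓ (Fin.last d) (u.1.snd (Fin.last d)))
  rw [n1] at i1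
  rw [n2] at i2
  have i3 := norm_last_le hℓ u
  have i4 := norm_gradL_last_le u
  have hb0 : 0 ≤ b := Real.sqrt_nonneg _
  have ha0 : 0 ≤ a := Real.sqrt_nonneg _
  have hn := norm_nonneg (hψ.toLp ψ)
  have hs := Real.sqrt_nonneg (dissip u)
  calc _ ≤ b * ‖hψ.toLp ψ‖ * (ℓ * √(dissip u)) + a * ‖hψ.toLp ψ‖ * √(dissip u) := by
        refine (add_le_add i1 i2).trans ?_
        gcongr
    _ = (b * ℓ + a) * √(dissip u) * ‖hψ.toLp ψ‖ := by ring
    _ ≤ (b * ℓ + a + 1) * √(dissip u) * ‖hψ.toLp ψ‖ := by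
        have := mul_nonneg hs hn
        nlinarith

end Trace

/-! ### The Fourier transform of real L² functions -/

section FourierL2

open scoped SchwartzMap

variable {d : ℕ}

/-- `L²(ℝ^d; ℂ)`. -/
abbrev L2Cplx (d : ℕ) : Type := Lp ℂ 2 (volume : Measure (Hor d))

/-- The Fourier transform on complex `L²`, as a real linear isometric equivalence. -/
def fourC (d : ℕ) : L2Cplx d ≃ₗᵢ[ℝ] L2Cplx d where
  toLinearEquiv := (Lp.fourierTransformₗᵢ (Hor d) ℂ).toLinearEquiv.restrictScalars ℝ
  norm_map' f := (Lp.fourierTransformₗᵢ (Hor d) ℂ).norm_map f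

lemma fourC_apply (f : L2Cplx d) : fourC d f = 𝓕 f := rfl

/-- The inclusion of real `L²` in complex `L²`. -/
def cplxL (d : ℕ) : L2Hor d →L[ℝ] L2Cplx d := Complex.ofRealCLM.compLpL 2 volume

lemma coeFn_cplxL (f : L2Hor d) : cplxL d f =ᵐ[volume] fun x => (f x : ℂ) :=
  Complex.ofRealCLM.coeFn_compLpL f

/-- The real part, on complex `L²`. -/
def reL (d : ℕ) : L2Cplx d →L[ℝ] L2Hor d := Complex.reCLM.compLpL 2 volume

lemma coeFn_reL (f : L2Cplx d) : reL d f =ᵐ[volume] fun x => (f x).re :=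
  Complex.reCLM.coeFn_compLpL f

lemma norm_reL_le (f : L2Cplx d) : ‖reL d f‖ ≤ ‖f‖ := by
  refine Lp.norm_le_norm_of_ae_le ?_
  filter_upwards [coeFn_reL f] with x hx
  rw [hx]
  exact Complex.abs_re_le_norm _

lemma norm_cplxL (f : L2Hor d) : ‖cplxL d f‖ = ‖f‖ := by
  refine le_antisymm (Lp.norm_le_norm_of_ae_le ?_) (Lp.norm_le_norm_of_ae_le ?_) <;>
  · filter_upwards [coeFn_cplxL f] with x hx
    rw [hx]
    simp

/-- Against a real function the real inner product sees only the real part of F. -/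
lemma inner_reL (F : L2Cplx d) (f : L2Hor d) :
    (inner ℝ (reL d F) f : ℝ) = inner ℝ F (cplxL d f) := by
  rw [L2.inner_def, L2.inner_def]
  refine integral_congr_ae ?_
  filter_upwards [coeFn_reL F, coeFn_cplxL f] with x h1 h2
  rw [h1, h2]
  simp [Complex.inner, mul_comm]

/-- The Fourier transform of a real `L²` function. -/
def fourL (d : ℕ) : L2Hor d →L[ℝ] L2Cplx d :=
  (fourC d).toContinuousLinearEquiv.toContinuousLinearMap.comp (cplxL d)

lemma fourL_apply (h : L2Hor d) : fourL d h = fourC d (cplxL d h) := rfl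

lemma norm_fourL (h : L2Hor d) : ‖fourL d h‖ = ‖h‖ := by
  rw [fourL_apply, LinearIsometryEquiv.norm_map, norm_cplxL]

lemma inner_fourL (f h : L2Hor d) : (inner ℝ (fourL d f) (fourL d h) : ℝ) = inner ℝ f h :=
  LinearIsometry.inner_map_map ⟨(fourL d).toLinearMap, norm_fourL⟩ f h

lemma l2Fourier_congr {f g : Hor d → ℂ} (h : f =ᵐ[volume] g) : l2Fourier f = l2Fourier g := by
  unfold l2Fourier
  by_cases hf : MemLp f 2 volume
  · have hg : MemLp g 2 volume := (memLp_congr_ae h).1 hf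
    rw [dif_pos hf, dif_pos hg]
    have : hf.toLp f = hg.toLp g := by rwa [MemLp.toLp_eq_toLp_iff]
    rw [this]
  · rw [dif_neg hf, dif_neg (fun hg => hf ((memLp_congr_ae h).2 hg))]

lemma hat_congr {f g : Hor d → ℝ} (h : f =ᵐ[volume] g) : hat f = hat g :=
  l2Fourier_congr (h.mono fun x hx => by simp [hx])

lemma hat_coe (h : L2Hor d) : hat h = fourL d h := by
  have hm : MemLp (cplxL d h) 2 volume := Lp.memLp _
  rw [hat, ← l2Fourier_congr (coeFn_cplxL h), l2Fourier, dif_pos hm, Lp.toLp_coeFn, fourL_apply,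
    fourC_apply]

lemma hat_toLp {f : Hor d → ℝ} (hf : MemLp f 2 volume) : hat f = fourL d (hf.toLp f) := by
  rw [← hat_coe, hat_congr hf.coeFn_toLp]

/-- The pairing formula `∫ 𝓕f ψ = ∫ f 𝓕ψ`. -/
lemma integral_fourC_mul (f : L2Cplx d) (ψ : 𝓢(Hor d, ℂ)) :
    ∫ ξ, ψ ξ * (fourC d f) ξ = ∫ x, (𝓕 ψ) x * f x := by
  have h := DFunLike.congr_fun (Lp.fourier_toTemperedDistribution_eq f) ψ
  rw [TemperedDistribution.fourier_apply, Lp.toTemperedDistribution_apply,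
    Lp.toTemperedDistribution_apply] at h
  simp only [smul_eq_mul] at h
  rw [fourC_apply, ← h]

end FourierL2

/-! ### Bounded Fourier multipliers -/

section Multipliers

open scoped SchwartzMap

variable {d : ℕ}

/-- Multiplication by a bounded function on `L²(ℝ^d; ℂ)`. -/
def mulL {q : Hor d → ℂ} (hq : MemLp q ∞ (volume : Measure (Hor d))) : L2Cplx d →L[ℝ] L2Cplx d :=
  (ContinuousLinearMap.mul ℝ ℂ).holderL volume ∞ 2 2 (hq.toLp q)

lemma coeFn_mulL {q : Hor d → ℂ} (hq : MemLp q ∞ (volume : Measure (Hor d))) (F : L2Cplx d) :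
    mulL hq F =ᵐ[volume] fun ξ => q ξ * F ξ := by
  have h := (ContinuousLinearMap.mul ℝ ℂ).coeFn_holder (r := 2) (hq.toLp q) F
  filter_upwards [h, hq.coeFn_toLp] with ξ h1 h2
  change ((ContinuousLinearMap.mul ℝ ℂ).holder 2 (hq.toLp q) F) ξ = _
  rw [h1, h2]
  rfl

lemma norm_mulL_le {q : Hor d → ℂ} (hq : MemLp q ∞ (volume : Measure (Hor d))) {c : ℝ}
    (hc : ∀ ξ, ‖q ξ‖ ≤ c) (F : L2Cplx d) : ‖mulL hq F‖ ≤ c * ‖F‖ := by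
  refine Lp.norm_le_mul_norm_of_ae_le_mul ?_
  filter_upwards [coeFn_mulL hq F] with ξ h
  rw [h, norm_mul]
  gcongr
  exact hc ξ

/-- The Fourier multiplier with bounded symbol `q`, followed by the real part. -/
def multL {q : Hor d → ℂ} (hq : MemLp q ∞ (volume : Measure (Hor d))) : L2Hor d →L[ℝ] L2Hor d :=
  (reL d).comp ((fourC d).symm.toContinuousLinearEquiv.toContinuousLinearMap.comp
    ((mulL hq).comp (fourL d)))

lemma multL_apply {q : Hor d → ℂ} (hq : MemLp q ∞ (volume : Measure (Hor d))) (h : L2Hor d) :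
    multL hq h = reL d ((fourC d).symm (mulL hq (fourL d h))) := rfl

lemma norm_multL_le {q : Hor d → ℂ} (hq : MemLp q ∞ (volume : Measure (Hor d))) {c : ℝ}
    (hc : ∀ ξ, ‖q ξ‖ ≤ c) (h : L2Hor d) : ‖multL hq h‖ ≤ c * ‖h‖ := by
  rw [multL_apply]
  refine (norm_reL_le _).trans ?_
  rw [LinearIsometryEquiv.norm_map]
  refine (norm_mulL_le hq hc _).trans_eq ?_
  rw [norm_fourL]

/-- Because of `inner_reL`, taking the real part is invisible in pairings with real functions. Hence
no Hermitian symmetry of q has to be checked for the lift symbols. -/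
lemma inner_multL {q : Hor d → ℂ} (hq : MemLp q ∞ (volume : Measure (Hor d))) (h f : L2Hor d) :
    (inner ℝ (multL hq h) f : ℝ) = inner ℝ (mulL hq (fourL d h)) (fourL d f) := by
  rw [multL_apply, inner_reL, fourL_apply f, ← LinearIsometryEquiv.inner_map_map (fourC d),
    LinearIsometryEquiv.apply_symm_apply]

lemma multL_sum {ι : Type*} (s : Finset ι) {q : ι → Hor d → ℂ} {Q : Hor d → ℂ}
    (hq : ∀ i, MemLp (q i) ∞ (volume : Measure (Hor d)))
    (hQ : MemLp Q ∞ (volume : Measure (Hor d))) (h : ∀ ξ, Q ξ = ∑ i ∈ s, q i ξ) (f : L2Hor d) :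
    multL hQ f = ∑ i ∈ s, multL (hq i) f := by
  have h1 : mulL hQ (fourL d f) = ∑ i ∈ s, mulL (hq i) (fourL d f) := by
    refine Lp.ext ?_
    have h2 : ∀ᵐ ξ, ∀ i ∈ s, mulL (hq i) (fourL d f) ξ = q i ξ * fourL d f ξ :=
      (ae_ball_iff s.countable_toSet).2 fun i _ => coeFn_mulL (hq i) (fourL d f)
    filter_upwards [coeFn_mulL hQ (fourL d f), h2,
      Lp.coeFn_finsetSum s (fun i => mulL (hq i) (fourL d f))] with ξ h3 h4 h5
    rw [h3, h5, h, Finset.sum_mul, Finset.sum_apply]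
    exact Finset.sum_congr rfl fun i hi => (h4 i hi).symm
  rw [multL_apply, h1, map_sum, map_sum]
  rfl

lemma fourL_toLp {ψ : Hor d → ℝ} (hψ : ContDiff ℝ ∞ ψ) (hc : HasCompactSupport ψ)
    (hm : MemLp ψ 2 volume) :
    fourL d (hm.toLp ψ) =ᵐ[volume] 𝓕 (fun x => (ψ x : ℂ)) := by
  have hs : HasCompactSupport (fun x => (ψ x : ℂ)) := hc.comp_left (g := Complex.ofReal) rfl
  have hs' : ContDiff ℝ ∞ (fun x => (ψ x : ℂ)) := Complex.ofRealCLM.contDiff.comp hψ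
  set Ψ : 𝓢(Hor d, ℂ) := hs.toSchwartzMap hs' with hΨ
  have h1 : cplxL d (hm.toLp ψ) = Ψ.toLp 2 := by
    refine Lp.ext ?_
    filter_upwards [coeFn_cplxL (hm.toLp ψ), hm.coeFn_toLp, Ψ.coeFn_toLp 2] with x h1 h2 h3
    rw [h1, h2, h3]; rfl
  rw [fourL_apply, h1, fourC_apply, SchwartzMap.toLp_fourier_eq]
  exact (𝓕 Ψ).coeFn_toLp 2

lemma fourier_fderiv {ψ : Hor d → ℝ} (hψ : ContDiff ℝ ∞ ψ) (hc : HasCompactSupport ψ) (v : Hor d)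
    (ξ : Hor d) : 𝓕 (fun x => ((fderiv ℝ ψ x v : ℝ) : ℂ)) ξ
      = (2 * Real.pi * Complex.I * (inner ℝ ξ v : ℝ)) * 𝓕 (fun x => (ψ x : ℂ)) ξ := by
  have hs : HasCompactSupport (fun x => (ψ x : ℂ)) := hc.comp_left (g := Complex.ofReal) rfl
  have hs' : ContDiff ℝ ∞ (fun x => (ψ x : ℂ)) := Complex.ofRealCLM.contDiff.comp hψ
  set Ψ : 𝓢(Hor d, ℂ) := hs.toSchwartzMap hs' with hΨ
  have h := DFunLike.congr_fun (SchwartzMap.fourier_lineDerivOp_eq Ψ v) ξ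
  rw [_root_.smul_apply, SchwartzMap.smulLeftCLM_apply_apply (by fun_prop)] at h
  have h2 : ⇑(LineDeriv.lineDerivOp v Ψ : 𝓢(Hor d, ℂ)) = fun x => ((fderiv ℝ ψ x v : ℝ) : ℂ) := by
    ext x
    rw [SchwartzMap.lineDerivOp_apply_eq_fderiv]
    have h3 : HasFDerivAt (fun x => (ψ x : ℂ)) (Complex.ofRealCLM.comp (fderiv ℝ ψ x)) x :=
      Complex.ofRealCLM.hasFDerivAt.comp x (hψ.differentiable (by simp) x).hasFDerivAt
    change fderiv ℝ (fun x => (ψ x : ℂ)) x v = _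
    rw [h3.fderiv]; rfl
  rw [SchwartzMap.fourier_coe, h2, SchwartzMap.fourier_coe] at h
  rw [h]
  simp only [smul_eq_mul, Complex.real_smul]
  change _ = _ * 𝓕 ⇑Ψ ξ
  ring

/-- The weak derivative of a Fourier multiplier. -/
lemma inner_multL_fderiv {q q' : Hor d → ℂ} (hq : MemLp q ∞ (volume : Measure (Hor d)))
    (hq' : MemLp q' ∞ (volume : Measure (Hor d))) (v : Hor d)
    (h : ∀ ξ, q' ξ = (2 * Real.pi * Complex.I * (inner ℝ ξ v : ℝ)) * q ξ)
    {ψ : Hor d → ℝ} (hψ : ContDiff ℝ ∞ ψ) (hc : HasCompactSupport ψ) (f : L2Hor d) :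
    ∫ x, fderiv ℝ ψ x v * multL hq f x = - ∫ x, ψ x * multL hq' f x := by
  have hm : MemLp ψ 2 volume := hψ.continuous.memLp_of_hasCompactSupport hc
  have hψ' : ContDiff ℝ ∞ (fun x => fderiv ℝ ψ x v) :=
    (hψ.fderiv_right (m := ∞) (by simp)).clm_apply contDiff_const
  have hc' : HasCompactSupport (fun x => fderiv ℝ ψ x v) := hc.fderiv_apply ℝ v
  have hm' : MemLp (fun x => fderiv ℝ ψ x v) 2 volume :=
    hψ'.continuous.memLp_of_hasCompactSupport hc'
  rw [← inner_toLp_eq_integral hm', ← inner_toLp_eq_integral hm, real_inner_comm, inner_multL,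
    real_inner_comm (multL hq' f), inner_multL, ← inner_neg_left, L2.inner_def, L2.inner_def]
  refine integral_congr_ae ?_
  filter_upwards [coeFn_mulL hq (fourL d f), coeFn_mulL hq' (fourL d f), fourL_toLp hψ hc hm,
    fourL_toLp hψ' hc' hm', Lp.coeFn_neg (mulL hq' (fourL d f))] with ξ h1 h2 h3 h4 h5
  rw [h1, h5, Pi.neg_apply, h2, h3, h4, fourier_fderiv hψ hc, h]
  simp only [Complex.inner]
  simp
  ring

end Multipliers

/-! ### Convolution on the Fourier side -/

section ConvolutionSymbol

open scoped SchwartzMap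

variable {d : ℕ}

lemma fourL_toLp_schwartz (ψ : 𝓢(Hor d, ℝ)) :
    fourL d (ψ.toLp 2) =ᵐ[volume] 𝓕 (fun x => (ψ x : ℂ)) := by
  obtain ⟨Ψ, hΨ⟩ : ∃ Ψ : 𝓢(Hor d, ℂ), ⇑Ψ = fun x => (ψ x : ℂ) :=
    ⟨SchwartzMap.postcompCLM (𝕜 := ℝ) Complex.ofRealCLM ψ, rfl⟩
  have h1 : cplxL d (ψ.toLp 2) = Ψ.toLp 2 := by
    refine Lp.ext ?_
    filter_upwards [coeFn_cplxL (ψ.toLp 2), ψ.coeFn_toLp 2, Ψ.coeFn_toLp 2] with x h1 h2 h3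
    rw [h1, h2, h3, hΨ]
  rw [fourL_apply, h1, fourC_apply, SchwartzMap.toLp_fourier_eq]
  have h2 := (𝓕 Ψ).coeFn_toLp 2 volume
  rwa [SchwartzMap.fourier_coe, hΨ] at h2

/-- The character `ξ ↦ e^{2πi⟨a, ξ⟩}`. -/
def phase (a ξ : Hor d) : ℂ := (Real.fourierChar (inner ℝ a ξ : ℝ) : ℂ)

lemma norm_phase (a ξ : Hor d) : ‖phase a ξ‖ = 1 := Circle.norm_coe _

lemma continuous_phase : Continuous fun p : Hor d × Hor d => phase p.1 p.2 :=
  continuous_subtype_val.comp (Real.continuous_fourierChar.comp (by fun_prop))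

lemma memLp_phase (a : Hor d) : MemLp (phase a) ∞ (volume : Measure (Hor d)) :=
  memLp_top_of_bound (continuous_phase.comp (by fun_prop : Continuous fun ξ => (a, ξ))).aestronglyMeasurable
    1 (Eventually.of_forall fun ξ => (norm_phase a ξ).le)

/-- Both sides are continuous in f, so the classical formula on Schwartz functions suffices. -/
lemma fourL_horTranslation (a : Hor d) (f : L2Hor d) :
    fourL d ((horTranslation d ℝ).op a f) = mulL (memLp_phase a) (fourL d f) := by
  refine DenseRange.induction_on (p := fun f => fourL d ((horTranslation d ℝ).op a f)
    = mulL (memLp_phase a) (fourL d f))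
    (SchwartzMap.denseRange_toLpCLM (E := Hor d) (F := ℝ) (p := 2) (μ := volume) ENNReal.ofNat_ne_top) f
    (isClosed_eq (by fun_prop) (by fun_prop)) fun ψ => ?_
  have h1 : (horTranslation d ℝ).op a (ψ.toLp 2)
      = (SchwartzMap.compSubConstCLM ℝ (-a) ψ).toLp 2 := by
    refine Lp.ext ?_
    filter_upwards [coeFn_horTranslation a (ψ.toLp 2),
      (measurePreserving_add_right (volume : Measure (Hor d)) a).quasiMeasurePreserving.ae
        (ψ.coeFn_toLp 2 volume), (SchwartzMap.compSubConstCLM ℝ (-a) ψ).coeFn_toLp 2] with x h1 h2 h3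
    rw [h1, h2, h3, SchwartzMap.compSubConstCLM_apply, sub_neg_eq_add]
  change fourL d ((horTranslation d ℝ).op a (ψ.toLp 2)) = mulL (memLp_phase a) (fourL d (ψ.toLp 2))
  rw [h1]
  refine Lp.ext ?_
  filter_upwards [fourL_toLp_schwartz ψ, fourL_toLp_schwartz (SchwartzMap.compSubConstCLM ℝ (-a) ψ),
    coeFn_mulL (memLp_phase a) (fourL d (ψ.toLp 2))] with ξ h2 h3 h4
  rw [h3, h4, h2]
  have := congrFun (VectorFourier.fourierIntegral_comp_add_right Real.fourierChar
    (volume : Measure (Hor d)) (innerₗ (Hor d)) (fun x => (ψ x : ℂ)) a) ξ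
  simp only [SchwartzMap.compSubConstCLM_apply, sub_neg_eq_add]
  exact this

/-- The Fourier transform turns convolution into multiplication. -/
lemma fourL_horConv (k : 𝓢(Hor d, ℝ)) {m : Hor d → ℂ}
    (hm : MemLp m ∞ (volume : Measure (Hor d))) (hk : ∀ ξ, 𝓕⁻ (fun a => (k a : ℂ)) ξ = m ξ)
    (h : L2Hor d) : fourL d (horConv k h) = mulL hm (fourL d h) := by
  -- Pairing with G turns the Bochner integral over a into a scalar one. Fubini then leaves ∫
  -- k(a)e^{2πi⟨a,ξ⟩} da at each ξ; translations act by f(x + a), which is why the inverse transform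
  -- of k appears.
  refine ext_inner_left ℝ fun G => ?_
  rw [horConv, TranslationFamily.functional_avg, ← integral_inner]
  swap
  · have := (fourL d).integrable_comp ((horTranslation d ℝ).integrable k h)
    simpa only [map_smul] using this
  set P : Hor d → ℂ := fun ξ => (starRingEnd ℂ) (G ξ) * (fourL d h) ξ with hP
  have hPi : Integrable P := by
    have h1 : MemLp (fun ξ => (starRingEnd ℂ) (G ξ)) 2 volume :=
      (Lp.memLp G).continuousLinearMap_comp Complex.conjCLE.toContinuousLinearMap
    exact h1.integrable_mul (Lp.memLp (fourL d h))
  have h1 : ∀ a, (inner ℝ G (k a • fourL d ((horTranslation d ℝ).op a h)) : ℝ)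
      = ∫ ξ, ((k a : ℂ) * P ξ * phase a ξ).re := fun a => by
    rw [inner_smul_right, fourL_horTranslation, L2.inner_def, ← integral_const_mul]
    refine integral_congr_ae ?_
    filter_upwards [coeFn_mulL (memLp_phase a) (fourL d h)] with ξ h2
    rw [h2, Complex.inner, ← Complex.re_ofReal_mul]
    simp only [hP]
    congr 1; ring
  simp_rw [h1]
  have hint : Integrable (fun p : Hor d × Hor d => (k p.1 : ℂ) * P p.2 * phase p.1 p.2)
      (volume.prod volume) := by
    have hk' : Integrable (fun a => (k a : ℂ)) := (k.integrable (μ := volume)).ofReal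
    exact (hk'.mul_prod hPi).mul_bdd (c := 1) continuous_phase.aestronglyMeasurable
      (Eventually.of_forall fun p => (norm_phase _ _).le)
  rw [integral_integral_swap (f := fun a ξ => ((k a : ℂ) * P ξ * phase a ξ).re) hint.re, L2.inner_def]
  refine integral_congr_ae ?_
  filter_upwards [coeFn_mulL hm (fourL d h), hint.prod_left_ae] with ξ h2 h3
  have e : ∫ a, ((k a : ℂ) * P ξ * phase a ξ).re = (∫ a, (k a : ℂ) * P ξ * phase a ξ).re :=
    integral_re (𝕜 := ℂ) h3
  rw [e, h2, Complex.inner, ← hk, Real.fourierInv_eq]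
  have e2 : ∀ a, (k a : ℂ) * P ξ * phase a ξ = (phase a ξ * (k a : ℂ)) * P ξ := fun a => by ring
  simp_rw [e2]
  rw [integral_mul_const]
  simp only [Circle.smul_def, smul_eq_mul, hP, phase]
  congr 1; ring

/-- The Fourier transform of an integrable function is bounded by its `L¹` norm. -/
lemma norm_fourL_le_integral {f : Hor d → ℝ} (h1 : Integrable f) (h2 : MemLp f 2 volume) :
    ∀ᵐ ξ, ‖fourL d (h2.toLp f) ξ‖ₑ ≤ ∫⁻ x, ‖f x‖ₑ := by
  -- The L² transform and the Fourier integral satisfy the same multiplication formula ∫ g·𝓕f = ∫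
  -- 𝓕g·f against test functions g, hence agree almost everywhere.
  have hF : fourL d (h2.toLp f) =ᵐ[volume] 𝓕 (fun x => (f x : ℂ)) := by
    have hc : Continuous (𝓕 (fun x => (f x : ℂ))) :=
      VectorFourier.fourierIntegral_continuous Real.continuous_fourierChar
        (by simpa using (continuous_inner (𝕜 := ℝ) (E := Hor d))) h1.ofReal
    refine ae_eq_of_integral_contDiff_smul_eq ?_ hc.locallyIntegrable fun g hg hgc => ?_
    · exact (Lp.memLp (fourL d (h2.toLp f))).locallyIntegrable (by simp)
    have hs : HasCompactSupport (fun x => (g x : ℂ)) := hgc.comp_left (g := Complex.ofReal) rfl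
    have hs' : ContDiff ℝ ∞ (fun x => (g x : ℂ)) := Complex.ofRealCLM.contDiff.comp hg
    set Ψ : 𝓢(Hor d, ℂ) := hs.toSchwartzMap hs' with hΨ
    have e1 := integral_fourC_mul (cplxL d (h2.toLp f)) Ψ
    have e2 := VectorFourier.integral_fourierIntegral_smul_eq_flip (μ := (volume : Measure (Hor d)))
      (ν := (volume : Measure (Hor d))) (L := innerₗ (Hor d)) (f := fun x => (g x : ℂ))
      (g := fun x => (f x : ℂ)) Real.continuous_fourierChar
      (by simpa using (continuous_inner (𝕜 := ℝ) (E := Hor d)))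
      ((hg.continuous.integrable_of_hasCompactSupport hgc).ofReal) h1.ofReal
    rw [flip_innerₗ] at e2
    have e3 : ∫ x, (𝓕 Ψ) x * cplxL d (h2.toLp f) x
        = ∫ x, 𝓕 (fun x => (g x : ℂ)) x • (f x : ℂ) := by
      refine integral_congr_ae ?_
      filter_upwards [coeFn_cplxL (h2.toLp f), h2.coeFn_toLp] with x h3 h4
      rw [h3, h4]; rfl
    rw [e3] at e1
    simp only [Complex.real_smul]
    exact e1.trans e2
  filter_upwards [hF] with ξ h3
  rw [h3, Real.fourier_eq]
  refine (enorm_integral_le_lintegral_enorm _).trans_eq ?_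
  refine lintegral_congr fun x => ?_
  rw [Circle.smul_def, smul_eq_mul, enorm_mul]
  have e1 : ‖((Real.fourierChar (-inner ℝ x ξ : ℝ)) : ℂ)‖ₑ = 1 := by
    rw [← ofReal_norm, Circle.norm_coe, ENNReal.ofReal_one]
  rw [e1, one_mul, ← ofReal_norm, ← ofReal_norm, Complex.norm_real]

end ConvolutionSymbol

/-! ### Horizontal convolution, slice by slice -/

section Slices

variable {d : ℕ} {ℓ : ℝ}

lemma tensor_slabTranslation {p : ℝ → ℝ} (hp : Continuous p) (a : Hor d) (f : L2Hor d) :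
    tensorL d ℓ hp ((horTranslation d ℝ).op a f)
      = (slabTranslation d ℓ ℝ).op a (tensorL d ℓ hp f) := by
  refine Lp.ext ?_
  simp only [tensorL_apply]
  filter_upwards [coeFn_tensor (ℓ := ℓ) hp ((horTranslation d ℝ).op a f),
    coeFn_slabTranslation a (tensor ℓ hp f), ae_slabVol_fst (coeFn_horTranslation a f),
    (measurePreserving_slabShift (ℓ := ℓ) a).quasiMeasurePreserving.ae (coeFn_tensor (ℓ := ℓ) hp f)]
    with z h1 h2 h3 h4
  rw [h1, h2, h3, h4]
  simp [slabShift]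

lemma slabConv_tensorL {p : ℝ → ℝ} (hp : Continuous p) (k : SchwartzMap (Hor d) ℝ) (f : L2Hor d) :
    slabConv ℓ ℝ k (tensorL d ℓ hp f) = tensorL d ℓ hp (horConv k f) :=
  (TranslationFamily.map_avg _ _ (tensorL d ℓ hp) (fun a f => tensor_slabTranslation hp a f) k f).symm

lemma memLp_prod (f : L2Scalar d ℓ) :
    MemLp f 2 ((volume : Measure (Hor d)).prod (volume.restrict (Ioo 0 ℓ))) := by
  have h := Lp.memLp f
  generalize (f : Hor d × ℝ → ℝ) = F at h ⊢
  rwa [slabVol_eq_prod] at h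

lemma ae_memLp_slice (f : L2Scalar d ℓ) :
    ∀ᵐ y ∂(volume.restrict (Ioo 0 ℓ)), MemLp (fun x => f (x, y)) 2 (volume : Measure (Hor d)) := by
  have h := memLp_prod f
  have h1 : Integrable (fun z => f z ^ 2) ((volume : Measure (Hor d)).prod (volume.restrict (Ioo 0 ℓ))) :=
    h.integrable_sq
  have h0 : ∀ᵐ y ∂(volume.restrict (Ioo 0 ℓ)),
      AEStronglyMeasurable (fun x => f (x, y)) (volume : Measure (Hor d)) := h.1.prodMk_right
  filter_upwards [h1.prod_left_ae, h0] with y h2 h3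
  exact (memLp_two_iff_integrable_sq h3).2 h2

lemma integrable_mul_slice (f : L2Scalar d ℓ) (g : L2Hor d) :
    Integrable (fun z : Hor d × ℝ => g z.1 * f z)
      ((volume : Measure (Hor d)).prod (volume.restrict (Ioo 0 ℓ))) := by
  have h1 : MemLp (fun z : Hor d × ℝ => (1 : ℝ) * g z.1) 2 (slabVol d ℓ) :=
    memLp_tensor (p := fun _ => 1) continuous_const (Lp.memLp g)
  rw [slabVol_eq_prod] at h1
  simpa [Pi.mul_def] using h1.integrable_mul (memLp_prod f)

lemma integral_tensor_mul {p : ℝ → ℝ} (hp : Continuous p) (hc : HasCompactSupport p)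
    (f : L2Scalar d ℓ) (g : L2Hor d) :
    (inner ℝ (tensorL d ℓ hp g) f : ℝ) = ∫ y in Ioo 0 ℓ, p y • ∫ x, g x * f (x, y) := by
  have hi := integrable_mul_slice f g
  obtain ⟨C, hC⟩ := hc.exists_bound_of_continuous hp
  have hi2 : Integrable (fun z : Hor d × ℝ => p z.2 * (g z.1 * f z))
      ((volume : Measure (Hor d)).prod (volume.restrict (Ioo 0 ℓ))) :=
    hi.bdd_mul (c := C) (hp.comp continuous_snd).aestronglyMeasurable (Eventually.of_forall fun z => hC z.2)
  have e : (inner ℝ (tensorL d ℓ hp g) f : ℝ) = ∫ z, p z.2 * (g z.1 * f z) ∂(slabVol d ℓ) := by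
    rw [L2.inner_def]
    refine integral_congr_ae ?_
    filter_upwards [coeFn_tensor (ℓ := ℓ) hp g] with z hz
    rw [tensorL_apply, hz]
    simp; ring
  rw [e]
  generalize (f : Hor d × ℝ → ℝ) = F at hi2 ⊢
  rw [slabVol_eq_prod, integral_prod_symm _ hi2]
  refine integral_congr_ae (Eventually.of_forall fun y => ?_)
  simp only [smul_eq_mul]
  rw [integral_const_mul]

/-- Gives separability of L², hence the dense sequence used for slices. -/
instance : Fact ((2 : ℝ≥0∞) ≠ ⊤) := ⟨by simp⟩

/-- Horizontal convolution acts slice by slice. -/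
lemma slice_slabConv {k : SchwartzMap (Hor d) ℝ} (hk : ∀ a, k (-a) = k a) (f : L2Scalar d ℓ) :
    ∀ᵐ y ∂(volume.restrict (Ioo 0 ℓ)), ∀ h : MemLp (fun x => f (x, y)) 2 (volume : Measure (Hor d)),
      (fun x => slabConv ℓ ℝ k f (x, y)) =ᵐ[volume] horConv k (h.toLp _) := by
  have key : ∀ g : L2Hor d, ∀ᵐ y ∂(volume.restrict (Ioo 0 ℓ)),
      ∫ x, g x * slabConv ℓ ℝ k f (x, y) = ∫ x, horConv k g x * f (x, y) := fun g => by
    refine ae_eq_of_integral_contDiff_smul_eq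
      (integrable_mul_slice _ _).integral_prod_right.locallyIntegrable
      (integrable_mul_slice _ _).integral_prod_right.locallyIntegrable fun p hp hc => ?_
    rw [← integral_tensor_mul hp.continuous hc, ← integral_tensor_mul hp.continuous hc,
      ← slabConv_tensorL, inner_slabConv hk]
  -- For each g the identity holds off a null set of heights depending on g. A countable dense
  -- family gives one null set for all g.
  let D := TopologicalSpace.denseSeq (L2Hor d)
  have key2 : ∀ᵐ y ∂(volume.restrict (Ioo 0 ℓ)), ∀ n,
      ∫ x, D n x * slabConv ℓ ℝ k f (x, y) = ∫ x, horConv k (D n) x * f (x, y) :=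
    ae_all_iff.2 fun n => key (D n)
  filter_upwards [key2, ae_memLp_slice (slabConv ℓ ℝ k f)] with y h1 h2 h
  have h3 : h2.toLp _ = horConv k (h.toLp _) := by
    refine ext_inner_left ℝ fun g => ?_
    refine DenseRange.induction_on (TopologicalSpace.denseRange_denseSeq (L2Hor d))
      (p := fun g => (inner ℝ g (h2.toLp _) : ℝ) = inner ℝ g (horConv k (h.toLp _))) g
      (isClosed_eq (by fun_prop) (by fun_prop)) fun n => ?_
    rw [← inner_horConv hk, real_inner_comm, inner_toLp_eq_integral, real_inner_comm,
      inner_toLp_eq_integral]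
    simpa only [mul_comm] using h1 n
  rw [← h3]
  exact h2.coeFn_toLp.symm

end Slices

/-! ### Plancherel in the horizontal variable -/

section SlicePlancherel

variable {d : ℕ} {ℓ : ℝ}

lemma lintegral_enorm_sq {α E : Type*} [MeasurableSpace α] {μ : Measure α} [NormedAddCommGroup E]
    (f : Lp E 2 μ) : ∫⁻ x, ‖f x‖ₑ ^ 2 ∂μ = ENNReal.ofReal (‖f‖ ^ 2) := by
  rw [ENNReal.ofReal_pow (norm_nonneg _), ofReal_norm, Lp.enorm_def,
    eLpNorm_eq_lintegral_rpow_enorm_toReal (by simp) (by simp), ← ENNReal.rpow_natCast,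
    ← ENNReal.rpow_mul]
  simp

/-- Plancherel's formula for a convolution. -/
lemma lintegral_horConv {k : SchwartzMap (Hor d) ℝ} {m : Hor d → ℝ}
    (hm : MemLp (fun ξ => (m ξ : ℂ)) ∞ (volume : Measure (Hor d)))
    (hkm : ∀ ξ, 𝓕⁻ (fun a => (k a : ℂ)) ξ = m ξ) (h : L2Hor d) :
    ∫⁻ x, ‖horConv k h x‖ₑ ^ 2 = ∫⁻ ξ, ENNReal.ofReal (m ξ ^ 2) * ‖hat h ξ‖ₑ ^ 2 := by
  rw [lintegral_enorm_sq, ← norm_fourL, fourL_horConv k hm hkm, ← lintegral_enorm_sq]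
  refine lintegral_congr_ae ?_
  filter_upwards [coeFn_mulL hm (fourL d h)] with ξ h1
  rw [h1, hat_coe, enorm_mul, mul_pow]
  congr 1
  rw [← ofReal_norm, Complex.norm_real, ← ENNReal.ofReal_pow (norm_nonneg _), Real.norm_eq_abs, sq_abs]

lemma aestronglyMeasurable_hat {f : Hor d → ℝ} (hf : MemLp f 2 volume) :
    AEStronglyMeasurable (hat f) volume := by
  rw [hat_toLp hf]
  exact Lp.aestronglyMeasurable _

/-- Plancherel's formula for a horizontal convolution, slice by slice. -/
lemma lintegral_slabConv {k : SchwartzMap (Hor d) ℝ} (hk : ∀ a, k (-a) = k a) {m : Hor d → ℝ}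
    (hm : MemLp (fun ξ => (m ξ : ℂ)) ∞ (volume : Measure (Hor d)))
    (hkm : ∀ ξ, 𝓕⁻ (fun a => (k a : ℂ)) ξ = m ξ) (f : L2Scalar d ℓ) :
    -- The transform is chosen separately on each slice, so measurability in y is not automatic. It
    -- is inherited from the convolution and is needed later to sum over shells.
    AEMeasurable (fun y => ∫⁻ ξ, ENNReal.ofReal (m ξ ^ 2) * ‖hat (fun x => f (x, y)) ξ‖ₑ ^ 2)
      (volume.restrict (Ioo 0 ℓ)) ∧
    ENNReal.ofReal (‖slabConv ℓ ℝ k f‖ ^ 2)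
      = ∫⁻ y in Ioo 0 ℓ, ∫⁻ ξ, ENNReal.ofReal (m ξ ^ 2) * ‖hat (fun x => f (x, y)) ξ‖ₑ ^ 2 := by
  have hmeas : AEMeasurable (fun z => ‖slabConv ℓ ℝ k f z‖ₑ ^ 2)
      ((volume : Measure (Hor d)).prod (volume.restrict (Ioo 0 ℓ))) :=
    (memLp_prod (slabConv ℓ ℝ k f)).1.enorm.pow_const 2
  have h1 : (fun y => ∫⁻ x, ‖slabConv ℓ ℝ k f (x, y)‖ₑ ^ 2) =ᵐ[volume.restrict (Ioo 0 ℓ)]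
      fun y => ∫⁻ ξ, ENNReal.ofReal (m ξ ^ 2) * ‖hat (fun x => f (x, y)) ξ‖ₑ ^ 2 := by
    filter_upwards [slice_slabConv hk f, ae_memLp_slice f] with y h2 h3
    have h4 : ∫⁻ x, ‖slabConv ℓ ℝ k f (x, y)‖ₑ ^ 2 = ∫⁻ x, ‖horConv k (h3.toLp _) x‖ₑ ^ 2 := by
      refine lintegral_congr_ae ?_
      filter_upwards [h2 h3] with x hx
      rw [hx]
    rw [h4, lintegral_horConv hm hkm, hat_congr h3.coeFn_toLp]
  refine ⟨(hmeas.lintegral_prod_left').congr h1, ?_⟩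
  rw [← lintegral_congr_ae h1, ← lintegral_enorm_sq]
  generalize (slabConv ℓ ℝ k f : Hor d × ℝ → ℝ) = F at hmeas ⊢
  rw [slabVol_eq_prod, lintegral_prod_symm _ hmeas]

lemma lintegral_slice (f : L2Scalar d ℓ) :
    ENNReal.ofReal (‖f‖ ^ 2) = ∫⁻ y in Ioo 0 ℓ, ∫⁻ ξ, ‖hat (fun x => f (x, y)) ξ‖ₑ ^ 2 := by
  have hmeas : AEMeasurable (fun z => ‖f z‖ₑ ^ 2)
      ((volume : Measure (Hor d)).prod (volume.restrict (Ioo 0 ℓ))) :=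
    (memLp_prod f).1.enorm.pow_const 2
  have h1 : (fun y => ∫⁻ x, ‖f (x, y)‖ₑ ^ 2) =ᵐ[volume.restrict (Ioo 0 ℓ)]
      fun y => ∫⁻ ξ, ‖hat (fun x => f (x, y)) ξ‖ₑ ^ 2 := by
    filter_upwards [ae_memLp_slice f] with y h3
    rw [hat_toLp h3, lintegral_enorm_sq, norm_fourL, ← lintegral_enorm_sq]
    refine lintegral_congr_ae ?_
    filter_upwards [h3.coeFn_toLp] with x hx
    rw [hx]
  rw [← lintegral_congr_ae h1, ← lintegral_enorm_sq]
  generalize (f : Hor d × ℝ → ℝ) = F at hmeas ⊢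
  rw [slabVol_eq_prod, lintegral_prod_symm _ hmeas]

end SlicePlancherel

/-! ### Dyadic frequency shells -/

section Shells

open scoped SchwartzMap

variable {d : ℕ}

/-- A real even symbol has a real even transform. Reality keeps convolution within real fields;
evenness makes it self-adjoint. -/
lemma exists_kernel {m : Hor d → ℝ} (hm : ContDiff ℝ ∞ m) (hc : HasCompactSupport m)
    (he : ∀ ξ, m (-ξ) = m ξ) : ∃ k : 𝓢(Hor d, ℝ), (∀ a, k (-a) = k a) ∧
      ∀ ξ, 𝓕⁻ (fun a => (k a : ℂ)) ξ = m ξ := by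
  have hs : HasCompactSupport (fun x => (m x : ℂ)) := hc.comp_left (g := Complex.ofReal) rfl
  have hs' : ContDiff ℝ ∞ (fun x => (m x : ℂ)) := Complex.ofRealCLM.contDiff.comp hm
  obtain ⟨M, hM⟩ : ∃ M : 𝓢(Hor d, ℂ), ⇑M = fun x => (m x : ℂ) := ⟨hs.toSchwartzMap hs', rfl⟩
  obtain ⟨k, hk⟩ : ∃ k : 𝓢(Hor d, ℝ), ⇑k = fun x => ((𝓕 M) x).re :=
    ⟨SchwartzMap.postcompCLM (𝕜 := ℝ) Complex.reCLM (𝓕 M), rfl⟩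
  have hF : ∀ ξ, (𝓕 M) ξ = ∫ v, (Real.fourierChar (-(inner ℝ v ξ)) : ℂ) * (m v : ℂ) := fun ξ => by
    rw [SchwartzMap.fourier_coe, Real.fourier_eq, hM]; rfl
  have heven : ∀ ξ, (𝓕 M) (-ξ) = (𝓕 M) ξ := fun ξ => by
    rw [hF, hF, ← integral_neg_eq_self]
    simp [he]
  have hreal : ∀ ξ, (starRingEnd ℂ) ((𝓕 M) ξ) = (𝓕 M) ξ := fun ξ => by
    rw [hF, ← integral_conj, ← integral_neg_eq_self]
    congr 1 with v
    rw [map_mul, Complex.conj_ofReal, he, ← Circle.coe_inv_eq_conj, ← AddChar.map_neg_eq_inv]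
    simp
  refine ⟨k, fun a => by rw [hk]; simp only [heven], fun ξ => ?_⟩
  have h1 : (fun a => (k a : ℂ)) = ⇑(𝓕 M : 𝓢(Hor d, ℂ)) := by
    ext a
    rw [hk]
    exact Complex.conj_eq_iff_re.1 (hreal a)
  rw [h1, ← SchwartzMap.fourierInv_coe, FourierTransform.fourierInv_fourier_eq, hM]

/-- A smooth cut-off equal to `1` on `[1, 4]` and supported in `[1/4, 16]`. -/
def cutoff (s : ℝ) : ℝ :=
  Real.smoothTransition ((s - 1 / 4) / (3 / 4)) * Real.smoothTransition ((16 - s) / 12)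

lemma contDiff_cutoff : ContDiff ℝ ∞ cutoff :=
  (Real.smoothTransition.contDiff.comp (by fun_prop)).mul
    (Real.smoothTransition.contDiff.comp (by fun_prop))

lemma cutoff_nonneg (s : ℝ) : 0 ≤ cutoff s :=
  mul_nonneg (Real.smoothTransition.nonneg _) (Real.smoothTransition.nonneg _)

lemma cutoff_le_one (s : ℝ) : cutoff s ≤ 1 :=
  mul_le_one₀ (Real.smoothTransition.le_one _) (Real.smoothTransition.nonneg _)
    (Real.smoothTransition.le_one _)

lemma cutoff_eq_one {s : ℝ} (h1 : 1 ≤ s) (h2 : s ≤ 4) : cutoff s = 1 := by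
  rw [cutoff, Real.smoothTransition.one_of_one_le, Real.smoothTransition.one_of_one_le, one_mul]
  · rw [le_div_iff₀ (by norm_num)]; linarith
  · rw [le_div_iff₀ (by norm_num)]; linarith

lemma lt_of_cutoff_ne_zero {s : ℝ} (h : cutoff s ≠ 0) : 1 / 4 < s ∧ s < 16 := by
  constructor
  · by_contra hs
    refine left_ne_zero_of_mul h (Real.smoothTransition.zero_of_nonpos ?_)
    exact div_nonpos_of_nonpos_of_nonneg (by linarith [not_lt.1 hs]) (by norm_num)
  · by_contra hs
    refine right_ne_zero_of_mul h (Real.smoothTransition.zero_of_nonpos ?_)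
    exact div_nonpos_of_nonpos_of_nonneg (by linarith [not_lt.1 hs]) (by norm_num)

/-- The smooth symbol of the frequency shell at scale `a`. -/
def shell (d : ℕ) (a : ℝ) (ξ : Hor d) : ℝ := cutoff (‖ξ‖ ^ 2 / a ^ 2)

lemma shell_nonneg (a : ℝ) (ξ : Hor d) : 0 ≤ shell d a ξ := cutoff_nonneg _

lemma shell_le_one (a : ℝ) (ξ : Hor d) : shell d a ξ ≤ 1 := cutoff_le_one _

lemma contDiff_shell (a : ℝ) : ContDiff ℝ ∞ (shell d a) :=
  contDiff_cutoff.comp ((contDiff_norm_sq ℝ).div_const _)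

lemma bounds_of_shell_ne_zero {a : ℝ} (ha : 0 < a) {ξ : Hor d} (h : shell d a ξ ≠ 0) :
    a / 2 < ‖ξ‖ ∧ ‖ξ‖ < 4 * a := by
  obtain ⟨h1, h2⟩ := lt_of_cutoff_ne_zero h
  rw [lt_div_iff₀ (by positivity)] at h1
  rw [div_lt_iff₀ (by positivity)] at h2
  constructor
  · refine lt_of_pow_lt_pow_left₀ 2 (norm_nonneg _) ?_
    calc (a / 2) ^ 2 = 1 / 4 * a ^ 2 := by ring
      _ < _ := h1
  · refine lt_of_pow_lt_pow_left₀ 2 (by positivity) ?_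
    calc ‖ξ‖ ^ 2 < 16 * a ^ 2 := h2
      _ = _ := by ring

lemma shell_eq_one {a : ℝ} (ha : 0 < a) {ξ : Hor d} (h1 : a ≤ ‖ξ‖) (h2 : ‖ξ‖ ≤ 2 * a) :
    shell d a ξ = 1 := by
  refine cutoff_eq_one ?_ ?_
  · rw [le_div_iff₀ (by positivity), one_mul]
    exact pow_le_pow_left₀ ha.le h1 2
  · rw [div_le_iff₀ (by positivity)]
    calc ‖ξ‖ ^ 2 ≤ (2 * a) ^ 2 := pow_le_pow_left₀ (norm_nonneg _) h2 2
      _ = _ := by ring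

lemma hasCompactSupport_shell {a : ℝ} (ha : 0 < a) : HasCompactSupport (shell d a) :=
  HasCompactSupport.intro (isCompact_closedBall 0 (4 * a)) fun ξ hξ => by
    by_contra h
    exact hξ (by simpa using (bounds_of_shell_ne_zero ha h).2.le)

lemma memLp_shell (a : ℝ) : MemLp (fun ξ => (shell d a ξ : ℂ)) ∞ (volume : Measure (Hor d)) :=
  memLp_top_of_bound (Complex.continuous_ofReal.comp (contDiff_shell a).continuous).aestronglyMeasurable
    1 (Eventually.of_forall fun ξ => by
      rw [Complex.norm_real, Real.norm_of_nonneg (shell_nonneg _ _)]; exact shell_le_one _ _)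

lemma exists_shellKernel (d : ℕ) {a : ℝ} (ha : 0 < a) : ∃ k : 𝓢(Hor d, ℝ), (∀ x, k (-x) = k x) ∧
    ∀ ξ, 𝓕⁻ (fun x => (k x : ℂ)) ξ = shell d a ξ :=
  exists_kernel (contDiff_shell a) (hasCompactSupport_shell ha) fun ξ => by simp [shell]

/-- The dyadic scales. -/
def dyad (j : ℤ) : ℝ := 2 ^ j

lemma dyad_pos (j : ℤ) : 0 < dyad j := zpow_pos two_pos j

/-- The real even kernel whose Fourier transform is the shell symbol at scale `2^j`. -/
def dyadKernel (d : ℕ) (j : ℤ) : 𝓢(Hor d, ℝ) := (exists_shellKernel d (dyad_pos j)).choose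

lemma dyadKernel_even (j : ℤ) (x : Hor d) : dyadKernel d j (-x) = dyadKernel d j x :=
  (exists_shellKernel d (dyad_pos j)).choose_spec.1 x

lemma fourierInv_dyadKernel (j : ℤ) (ξ : Hor d) :
    𝓕⁻ (fun x => (dyadKernel d j x : ℂ)) ξ = shell d (dyad j) ξ :=
  (exists_shellKernel d (dyad_pos j)).choose_spec.2 ξ

/-- No exact partition of unity is needed: with `tsum_shell_le`, the squares of the shells sum to a
number between 1 and 3. The frequency 0 lies in no shell. -/
lemma one_le_tsum_shell {ξ : Hor d} (hξ : ξ ≠ 0) :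
    1 ≤ ∑' j : ℤ, ENNReal.ofReal (shell d (dyad j) ξ ^ 2) := by
  obtain ⟨j, h1, h2⟩ := exists_mem_Ico_zpow (norm_pos_iff.2 hξ) (one_lt_two (α := ℝ))
  refine le_trans ?_ (ENNReal.le_tsum j)
  rw [zpow_add_one₀ (by norm_num), mul_comm] at h2
  rw [shell_eq_one (dyad_pos j) h1 h2.le]
  simp

/-- If 2ⁿ ≤ |ξ| < 2ⁿ⁺¹, only the scales n-1, n, n+1 can meet ξ; hence the factor 3. -/
lemma tsum_shell_le {ξ : Hor d} (hξ : ξ ≠ 0) (c : ℤ → ℝ≥0∞) (B : ℝ≥0∞)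
    (h : ∀ j, ‖ξ‖ / 4 < dyad j → dyad j < 2 * ‖ξ‖ → c j ≤ B) :
    ∑' j : ℤ, c j * ENNReal.ofReal (shell d (dyad j) ξ ^ 2) ≤ 3 * B := by
  obtain ⟨n, h1, h2⟩ := exists_mem_Ico_zpow (norm_pos_iff.2 hξ) (one_lt_two (α := ℝ))
  have hz : ∀ j ∉ Finset.Icc (n - 1) (n + 1),
      c j * ENNReal.ofReal (shell d (dyad j) ξ ^ 2) = 0 := fun j hj => by
    by_contra hne
    have hs : shell d (dyad j) ξ ≠ 0 := fun h0 => hne (by simp [h0])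
    obtain ⟨h3, h4⟩ := bounds_of_shell_ne_zero (dyad_pos j) hs
    refine hj (Finset.mem_Icc.2 ⟨?_, ?_⟩)
    · have : (2 : ℝ) ^ n < 2 ^ (j + 2) := by
        rw [zpow_add₀ (by norm_num)]
        calc (2 : ℝ) ^ n ≤ ‖ξ‖ := h1
          _ < 4 * dyad j := h4
          _ = _ := by rw [dyad]; norm_num; ring
      have := (zpow_lt_zpow_iff_right₀ (one_lt_two (α := ℝ))).1 this
      omega
    · have : (2 : ℝ) ^ j < 2 ^ (n + 1 + 1) := by
        rw [zpow_add_one₀ (by norm_num)]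
        change dyad j < _
        linarith
      have := (zpow_lt_zpow_iff_right₀ (one_lt_two (α := ℝ))).1 this
      omega
  rw [tsum_eq_sum hz]
  have hb : ∀ j ∈ Finset.Icc (n - 1) (n + 1),
      c j * ENNReal.ofReal (shell d (dyad j) ξ ^ 2) ≤ B := fun j _ => by
    by_cases hs : shell d (dyad j) ξ = 0
    · simp [hs]
    · obtain ⟨h3, h4⟩ := bounds_of_shell_ne_zero (dyad_pos j) hs
      calc _ ≤ B * 1 := by
            gcongr
            · exact h j (by linarith) (by linarith)
            · refine ENNReal.ofReal_le_one.2 (pow_le_one₀ (shell_nonneg _ _) (shell_le_one _ _))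
        _ = B := mul_one _
  refine (Finset.sum_le_card_nsmul _ _ _ hb).trans_eq ?_
  have : (n + 1 + 1 - (n - 1)).toNat = 3 := by omega
  rw [Int.card_Icc, this]
  simp

end Shells

/-! ### Weak derivatives of tensor products -/

section TensorDerivatives

variable {d : ℕ} {ℓ : ℝ}

lemma hasDerivAt_vertical {φ : Hor d × ℝ → ℝ} (hφ : ContDiff ℝ ∞ φ) (x : Hor d) (y : ℝ) :
    HasDerivAt (fun y => φ (x, y)) (pderiv (Fin.last d) φ (x, y)) y := by
  have h1 : HasFDerivAt φ (fderiv ℝ φ (x, y)) (x, y) :=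
    (hφ.differentiable (by simp) (x, y)).hasFDerivAt
  have h2 : HasDerivAt (fun y : ℝ => ((x, y) : Hor d × ℝ)) (0, 1) y :=
    (hasDerivAt_const y x).prodMk (hasDerivAt_id y)
  have h3 := h1.comp_hasDerivAt y h2
  rwa [pderiv, dir_last]

lemma fderiv_horizontal {φ : Hor d × ℝ → ℝ} (hφ : ContDiff ℝ ∞ φ) (i : Fin d) (x : Hor d) (y : ℝ) :
    fderiv ℝ (fun x => φ (x, y)) x (EuclideanSpace.single i 1) = pderiv i.castSucc φ (x, y) := by
  have h1 : HasFDerivAt φ (fderiv ℝ φ (x, y)) (x, y) :=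
    (hφ.differentiable (by simp) (x, y)).hasFDerivAt
  have h2 : HasFDerivAt (fun x : Hor d => ((x, y) : Hor d × ℝ))
      ((ContinuousLinearMap.id ℝ (Hor d)).prod 0) x :=
    (hasFDerivAt_id x).prodMk (hasFDerivAt_const y x)
  have h3 : HasFDerivAt (fun x => φ (x, y)) _ x := h1.comp x h2
  rw [h3.fderiv, pderiv, dir_castSucc]
  simp

lemma integral_mul_tensor {χ : Hor d × ℝ → ℝ} (p : ℝ → ℝ) (hp : Continuous p) (f : L2Hor d) :
    ∫ z in slab d ℓ, χ z * tensorL d ℓ hp f z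
      = ∫ z, f z.1 * (χ z * p z.2) ∂((volume : Measure (Hor d)).prod (volume.restrict (Ioo 0 ℓ))) := by
  rw [← slabVol_eq_prod]
  refine integral_congr_ae ?_
  filter_upwards [coeFn_tensor (ℓ := ℓ) hp f] with z hz
  rw [tensorL_apply, hz]; ring

lemma integrable_mul_tensor {χ : Hor d × ℝ → ℝ} (hχ : MemLp χ 2 (slabVol d ℓ)) {p : ℝ → ℝ}
    (hp : Continuous p) (f : L2Hor d) : Integrable (fun z => f z.1 * (χ z * p z.2))
      ((volume : Measure (Hor d)).prod (volume.restrict (Ioo 0 ℓ))) := by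
  rw [← slabVol_eq_prod]
  refine (hχ.integrable_mul (memLp_tensor hp (Lp.memLp f))).congr (Eventually.of_forall fun z => ?_)
  simp only [Pi.mul_apply]; ring

/-- Vertical integration by parts for a tensor product. -/
lemma integral_vertical_tensor (hℓ : 0 < ℓ) {U : Set (Hor d × ℝ)} {φ : Hor d × ℝ → ℝ} (hφ : IsTest U φ)
    {p p' : ℝ → ℝ} (hp : Continuous p) (hp' : Continuous p') (h : ∀ y, HasDerivAt p (p' y) y)
    (f : L2Hor d) :
    (∫ z in slab d ℓ, pderiv (Fin.last d) φ z * tensorL d ℓ hp f z)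
      + (∫ z in slab d ℓ, φ z * tensorL d ℓ hp' f z)
      = ∫ x, f x * (φ (x, ℓ) * p ℓ - φ (x, 0) * p 0) := by
  have i1 := integrable_mul_tensor (hφ.memLp_pderiv ℓ (Fin.last d)) hp f
  have i2 := integrable_mul_tensor (hφ.memLp ℓ) hp' f
  have i3 : Integrable (fun z => f z.1 * (pderiv (Fin.last d) φ z * p z.2) + f z.1 * (φ z * p' z.2))
      ((volume : Measure (Hor d)).prod (volume.restrict (Ioo 0 ℓ))) := i1.add i2
  rw [integral_mul_tensor, integral_mul_tensor, ← integral_add i1 i2, integral_prod _ i3]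
  refine integral_congr_ae (Eventually.of_forall fun x => ?_)
  simp only [← mul_add]
  rw [integral_const_mul]
  congr 1
  rw [← integral_Ioc_eq_integral_Ioo, ← intervalIntegral.integral_of_le hℓ.le]
  have hc : Continuous (pderiv (Fin.last d) φ) :=
    (hφ.smooth.continuous_fderiv (by simp)).clm_apply continuous_const
  have hcφ := hφ.smooth.continuous
  exact intervalIntegral.integral_eq_sub_of_hasDerivAt
    (fun y _ => (hasDerivAt_vertical hφ.smooth x y).mul (h y))
    (Continuous.intervalIntegrable (by fun_prop) _ _)

/-- Horizontal integration by parts for a tensor product with a Fourier multiplier. -/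
lemma integral_horizontal_tensor {U : Set (Hor d × ℝ)} {φ : Hor d × ℝ → ℝ} (hφ : IsTest U φ)
    {p : ℝ → ℝ} (hp : Continuous p) (i : Fin d) {q q' : Hor d → ℂ}
    (hq : MemLp q ∞ (volume : Measure (Hor d))) (hq' : MemLp q' ∞ (volume : Measure (Hor d)))
    (h : ∀ ξ, q' ξ = (2 * Real.pi * Complex.I * (ξ i : ℝ)) * q ξ) (f : L2Hor d) :
    (∫ z in slab d ℓ, pderiv i.castSucc φ z * tensorL d ℓ hp (multL hq f) z)
      = - ∫ z in slab d ℓ, φ z * tensorL d ℓ hp (multL hq' f) z := by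
  have i1 := integrable_mul_tensor (hφ.memLp_pderiv ℓ i.castSucc) hp (multL hq f)
  have i2 := integrable_mul_tensor (hφ.memLp ℓ) hp (multL hq' f)
  rw [integral_mul_tensor, integral_mul_tensor, integral_prod_symm _ i1, integral_prod_symm _ i2,
    ← integral_neg]
  refine integral_congr_ae (Eventually.of_forall fun y => ?_)
  have hs : ContDiff ℝ ∞ (fun x => φ (x, y)) := hφ.smooth.comp (by fun_prop)
  have hc : HasCompactSupport (fun x => φ (x, y)) := by
    have hK := (hφ.compact.isCompact.image continuous_fst)
    refine HasCompactSupport.intro hK fun x hx => ?_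
    by_contra hne
    exact hx ⟨(x, y), subset_tsupport _ hne, rfl⟩
  have key := inner_multL_fderiv hq hq' (EuclideanSpace.single i 1) (fun ξ => by
    rw [h ξ, EuclideanSpace.inner_single_right]; simp) hs hc f
  simp only [fderiv_horizontal hφ.smooth] at key
  simp only
  have e : ∀ (χ : Hor d × ℝ → ℝ) (g : L2Hor d), ∫ x, g x * (χ (x, y) * p y)
      = p y * ∫ x, χ (x, y) * g x := fun χ g => by
    rw [← integral_const_mul]
    congr 1 with x
    ring
  rw [e, e, key, mul_neg]

/-- The field with given components. -/
def unitL (d : ℕ) (ℓ : ℝ) (i : Fin (d + 1)) : L2Scalar d ℓ →L[ℝ] L2Slab d ℓ :=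
  ((ContinuousLinearMap.id ℝ ℝ).smulRight (EuclideanSpace.single i (1 : ℝ) : Vel d)).compLpL 2
    (slabVol d ℓ)

lemma compL_unitL (i j : Fin (d + 1)) (f : L2Scalar d ℓ) :
    compL d ℓ i (unitL d ℓ j f) = if i = j then f else 0 := by
  refine Lp.ext ?_
  filter_upwards [coeFn_compL i (unitL d ℓ j f),
    ((ContinuousLinearMap.id ℝ ℝ).smulRight (EuclideanSpace.single j (1 : ℝ) : Vel d)).coeFn_compLpL
      (p := 2) (μ := slabVol d ℓ) f, Lp.coeFn_zero ℝ 2 (slabVol d ℓ)] with z h1 h2 h3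
  rw [h1]
  change (((ContinuousLinearMap.id ℝ ℝ).smulRight (EuclideanSpace.single j (1 : ℝ) : Vel d)).compLpL 2
    (slabVol d ℓ) f) z i = _
  rw [h2]
  by_cases hij : i = j
  · subst hij; simp
  · rw [if_neg hij, h3]
    simp [hij]

lemma compL_sum_unitL (F : Fin (d + 1) → L2Hor d →L[ℝ] L2Scalar d ℓ) (i : Fin (d + 1)) (h : L2Hor d) :
    compL d ℓ i ((∑ j, (unitL d ℓ j).comp (F j)) h) = F i h := by
  simp [compL_unitL]

end TensorDerivatives

/-! ### Symbols and vertical profiles of the lift -/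

section LiftData

variable {d : ℕ}

/-- The indicator function of the closed frequency shell at scale `a`. -/
def cut (d : ℕ) (a : ℝ) : Hor d → ℂ := {ξ : Hor d | a / 2 ≤ ‖ξ‖ ∧ ‖ξ‖ ≤ 4 * a}.indicator fun _ => 1

lemma measurable_cut (a : ℝ) : Measurable (cut d a) :=
  measurable_const.indicator ((measurableSet_le measurable_const measurable_norm).inter
    (measurableSet_le measurable_norm measurable_const))

lemma norm_cut_le (a : ℝ) (ξ : Hor d) : ‖cut d a ξ‖ ≤ 1 := by
  unfold cut indicator
  split_ifs <;> simp

lemma cut_eq_zero {a : ℝ} {ξ : Hor d} (h : ¬(a / 2 ≤ ‖ξ‖ ∧ ‖ξ‖ ≤ 4 * a)) : cut d a ξ = 0 := by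
  unfold cut indicator
  rw [if_neg]
  exact h

/-- The symbols of the components of the divergence-free lift. -/
def liftSymbol (d : ℕ) (a : ℝ) (i : Fin (d + 1)) (ξ : Hor d) : ℂ :=
  Fin.lastCases (motive := fun _ => ℂ) 1
    (fun j => Complex.I * (ξ j : ℝ) / (2 * Real.pi * (‖ξ‖ ^ 2 : ℝ))) i * cut d a ξ

/-- The symbols of the horizontal derivatives of the components of the lift. -/
def liftGradSymbol (d : ℕ) (a : ℝ) (k : Fin d) (i : Fin (d + 1)) (ξ : Hor d) : ℂ :=
  2 * Real.pi * Complex.I * (ξ k : ℝ) * liftSymbol d a i ξ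

lemma liftSymbol_last (a : ℝ) (ξ : Hor d) : liftSymbol d a (Fin.last d) ξ = cut d a ξ := by
  simp [liftSymbol]

lemma liftSymbol_castSucc (a : ℝ) (j : Fin d) (ξ : Hor d) : liftSymbol d a j.castSucc ξ
    = Complex.I * (ξ j : ℝ) / (2 * Real.pi * (‖ξ‖ ^ 2 : ℝ)) * cut d a ξ := by
  simp [liftSymbol]

lemma measurable_liftSymbol (a : ℝ) (i : Fin (d + 1)) : Measurable (liftSymbol d a i) := by
  induction i using Fin.lastCases with
  | last => rw [funext (liftSymbol_last a)]; exact measurable_cut a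
  | cast j =>
    have h : Measurable fun ξ : Hor d =>
        Complex.I * (ξ j : ℝ) / (2 * Real.pi * (‖ξ‖ ^ 2 : ℝ)) * cut d a ξ := by
      have := measurable_cut (d := d) a
      have h2 : Measurable fun ξ : Hor d => ξ j :=
        (EuclideanSpace.proj j : Hor d →L[ℝ] ℝ).continuous.measurable
      fun_prop
    rwa [funext (liftSymbol_castSucc a j)]

lemma measurable_liftGradSymbol (a : ℝ) (k : Fin d) (i : Fin (d + 1)) :
    Measurable (liftGradSymbol d a k i) := by
  have := measurable_liftSymbol a i
  have h2 : Measurable fun ξ : Hor d => ξ k :=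
    (EuclideanSpace.proj k : Hor d →L[ℝ] ℝ).continuous.measurable
  unfold liftGradSymbol
  fun_prop

lemma norm_mul_cut_le {a : ℝ} {c : ℝ} (hc : 0 ≤ c) (z : ℂ) (ξ : Hor d)
    (h : a / 2 ≤ ‖ξ‖ → ‖ξ‖ ≤ 4 * a → ‖z‖ ≤ c) : ‖z * cut d a ξ‖ ≤ c := by
  by_cases hξ : a / 2 ≤ ‖ξ‖ ∧ ‖ξ‖ ≤ 4 * a
  · rw [norm_mul]
    calc _ ≤ c * 1 := mul_le_mul (h hξ.1 hξ.2) (norm_cut_le a ξ) (norm_nonneg _) hc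
      _ = c := mul_one c
  · have : cut d a ξ = 0 := cut_eq_zero hξ
    rw [this]; simpa

lemma abs_coord_le (ξ : Hor d) (j : Fin d) : |ξ j| ≤ ‖ξ‖ := PiLp.norm_apply_le ξ j

lemma norm_liftSymbol_last_le (a : ℝ) (ξ : Hor d) : ‖liftSymbol d a (Fin.last d) ξ‖ ≤ 1 := by
  rw [liftSymbol_last]; exact norm_cut_le a ξ

lemma norm_liftSymbol_castSucc_le {a : ℝ} (ha : 0 < a) (j : Fin d) (ξ : Hor d) :
    ‖liftSymbol d a j.castSucc ξ‖ ≤ 1 / a := by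
  rw [liftSymbol_castSucc]
  refine norm_mul_cut_le (by positivity) _ ξ fun h1 _ => ?_
  have hp : 0 < ‖ξ‖ := lt_of_lt_of_le (by positivity) h1
  have h2 := abs_coord_le ξ j
  have hpi := Real.pi_gt_three
  simp only [norm_div, norm_mul, Complex.norm_I, Complex.norm_real, Complex.norm_ofNat,
    Real.norm_eq_abs, abs_of_pos Real.pi_pos, abs_of_nonneg (sq_nonneg ‖ξ‖), one_mul]
  rw [div_le_div_iff₀ (by positivity) ha, one_mul]
  calc |ξ j| * a ≤ ‖ξ‖ * (2 * ‖ξ‖) := by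
        gcongr; linarith
    _ = 2 * 1 * ‖ξ‖ ^ 2 := by ring
    _ ≤ 2 * Real.pi * ‖ξ‖ ^ 2 := by gcongr; linarith

lemma norm_liftGradSymbol_last_le {a : ℝ} (ha : 0 < a) (k : Fin d) (ξ : Hor d) :
    ‖liftGradSymbol d a k (Fin.last d) ξ‖ ≤ 32 * a := by
  rw [liftGradSymbol, liftSymbol_last]
  refine norm_mul_cut_le (by positivity) _ ξ fun _ h1 => ?_
  have h2 := abs_coord_le ξ k
  have hpi := Real.pi_le_four
  simp only [norm_mul, Complex.norm_I, Complex.norm_real, Complex.norm_ofNat,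
    Real.norm_eq_abs, abs_of_pos Real.pi_pos, mul_one]
  calc 2 * Real.pi * |ξ k| ≤ 2 * 4 * (4 * a) := by gcongr; linarith
    _ = 32 * a := by ring

lemma norm_liftGradSymbol_castSucc_le {a : ℝ} (ha : 0 < a) (k j : Fin d) (ξ : Hor d) :
    ‖liftGradSymbol d a k j.castSucc ξ‖ ≤ 1 := by
  rw [liftGradSymbol, liftSymbol_castSucc, ← mul_assoc]
  refine norm_mul_cut_le (by positivity) _ ξ fun h1 _ => ?_
  have hp : 0 < ‖ξ‖ := lt_of_lt_of_le (by positivity) h1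
  have h2 := abs_coord_le ξ j
  have h3 := abs_coord_le ξ k
  have hpi := Real.pi_pos
  simp only [norm_div, norm_mul, Complex.norm_I, Complex.norm_real, Complex.norm_ofNat,
    Real.norm_eq_abs, abs_of_pos Real.pi_pos, abs_of_nonneg (sq_nonneg ‖ξ‖), one_mul, mul_one]
  rw [mul_div_assoc', div_le_one (by positivity)]
  calc 2 * Real.pi * |ξ k| * |ξ j| ≤ 2 * Real.pi * ‖ξ‖ * ‖ξ‖ := by gcongr
    _ = _ := by ring

lemma memLp_liftSymbol {a : ℝ} (ha : 0 < a) (i : Fin (d + 1)) :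
    MemLp (liftSymbol d a i) ∞ (volume : Measure (Hor d)) := by
  refine memLp_top_of_bound (measurable_liftSymbol a i).aestronglyMeasurable (1 + 1 / a)
    (Eventually.of_forall fun ξ => ?_)
  have h0 : 0 < 1 / a := by positivity
  induction i using Fin.lastCases with
  | last => exact (norm_liftSymbol_last_le a ξ).trans (by linarith)
  | cast j => exact (norm_liftSymbol_castSucc_le ha j ξ).trans (by linarith)

lemma memLp_liftGradSymbol {a : ℝ} (ha : 0 < a) (k : Fin d) (i : Fin (d + 1)) :
    MemLp (liftGradSymbol d a k i) ∞ (volume : Measure (Hor d)) := by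
  refine memLp_top_of_bound (measurable_liftGradSymbol a k i).aestronglyMeasurable (1 + 32 * a)
    (Eventually.of_forall fun ξ => ?_)
  induction i using Fin.lastCases with
  | last => exact (norm_liftGradSymbol_last_le ha k ξ).trans (by linarith)
  | cast j => exact (norm_liftGradSymbol_castSucc_le ha k j ξ).trans (by linarith)

/-- The reason for the factor iξⱼ/(2π|ξ|²): multiplying by 2πiξⱼ and summing gives -1, so the
horizontal divergence cancels the vertical derivative of the profile. -/
lemma sum_liftGradSymbol {a : ℝ} (ha : 0 < a) (ξ : Hor d) :
    ∑ k, liftGradSymbol d a k k.castSucc ξ = - liftSymbol d a (Fin.last d) ξ := by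
  rw [liftSymbol_last]
  by_cases hξ : a / 2 ≤ ‖ξ‖ ∧ ‖ξ‖ ≤ 4 * a
  · have hp : 0 < ‖ξ‖ := lt_of_lt_of_le (by positivity) hξ.1
    have hp' : ((‖ξ‖ : ℝ) : ℂ) ≠ 0 := by exact_mod_cast hp.ne'
    have hpi : ((Real.pi : ℝ) : ℂ) ≠ 0 := by exact_mod_cast Real.pi_ne_zero
    have h1 : ∀ k, liftGradSymbol d a k k.castSucc ξ
        = -(((ξ k) ^ 2 : ℝ) : ℂ) / ((‖ξ‖ ^ 2 : ℝ) : ℂ) * cut d a ξ := fun k => by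
      rw [liftGradSymbol, liftSymbol_castSucc]
      push_cast
      field_simp
      rw [Complex.I_sq]; ring
    simp_rw [h1]
    rw [← Finset.sum_mul, ← Finset.sum_div, Finset.sum_neg_distrib, ← Complex.ofReal_sum,
      ← EuclideanSpace.real_norm_sq_eq]
    push_cast
    field_simp
  · have : cut d a ξ = 0 := cut_eq_zero hξ
    simp only [liftGradSymbol, liftSymbol, this, mul_zero, Finset.sum_const_zero, neg_zero]

/-- The vertical profile of the lift. -/
def prof (ℓ : ℝ) (m : ℕ) (y : ℝ) : ℝ := (y / ℓ) ^ (m + 2)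

/-- The derivative of the vertical profile. -/
def prof' (ℓ : ℝ) (m : ℕ) (y : ℝ) : ℝ := (m + 2) / ℓ * (y / ℓ) ^ (m + 1)

/-- The second derivative of the vertical profile. -/
def prof'' (ℓ : ℝ) (m : ℕ) (y : ℝ) : ℝ := (m + 2) * (m + 1) / ℓ ^ 2 * (y / ℓ) ^ m

lemma continuous_prof (ℓ : ℝ) (m : ℕ) : Continuous (prof ℓ m) := by unfold prof; fun_prop
lemma continuous_prof' (ℓ : ℝ) (m : ℕ) : Continuous (prof' ℓ m) := by unfold prof'; fun_prop
lemma continuous_prof'' (ℓ : ℝ) (m : ℕ) : Continuous (prof'' ℓ m) := by unfold prof''; fun_prop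

lemma hasDerivAt_prof (ℓ : ℝ) (m : ℕ) (y : ℝ) : HasDerivAt (prof ℓ m) (prof' ℓ m y) y := by
  have h := ((hasDerivAt_id y).div_const ℓ).pow (m + 2)
  refine h.congr_deriv ?_
  simp only [prof', id]
  push_cast
  ring

lemma hasDerivAt_prof' (ℓ : ℝ) (m : ℕ) (y : ℝ) : HasDerivAt (prof' ℓ m) (prof'' ℓ m y) y := by
  have h := (((hasDerivAt_id y).div_const ℓ).pow (m + 1)).const_mul (((m : ℝ) + 2) / ℓ)
  refine h.congr_deriv ?_
  simp only [prof'', id]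
  push_cast
  ring

lemma integral_pow_sq {ℓ : ℝ} (hℓ : 0 < ℓ) (c : ℝ) (m : ℕ) :
    ∫ y in Ioo 0 ℓ, (c * (y / ℓ) ^ m) ^ 2 = c ^ 2 * (ℓ / (2 * m + 1)) := by
  rw [← integral_Ioc_eq_integral_Ioo, ← intervalIntegral.integral_of_le hℓ.le]
  have : ∀ y : ℝ, (c * (y / ℓ) ^ m) ^ 2 = c ^ 2 / ℓ ^ (2 * m) * y ^ (2 * m) := fun y => by
    rw [div_pow]; field_simp; ring
  simp_rw [this]
  rw [intervalIntegral.integral_const_mul, integral_pow]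
  push_cast
  rw [zero_pow (by omega), pow_succ]
  field_simp
  ring

lemma integral_prof_sq_le {ℓ : ℝ} (hℓ : 0 < ℓ) (m : ℕ) :
    ∫ y in Ioo 0 ℓ, prof ℓ m y ^ 2 ≤ ℓ / (m + 2) := by
  have h := integral_pow_sq hℓ 1 (m + 2)
  simp only [one_mul] at h
  simp only [prof]
  rw [h]
  push_cast
  rw [one_pow, one_mul]
  refine div_le_div_of_nonneg_left hℓ.le (by positivity) ?_
  linarith [Nat.cast_nonneg (α := ℝ) m]

lemma integral_prof'_sq_le {ℓ : ℝ} (hℓ : 0 < ℓ) (m : ℕ) :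
    ∫ y in Ioo 0 ℓ, prof' ℓ m y ^ 2 ≤ (m + 2) / ℓ := by
  simp only [prof']
  rw [integral_pow_sq hℓ]
  push_cast
  have := Nat.cast_nonneg (α := ℝ) m
  rw [div_pow, div_mul_div_comm, div_le_div_iff₀ (by positivity) hℓ]
  nlinarith [mul_nonneg this (sq_nonneg ℓ), mul_nonneg (mul_nonneg this this) (sq_nonneg ℓ), sq_nonneg ℓ]

lemma integral_prof''_sq_le {ℓ : ℝ} (hℓ : 0 < ℓ) (m : ℕ) :
    ∫ y in Ioo 0 ℓ, prof'' ℓ m y ^ 2 ≤ (m + 2) ^ 3 / ℓ ^ 3 := by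
  simp only [prof'']
  rw [integral_pow_sq hℓ]
  have := Nat.cast_nonneg (α := ℝ) m
  rw [div_pow, div_mul_div_comm, div_le_div_iff₀ (by positivity) (by positivity)]
  have h : ((m : ℝ) + 1) ^ 2 ≤ (m + 2) * (2 * m + 1) := by nlinarith
  calc (((m : ℝ) + 2) * (m + 1)) ^ 2 * ℓ * ℓ ^ 3 = (m + 2) ^ 2 * ((m + 1) ^ 2) * ℓ ^ 4 := by ring
    _ ≤ (m + 2) ^ 2 * ((m + 2) * (2 * m + 1)) * ℓ ^ 4 := by gcongr
    _ = _ := by ring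

end LiftData

/-! ### The divergence-free lift -/

section Lift

variable {d : ℕ} {ℓ : ℝ}

lemma multL_neg {q : Hor d → ℂ} (hq : MemLp q ∞ (volume : Measure (Hor d))) (h : L2Hor d) :
    multL hq.neg h = - multL hq h := by
  have h1 : mulL hq.neg (fourL d h) = - mulL hq (fourL d h) := by
    refine Lp.ext ?_
    filter_upwards [coeFn_mulL hq.neg (fourL d h), coeFn_mulL hq (fourL d h),
      Lp.coeFn_neg (mulL hq (fourL d h))] with ξ h1 h2 h3
    rw [h1, h3, Pi.neg_apply, Pi.neg_apply, h2, neg_mul]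
  rw [multL_apply, h1, map_neg, map_neg]
  rfl

/-- The vertical profiles of the components of the lift. -/
def liftProf (d : ℕ) (ℓ : ℝ) (m : ℕ) (i : Fin (d + 1)) : ℝ → ℝ :=
  Fin.lastCases (motive := fun _ => ℝ → ℝ) (prof ℓ m) (fun _ => prof' ℓ m) i

/-- The derivatives of the vertical profiles of the components of the lift. -/
def liftProf' (d : ℕ) (ℓ : ℝ) (m : ℕ) (i : Fin (d + 1)) : ℝ → ℝ :=
  Fin.lastCases (motive := fun _ => ℝ → ℝ) (prof' ℓ m) (fun _ => prof'' ℓ m) i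

@[simp] lemma liftProf_last (m : ℕ) : liftProf d ℓ m (Fin.last d) = prof ℓ m := by simp [liftProf]
@[simp] lemma liftProf_castSucc (m : ℕ) (j : Fin d) : liftProf d ℓ m j.castSucc = prof' ℓ m := by
  simp [liftProf]
@[simp] lemma liftProf'_last (m : ℕ) : liftProf' d ℓ m (Fin.last d) = prof' ℓ m := by simp [liftProf']
@[simp] lemma liftProf'_castSucc (m : ℕ) (j : Fin d) : liftProf' d ℓ m j.castSucc = prof'' ℓ m := by
  simp [liftProf']

lemma continuous_liftProf (ℓ : ℝ) (m : ℕ) (i : Fin (d + 1)) : Continuous (liftProf d ℓ m i) := by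
  induction i using Fin.lastCases with
  | last => rw [liftProf_last]; exact continuous_prof ℓ m
  | cast j => rw [liftProf_castSucc]; exact continuous_prof' ℓ m

lemma continuous_liftProf' (ℓ : ℝ) (m : ℕ) (i : Fin (d + 1)) : Continuous (liftProf' d ℓ m i) := by
  induction i using Fin.lastCases with
  | last => rw [liftProf'_last]; exact continuous_prof' ℓ m
  | cast j => rw [liftProf'_castSucc]; exact continuous_prof'' ℓ m

lemma hasDerivAt_liftProf (m : ℕ) (i : Fin (d + 1)) (y : ℝ) :
    HasDerivAt (liftProf d ℓ m i) (liftProf' d ℓ m i y) y := by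
  induction i using Fin.lastCases with
  | last => rw [liftProf_last, liftProf'_last]; exact hasDerivAt_prof ℓ m y
  | cast j => rw [liftProf_castSucc, liftProf'_castSucc]; exact hasDerivAt_prof' ℓ m y

/-- The exponent m + 2 ensures this even for m = 0: the profile and its derivative, which carries
the horizontal components, both vanish at the bottom. -/
lemma liftProf_zero (m : ℕ) (i : Fin (d + 1)) : liftProf d ℓ m i 0 = 0 := by
  induction i using Fin.lastCases with
  | last => simp [prof]
  | cast j => simp [prof']

variable {a : ℝ}

/-- The components of the lift. -/
def liftVal (ℓ : ℝ) (ha : 0 < a) (m : ℕ) (i : Fin (d + 1)) : L2Hor d →L[ℝ] L2Scalar d ℓ :=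
  (tensorL d ℓ (continuous_liftProf ℓ m i)).comp (multL (memLp_liftSymbol ha i))

/-- The partial derivatives of the components of the lift. -/
def liftGrad (ℓ : ℝ) (ha : 0 < a) (m : ℕ) (k i : Fin (d + 1)) : L2Hor d →L[ℝ] L2Scalar d ℓ :=
  Fin.lastCases (motive := fun _ => L2Hor d →L[ℝ] L2Scalar d ℓ)
    ((tensorL d ℓ (continuous_liftProf' ℓ m i)).comp (multL (memLp_liftSymbol ha i)))
    (fun k => (tensorL d ℓ (continuous_liftProf ℓ m i)).comp (multL (memLp_liftGradSymbol ha k i))) k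

lemma liftGrad_last (ha : 0 < a) (m : ℕ) (i : Fin (d + 1)) (h : L2Hor d) :
    liftGrad ℓ ha m (Fin.last d) i h
      = tensorL d ℓ (continuous_liftProf' ℓ m i) (multL (memLp_liftSymbol ha i) h) := by
  simp [liftGrad]

lemma liftGrad_castSucc (ha : 0 < a) (m : ℕ) (k : Fin d) (i : Fin (d + 1)) (h : L2Hor d) :
    liftGrad ℓ ha m k.castSucc i h
      = tensorL d ℓ (continuous_liftProf ℓ m i) (multL (memLp_liftGradSymbol ha k i) h) := by
  simp [liftGrad]

/-- The lift with its gradient. -/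
def liftJet (ℓ : ℝ) (ha : 0 < a) (m : ℕ) : L2Hor d →L[ℝ] Jet d ℓ :=
  (WithLp.prodContinuousLinearEquiv 2 ℝ (L2Slab d ℓ)
      (PiLp 2 (fun _ : Fin (d + 1) => L2Slab d ℓ))).symm.toContinuousLinearMap.comp
    ((∑ i, (unitL d ℓ i).comp (liftVal ℓ ha m i)).prod
      ((PiLp.continuousLinearEquiv 2 ℝ (fun _ : Fin (d + 1) => L2Slab d ℓ)).symm.toContinuousLinearMap.comp
        (ContinuousLinearMap.pi fun k => ∑ i, (unitL d ℓ i).comp (liftGrad ℓ ha m k i))))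

lemma compL_liftJet_fst (ha : 0 < a) (m : ℕ) (i : Fin (d + 1)) (h : L2Hor d) :
    compL d ℓ i (liftJet ℓ ha m h).fst = liftVal ℓ ha m i h := compL_sum_unitL _ i h

lemma compL_liftJet_snd (ha : 0 < a) (m : ℕ) (k i : Fin (d + 1)) (h : L2Hor d) :
    compL d ℓ i ((liftJet ℓ ha m h).snd k) = liftGrad ℓ ha m k i h := compL_sum_unitL _ i h

lemma IsTest.eq_zero {U : Set (Hor d × ℝ)} {φ : Hor d × ℝ → ℝ} (h : IsTest U φ) {z : Hor d × ℝ}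
    (hz : z ∉ U) : φ z = 0 := image_eq_zero_of_notMem_tsupport fun h' => hz (h.supp h')

/-- The boundary term vanishes at the top by the test function and at the bottom by the profile.
Taking U as the slab or as y < ℓ gives the weak gradient or the bottom condition. -/
lemma isWeakPartial_liftJet (hℓ : 0 < ℓ) (ha : 0 < a) (m : ℕ) (h : L2Hor d) {U : Set (Hor d × ℝ)}
    (hU : U ⊆ {z | z.2 < ℓ}) (k : Fin (d + 1)) :
    IsWeakPartial U k (liftJet ℓ ha m h).fst ((liftJet ℓ ha m h).snd k) := by
  refine isWeakPartial_of_component fun i φ hφ => ?_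
  rw [compL_liftJet_fst, compL_liftJet_snd]
  induction k using Fin.lastCases with
  | last =>
    rw [liftGrad_last, eq_neg_iff_add_eq_zero]
    refine (integral_vertical_tensor hℓ hφ (continuous_liftProf ℓ m i) (continuous_liftProf' ℓ m i)
      (hasDerivAt_liftProf m i) _).trans ?_
    have h1 : ∀ x : Hor d, φ (x, ℓ) = 0 := fun x => hφ.eq_zero fun h' => lt_irrefl ℓ (hU h')
    simp [h1, liftProf_zero]
  | cast k =>
    rw [liftGrad_castSucc]
    exact integral_horizontal_tensor hφ (continuous_liftProf ℓ m i) k _ _ (fun ξ => rfl) h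

lemma divergence_liftJet (ha : 0 < a) (m : ℕ) (h : L2Hor d) :
    ∑ i, compL d ℓ i ((liftJet ℓ ha m h).snd i) = 0 := by
  simp only [compL_liftJet_snd]
  rw [Fin.sum_univ_castSucc, liftGrad_last]
  simp only [liftGrad_castSucc]
  have e1 : ∀ k : Fin d, tensorL d ℓ (continuous_liftProf ℓ m k.castSucc)
      (multL (memLp_liftGradSymbol ha k k.castSucc) h)
      = tensorL d ℓ (continuous_prof' ℓ m) (multL (memLp_liftGradSymbol ha k k.castSucc) h) := fun k => by
    congr 2; exact liftProf_castSucc m k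
  have e2 : tensorL d ℓ (continuous_liftProf' ℓ m (Fin.last d))
      (multL (memLp_liftSymbol ha (Fin.last d)) h)
      = tensorL d ℓ (continuous_prof' ℓ m) (multL (memLp_liftSymbol ha (Fin.last d)) h) := by
    congr 2; exact liftProf'_last m
  simp only [e1, e2]
  rw [← map_sum, ← map_add, ← multL_sum Finset.univ (fun k => memLp_liftGradSymbol ha k k.castSucc)
    (memLp_liftSymbol ha (Fin.last d)).neg (fun ξ => (sum_liftGradSymbol ha ξ).symm), multL_neg _ h,
    neg_add_cancel, map_zero]
  exact memLp_liftSymbol ha (Fin.last d)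

lemma liftJet_mem (hℓ : 0 < ℓ) (ha : 0 < a) (m : ℕ) (h : L2Hor d) :
    liftJet ℓ ha m h ∈ solenoidal d ℓ :=
  ⟨fun k => isWeakPartial_liftJet hℓ ha m h (fun _ hz => hz.2) k,
    isWeakPartial_liftJet hℓ ha m h subset_rfl _,
    (divergence_eq_zero_iff _).2 (divergence_liftJet ha m h)⟩

/-- A divergence-free lift of functions on the top boundary, restricted to frequencies `|ξ| ~ a`. -/
def lift (hℓ : 0 < ℓ) (ha : 0 < a) (m : ℕ) : L2Hor d →L[ℝ] solenoidal d ℓ :=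
  (liftJet ℓ ha m).codRestrict (solenoidal d ℓ) (liftJet_mem hℓ ha m)

lemma isTopTrace_lift (hℓ : 0 < ℓ) (ha : 0 < a) (m : ℕ) (h : L2Hor d) :
    IsTopTrace (lift hℓ ha m h) (multL (memLp_liftSymbol ha (Fin.last d)) h) := by
  rw [isTopTrace_iff]
  intro φ hφ
  rw [inner_toLp_eq_integral, inner_toLp_eq_integral, inner_toLp_eq_integral]
  change (∫ z in slab d ℓ, pderiv (Fin.last d) φ z * compL d ℓ (Fin.last d) (liftJet ℓ ha m h).fst z)
    + (∫ z in slab d ℓ, φ z * compL d ℓ (Fin.last d) ((liftJet ℓ ha m h).snd (Fin.last d)) z) = _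
  rw [compL_liftJet_fst, compL_liftJet_snd, liftGrad_last]
  refine (integral_vertical_tensor hℓ hφ (continuous_liftProf ℓ m _) (continuous_liftProf' ℓ m _)
      (hasDerivAt_liftProf m _) _).trans ?_
  congr 1 with x
  rw [liftProf_zero, liftProf_last, prof, div_self hℓ.ne', one_pow, mul_zero, sub_zero, mul_one,
    mul_comm]
  rfl

lemma norm_tensorL_multL_sq_le {p : ℝ → ℝ} (hp : Continuous p) {q : Hor d → ℂ}
    (hq : MemLp q ∞ (volume : Measure (Hor d))) {I c : ℝ} (hI : ∫ y in Ioo 0 ℓ, p y ^ 2 ≤ I)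
    (hc : ∀ ξ, ‖q ξ‖ ≤ c) (h : L2Hor d) : ‖tensorL d ℓ hp (multL hq h)‖ ^ 2 ≤ I * c ^ 2 * ‖h‖ ^ 2 := by
  have h0 : 0 ≤ ∫ y in Ioo 0 ℓ, p y ^ 2 := integral_nonneg fun y => sq_nonneg _
  rw [tensorL_apply, norm_tensor_sq, mul_assoc, ← mul_pow]
  exact mul_le_mul hI (pow_le_pow_left₀ (norm_nonneg _) (norm_multL_le hq hc h) 2) (by positivity)
    (h0.trans hI)

/-- The profile lives in a layer of width about ℓ/(m+2). The vertical component gains this factor;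
the horizontal ones carry the derivative of the profile, but also a factor 1/a from their symbol. -/
lemma norm_lift_sq_le (hℓ : 0 < ℓ) (ha : 0 < a) (m : ℕ) (h : L2Hor d) :
    ‖toL2 d ℓ (lift hℓ ha m h)‖ ^ 2 ≤ (ℓ / (m + 2) + d * ((m + 2) / ℓ * (1 / a) ^ 2)) * ‖h‖ ^ 2 := by
  change ‖(liftJet ℓ ha m h).fst‖ ^ 2 ≤ _
  rw [norm_sq_eq_sum_compL]
  simp only [compL_liftJet_fst]
  rw [Fin.sum_univ_castSucc, add_comm, add_mul]
  refine add_le_add ?_ ?_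
  · have := norm_tensorL_multL_sq_le (ℓ := ℓ) (continuous_liftProf ℓ m (Fin.last d))
      (memLp_liftSymbol ha (Fin.last d)) (I := ℓ / (m + 2))
      (by rw [liftProf_last]; exact integral_prof_sq_le hℓ m) (norm_liftSymbol_last_le a) h
    refine this.trans_eq ?_
    rw [one_pow, mul_one]
  · have h1 : ∀ j ∈ Finset.univ, ‖liftVal ℓ ha m (Fin.castSucc j) h‖ ^ 2
        ≤ (m + 2) / ℓ * (1 / a) ^ 2 * ‖h‖ ^ 2 := fun (j : Fin d) _ =>
      norm_tensorL_multL_sq_le (continuous_liftProf ℓ m j.castSucc) _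
        (by rw [liftProf_castSucc]; exact integral_prof'_sq_le hℓ m) (norm_liftSymbol_castSucc_le ha j) h
    refine (Finset.sum_le_card_nsmul _ _ _ h1).trans_eq ?_
    simp; ring

/-- The constant in the gradient bound of the lift. -/
def liftBound (ℓ a : ℝ) (m : ℕ) : ℝ :=
  ℓ / (m + 2) * (32 * a) ^ 2 + (m + 2) / ℓ + (m + 2) ^ 3 / ℓ ^ 3 * (1 / a) ^ 2

lemma norm_liftGrad_sq_le (hℓ : 0 < ℓ) (ha : 0 < a) (m : ℕ) (k i : Fin (d + 1)) (h : L2Hor d) :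
    ‖liftGrad ℓ ha m k i h‖ ^ 2 ≤ liftBound ℓ a m * ‖h‖ ^ 2 := by
  have p1 : 0 ≤ ℓ / (m + 2) * (32 * a) ^ 2 := by positivity
  have p2 : 0 ≤ ((m : ℝ) + 2) / ℓ := by positivity
  have p3 : 0 ≤ ((m : ℝ) + 2) ^ 3 / ℓ ^ 3 * (1 / a) ^ 2 := by positivity
  induction k using Fin.lastCases with
  | last =>
    rw [liftGrad_last]
    induction i using Fin.lastCases with
    | last =>
      refine (norm_tensorL_multL_sq_le (continuous_liftProf' ℓ m (Fin.last d)) _ (I := ((m : ℝ) + 2) / ℓ)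
        (by rw [liftProf'_last]; exact integral_prof'_sq_le hℓ m) (norm_liftSymbol_last_le a) h).trans ?_
      gcongr
      unfold liftBound; linarith
    | cast j =>
      refine (norm_tensorL_multL_sq_le (continuous_liftProf' ℓ m j.castSucc) _ (I := ((m : ℝ) + 2) ^ 3 / ℓ ^ 3)
        (by rw [liftProf'_castSucc]; exact integral_prof''_sq_le hℓ m)
        (norm_liftSymbol_castSucc_le ha j) h).trans ?_
      gcongr
      unfold liftBound; linarith
  | cast k =>
    rw [liftGrad_castSucc]
    induction i using Fin.lastCases with
    | last =>
      refine (norm_tensorL_multL_sq_le (continuous_liftProf ℓ m (Fin.last d)) _ (I := ℓ / ((m : ℝ) + 2))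
        (by rw [liftProf_last]; exact integral_prof_sq_le hℓ m)
        (norm_liftGradSymbol_last_le ha k) h).trans ?_
      gcongr
      unfold liftBound; linarith
    | cast j =>
      refine (norm_tensorL_multL_sq_le (continuous_liftProf ℓ m j.castSucc) _ (I := ((m : ℝ) + 2) / ℓ)
        (by rw [liftProf_castSucc]; exact integral_prof'_sq_le hℓ m)
        (norm_liftGradSymbol_castSucc_le ha k j) h).trans ?_
      gcongr
      unfold liftBound; linarith

lemma dissip_lift_le (hℓ : 0 < ℓ) (ha : 0 < a) (m : ℕ) (h : L2Hor d) :
    dissip (lift hℓ ha m h) ≤ 4 * ((d : ℝ) + 1) ^ 2 * liftBound ℓ a m * ‖h‖ ^ 2 := by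
  have h1 : ∀ i j, ‖symGradL d ℓ i j (lift hℓ ha m h)‖ ^ 2 ≤ 4 * liftBound ℓ a m * ‖h‖ ^ 2 := by
    intro i j
    have e : symGradL d ℓ i j (lift hℓ ha m h) = liftGrad ℓ ha m i j h + liftGrad ℓ ha m j i h := by
      rw [symGradL_apply, ← compL_liftJet_snd, ← compL_liftJet_snd]; rfl
    rw [e]
    have h2 := norm_liftGrad_sq_le hℓ ha m i j h
    have h3 := norm_liftGrad_sq_le hℓ ha m j i h
    have h4 := norm_add_le (liftGrad ℓ ha m i j h) (liftGrad ℓ ha m j i h)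
    nlinarith [sq_nonneg (‖liftGrad ℓ ha m i j h‖ - ‖liftGrad ℓ ha m j i h‖),
      norm_nonneg (liftGrad ℓ ha m i j h + liftGrad ℓ ha m j i h)]
  unfold dissip
  refine (Finset.sum_le_sum fun i _ => Finset.sum_le_sum fun j _ => h1 i j).trans_eq ?_
  simp; ring

end Lift

/-! ### The surface energy in a shell -/

section SurfaceEnergy

variable {d : ℕ} {μ : Hor d → ℝ} {a : ℝ}

lemma memLp_shell_sqrt (hμ : Continuous μ) (ha : 0 < a) :
    MemLp (fun ξ => ((shell d a ξ * √(μ ξ) : ℝ) : ℂ)) ∞ (volume : Measure (Hor d)) := by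
  have hc : Continuous fun ξ => shell d a ξ * √(μ ξ) := (contDiff_shell a).continuous.mul hμ.sqrt
  obtain ⟨C, hC⟩ := (hasCompactSupport_shell ha).mul_right.exists_bound_of_continuous hc
  refine memLp_top_of_bound (Complex.continuous_ofReal.comp hc).aestronglyMeasurable C
    (Eventually.of_forall fun ξ => ?_)
  rw [Complex.norm_real]
  exact hC ξ

/-- The operator with symbol `m √μ`, whose square gives the surface energy in a frequency shell. -/
def surfL (hμ : Continuous μ) (ha : 0 < a) : L2Hor d →L[ℝ] L2Cplx d :=
  (mulL (memLp_shell_sqrt hμ ha)).comp (fourL d)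

lemma coeFn_surfL (hμ : Continuous μ) (ha : 0 < a) (h : L2Hor d) :
    surfL hμ ha h =ᵐ[volume] fun ξ => ((shell d a ξ * √(μ ξ) : ℝ) : ℂ) * fourL d h ξ :=
  coeFn_mulL _ _

variable {k : SchwartzMap (Hor d) ℝ}

lemma coeFn_fourL_horConv (hkm : ∀ ξ, 𝓕⁻ (fun x => (k x : ℂ)) ξ = shell d a ξ) (h : L2Hor d) :
    fourL d (horConv k h) =ᵐ[volume] fun ξ => (shell d a ξ : ℂ) * fourL d h ξ := by
  rw [fourL_horConv k (memLp_shell a) hkm]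
  exact coeFn_mulL _ _

/-- Splitting μ = √μ·√μ symmetrically. With f = ∂ₜh this identifies the surface work in the momentum
equation with half the derivative of the localised surface energy, so that the two cancel. -/
lemma inner_horConv_multiplier (hμ : Continuous μ) (hμ0 : ∀ ξ, 0 ≤ μ ξ) (ha : 0 < a)
    (hkm : ∀ ξ, 𝓕⁻ (fun x => (k x : ℂ)) ξ = shell d a ξ) {h p : L2Hor d} (hp : IsMultiplier μ h p)
    (f : L2Hor d) : (inner ℝ (horConv k p) (horConv k f) : ℝ)
      = inner ℝ (surfL hμ ha h) (surfL hμ ha f) := by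
  rw [← inner_fourL, L2.inner_def, L2.inner_def]
  refine integral_congr_ae ?_
  rw [IsMultiplier, hat_coe, hat_coe] at hp
  filter_upwards [hp, coeFn_fourL_horConv hkm p, coeFn_fourL_horConv hkm f, coeFn_surfL hμ ha h,
    coeFn_surfL hμ ha f] with ξ h1 h2 h3 h4 h5
  rw [h2, h3, h4, h5, h1]
  have e : ((√(μ ξ) : ℝ) : ℂ) * ((√(μ ξ) : ℝ) : ℂ) = (μ ξ : ℂ) := by
    rw [← Complex.ofReal_mul, Real.mul_self_sqrt (hμ0 ξ)]
  rw [Complex.inner, Complex.inner, ← e]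
  simp only [map_mul, Complex.conj_ofReal, Complex.ofReal_mul]
  congr 1; ring

/-- The sharp cut serves to keep the lift symbols bounded; it disappears once the smooth shell is
applied. -/
lemma cut_mul_shell (ha : 0 < a) (ξ : Hor d) : cut d a ξ * (shell d a ξ : ℂ) = shell d a ξ := by
  by_cases h : shell d a ξ = 0
  · simp [h]
  · have h1 := bounds_of_shell_ne_zero ha h
    have : cut d a ξ = 1 := by
      unfold cut indicator
      rw [if_pos]
      exact ⟨h1.1.le, h1.2.le⟩
    rw [this, one_mul]

/-- The surface term of the momentum equation tested with Ψh: this is where the damping of h comes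
from. -/
lemma inner_multiplier_lift (hμ : Continuous μ) (hμ0 : ∀ ξ, 0 ≤ μ ξ) (ha : 0 < a)
    (hk : ∀ x, k (-x) = k x)
    (hkm : ∀ ξ, 𝓕⁻ (fun x => (k x : ℂ)) ξ = shell d a ξ) {h p : L2Hor d} (hp : IsMultiplier μ h p) :
    (inner ℝ p (horConv k (multL (memLp_liftSymbol ha (Fin.last d)) (horConv k h))) : ℝ)
      = ‖surfL hμ ha h‖ ^ 2 := by
  rw [← inner_horConv hk, real_inner_comm, inner_multL, ← real_inner_self_eq_norm_sq,
    L2.inner_def, L2.inner_def]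
  refine integral_congr_ae ?_
  rw [IsMultiplier, hat_coe, hat_coe] at hp
  filter_upwards [hp, coeFn_fourL_horConv hkm p, coeFn_fourL_horConv hkm h, coeFn_surfL hμ ha h,
    coeFn_mulL (memLp_liftSymbol ha (Fin.last d)) (fourL d (horConv k h))] with ξ h1 h2 h3 h4 h5
  rw [h5, h4, h2, h3, h1, liftSymbol_last, ← mul_assoc, cut_mul_shell ha]
  have e : ((√(μ ξ) : ℝ) : ℂ) * ((√(μ ξ) : ℝ) : ℂ) = (μ ξ : ℂ) := by
    rw [← Complex.ofReal_mul, Real.mul_self_sqrt (hμ0 ξ)]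
  rw [Complex.inner, Complex.inner, ← e]
  simp only [map_mul, Complex.conj_ofReal, Complex.ofReal_mul]
  congr 1; ring

lemma norm_horConv_sq_le (hμ : Continuous μ) (ha : 0 < a)
    (hkm : ∀ ξ, 𝓕⁻ (fun x => (k x : ℂ)) ξ = shell d a ξ) {ν : ℝ} (hν : 0 ≤ ν)
    (h1 : ∀ ξ, a / 2 ≤ ‖ξ‖ → 1 ≤ ν * μ ξ) (h : L2Hor d) :
    ‖horConv k h‖ ^ 2 ≤ ν * ‖surfL hμ ha h‖ ^ 2 := by
  have h2 : ‖horConv k h‖ ≤ √ν * ‖surfL hμ ha h‖ := by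
    rw [← norm_fourL]
    refine Lp.norm_le_mul_norm_of_ae_le_mul ?_
    filter_upwards [coeFn_fourL_horConv hkm h, coeFn_surfL hμ ha h] with ξ h3 h4
    rw [h3, h4, norm_mul, norm_mul, ← mul_assoc, Complex.norm_real, Complex.norm_real]
    refine mul_le_mul_of_nonneg_right ?_ (norm_nonneg _)
    rw [Real.norm_of_nonneg (shell_nonneg _ _),
      Real.norm_of_nonneg (mul_nonneg (shell_nonneg _ _) (Real.sqrt_nonneg _))]
    by_cases hs : shell d a ξ = 0
    · simp [hs]
    have h5 := h1 ξ (bounds_of_shell_ne_zero ha hs).1.le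
    have h6 : 1 ≤ √ν * √(μ ξ) := by
      rw [← Real.sqrt_mul hν]
      exact Real.one_le_sqrt.2 h5
    calc shell d a ξ = shell d a ξ * 1 := (mul_one _).symm
      _ ≤ shell d a ξ * (√ν * √(μ ξ)) := mul_le_mul_of_nonneg_left h6 (shell_nonneg _ _)
      _ = _ := by ring
  calc ‖horConv k h‖ ^ 2 ≤ (√ν * ‖surfL hμ ha h‖) ^ 2 := pow_le_pow_left₀ (norm_nonneg _) h2 2
    _ = _ := by rw [mul_pow, Real.sq_sqrt hν]

end SurfaceEnergy

/-! ### The Lyapunov functional and exponential decay in a shell -/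

section ShellDecay

variable {d : ℕ} {ℓ : ℝ} {μ : Hor d → ℝ} {u₀ : L2Slab d ℓ} {h₀ : L2Hor d}
  {u : ℝ → solenoidal d ℓ} {h : ℝ → L2Hor d} {dtu : ℝ → StrongDual ℝ (solenoidal d ℓ)}
  {dth Mh : ℝ → L2Hor d}

lemma IsWeakSolutionWith.evolution (hw : IsWeakSolutionWith μ u₀ h₀ u h dtu dth Mh) :
    IsEvolution (toL2 d ℓ) u dtu := ⟨hw.memL2Loc_u, hw.memL2Loc_dtu, hw.deriv_u⟩

lemma IsWeakSolutionWith.momentum_ae (hw : IsWeakSolutionWith μ u₀ h₀ u h dtu dth Mh)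
    {v : ℝ → solenoidal d ℓ} (hv : MemL2Loc v) :
    ∀ᵐ t ∂posTimes, ∀ τ : L2Hor d, IsTopTrace (v t) τ →
      dtu t (v t) = - (1 / 2 * symGradInner (u t) (v t)) - (inner ℝ (Mh t) τ : ℝ) := by
  refine ae_posTimes_of_forall_Ioc fun T hT => ?_
  filter_upwards [hw.momentum T hT v (hv T hT)] with t h1 τ hτ
  have h2 := h1 τ hτ
  have h3 : (inner ℝ (Mh t) τ : ℝ) = ∫ x : Hor d, Mh t x * τ x := by
    rw [L2.inner_def]
    simp [mul_comm]
  rw [h3]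
  linarith

/-- Treats h and its lift, which have honest L² derivatives, on the same footing as u, so that one
product rule covers the energy and the cross term. -/
lemma isEvolution_of_weakTimeDeriv {V H : Type*} [NormedAddCommGroup V] [InnerProductSpace ℝ V]
    [CompleteSpace V] [NormedAddCommGroup H] [InnerProductSpace ℝ H] (ι : V →L[ℝ] H) {h k : ℝ → V}
    (hh : MemL2Loc h) (hk : MemL2Loc k) (hd : IsWeakTimeDeriv h k) :
    IsEvolution ι h (fun t => rieszDual ι (k t)) where
  memL2Loc := hh
  memL2Loc_deriv := hk.clm (rieszDualL ι)
  weakDeriv := hd.clm (rieszDualL ι) hh.memL1Loc hk.memL1Loc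

/-- Changing the map into H only precomposes the derivative with S. With S = KK it yields the
evolution of ‖Ku‖² from the equation for u. -/
lemma IsEvolution.precomp {V H : Type*} [NormedAddCommGroup V] [InnerProductSpace ℝ V] [CompleteSpace V]
    [NormedAddCommGroup H] [InnerProductSpace ℝ H] {ι ι' : V →L[ℝ] H} (S : V →L[ℝ] V)
    (hS : ∀ v w, (inner ℝ (ι' v) (ι' w) : ℝ) = inner ℝ (ι v) (ι (S w)))
    {u : ℝ → V} {g : ℝ → StrongDual ℝ V} (h : IsEvolution ι u g) :
    IsEvolution ι' u (fun t => (g t).comp S) where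
  memL2Loc := h.memL2Loc
  memL2Loc_deriv := h.memL2Loc_deriv.clm (ContinuousLinearMap.precomp ℝ S)
  weakDeriv := by
    have h1 := h.weakDeriv.clm (ContinuousLinearMap.precomp ℝ S)
      (h.memL2Loc.clm (rieszDualL ι)).memL1Loc h.memL2Loc_deriv.memL1Loc
    have e : ∀ w, rieszDual ι' w = (ContinuousLinearMap.precomp ℝ S) (rieszDual ι w) := fun w => by
      ext v
      exact hS w v
    simp only [e]
    exact h1

/-- The evolution of the horizontally smoothed velocity. -/
lemma IsEvolution.solConv {k : SchwartzMap (Hor d) ℝ} (hk : ∀ x, k (-x) = k x)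
    (h : IsEvolution (toL2 d ℓ) u dtu) :
    IsEvolution ((toL2 d ℓ).comp (FluidSlab.solConv ℓ k)) u
      (fun t => (dtu t).comp ((FluidSlab.solConv ℓ k).comp (FluidSlab.solConv ℓ k))) := by
  refine h.precomp _ fun v w => ?_
  simp only [ContinuousLinearMap.comp_apply]
  rw [toL2_solConv, toL2_solConv, toL2_solConv, toL2_solConv, inner_slabConv hk]

lemma abs_symGradInner_le (v w : solenoidal d ℓ) : |symGradInner v w| ≤ √(dissip v) * √(dissip w) := by
  rw [symGradInner_eq]
  have h1 : |∑ i, ∑ j, (inner ℝ (symGradL d ℓ i j v) (symGradL d ℓ i j w) : ℝ)|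
      ≤ ∑ p : Fin (d + 1) × Fin (d + 1), ‖symGradL d ℓ p.1 p.2 v‖ * ‖symGradL d ℓ p.1 p.2 w‖ := by
    rw [← Fintype.sum_prod_type' (f := fun i j => (inner ℝ (symGradL d ℓ i j v) (symGradL d ℓ i j w) : ℝ))]
    refine (Finset.abs_sum_le_sum_abs _ _).trans (Finset.sum_le_sum fun p _ => ?_)
    exact abs_real_inner_le_norm _ _
  refine h1.trans ((Real.sum_mul_le_sqrt_mul_sqrt _ _ _).trans_eq ?_)
  rw [Fintype.sum_prod_type, Fintype.sum_prod_type]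
  rfl

lemma le_of_sq_le {x y : ℝ} (h : x ^ 2 ≤ y ^ 2) (hy : 0 ≤ y) : x ≤ y :=
  (le_abs_self x).trans (abs_le_of_sq_le_sq h hy)

/-- Bookkeeping for the Lyapunov functional: X = ‖Ku‖, Y² the surface energy, s² the dissipation of
Ku, Z the cross term, G the viscous pairing with the lift, W the pairing of Ku with the lift of ∂ₜh.
`c1` and `c2` absorb G and W at a cost of s²/8 each, leaving -s²/4 - εY²/2. `c3` makes the
functional at most ¾(X² + Y²), whence the factor 2/3 in the rate. -/
lemma shell_rate_le {X Y Z s G W A B ν Ct Cp ε : ℝ} (hY : 0 ≤ Y) (hX : 0 ≤ X)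
    (hCp : 0 < Cp) (hε : 0 < ε)
    (c1 : ε * (B * ν) ≤ 1) (c2 : 8 * ε * (√A * Ct * √Cp) ≤ 1) (c3 : 4 * ε ^ 2 * (A * ν) ≤ 1)
    (hBν : 0 ≤ B * ν) (hAν : 0 ≤ A * ν) (hG : |G| ≤ s * (√(B * ν) * Y))
    (hW : |W| ≤ √A * Ct * √Cp * s ^ 2) (hZ : |Z| ≤ √(A * ν) * Y * X) (hXs : X ^ 2 ≤ Cp * s ^ 2) :
    |ε * Z| ≤ 1 / 4 * (X ^ 2 + Y ^ 2) ∧ -(1 / 2 * s ^ 2) - 1 / 2 * ε * G - ε * Y ^ 2 + ε * W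
      ≤ -(2 / 3 * min (1 / (2 * Cp)) ε) * (1 / 2 * X ^ 2 + 1 / 2 * Y ^ 2 + ε * Z) := by
  set β := √(B * ν)
  set γ := √(A * ν)
  have hβ : β ^ 2 = B * ν := Real.sq_sqrt hBν
  have hγ : γ ^ 2 = A * ν := Real.sq_sqrt hAν
  have hγ0 : 0 ≤ γ := Real.sqrt_nonneg _
  have hεγ : ε * γ ≤ 1 / 2 := by
    rw [← hγ] at c3
    have : (ε * γ) ^ 2 ≤ (1 / 2) ^ 2 := by nlinarith
    exact le_of_sq_le this (by norm_num)
  have hεZ : |ε * Z| ≤ 1 / 4 * (X ^ 2 + Y ^ 2) := by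
    rw [abs_mul, abs_of_pos hε]
    calc ε * |Z| ≤ ε * (γ * Y * X) := by gcongr
      _ = (ε * γ) * (Y * X) := by ring
      _ ≤ 1 / 2 * (Y * X) := by gcongr
      _ ≤ _ := by nlinarith [sq_nonneg (X - Y)]
  refine ⟨hεZ, ?_⟩
  have t1 : -(1 / 2 * ε * G) ≤ 1 / 2 * ε * Y ^ 2 + 1 / 8 * s ^ 2 := by
    have e1 : -G ≤ s * (β * Y) := (neg_le_abs G).trans hG
    have e2 : s * (β * Y) ≤ Y ^ 2 + 1 / 4 * (β ^ 2 * s ^ 2) := by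
      nlinarith [sq_nonneg (Y - 1 / 2 * (β * s))]
    have e3 : ε * β ^ 2 * s ^ 2 ≤ 1 * s ^ 2 := by
      gcongr; rwa [hβ]
    nlinarith
  have t2 : ε * W ≤ 1 / 8 * s ^ 2 := by
    have e1 : W ≤ √A * Ct * √Cp * s ^ 2 := (le_abs_self W).trans hW
    have e2 : (8 * ε * (√A * Ct * √Cp)) * s ^ 2 ≤ 1 * s ^ 2 := by gcongr
    nlinarith
  set lam := min (1 / (2 * Cp)) ε
  have hl0 : 0 < lam := lt_min (by positivity) hε
  have hl1 : lam ≤ 1 / (2 * Cp) := min_le_left _ _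
  have hl2 : lam ≤ ε := min_le_right _ _
  have t3 : lam * X ^ 2 ≤ 1 / 2 * s ^ 2 := by
    calc lam * X ^ 2 ≤ 1 / (2 * Cp) * (Cp * s ^ 2) := by gcongr
      _ = 1 / 2 * s ^ 2 := by field_simp
  have t4 : lam * Y ^ 2 ≤ ε * Y ^ 2 := by gcongr
  have t5 : lam * (ε * Z) ≤ lam * (1 / 4 * (X ^ 2 + Y ^ 2)) := by
    exact mul_le_mul_of_nonneg_left ((le_abs_self _).trans hεZ) hl0.le
  nlinarith

/-- The functional lies between ¼ and ¾ of p + q; the ratio is the factor 3. -/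
lemma energy_le_of_lyapunov_le {p q z p₀ q₀ z₀ E : ℝ}
    (h : 1 / 2 * p + 1 / 2 * q + z ≤ (1 / 2 * p₀ + 1 / 2 * q₀ + z₀) * E)
    (hz : |z| ≤ 1 / 4 * (p + q)) (hz₀ : |z₀| ≤ 1 / 4 * (p₀ + q₀)) (hE : 0 < E) :
    p + q ≤ 3 * (p₀ + q₀) * E := by
  have h1 := (abs_le.1 hz).1
  have h2 := (abs_le.1 hz₀).2
  have h5 : (1 / 2 * p₀ + 1 / 2 * q₀ + z₀) * E ≤ 3 / 4 * (p₀ + q₀) * E := by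
    gcongr
    linarith
  linarith

set_option maxHeartbeats 400000 in
/-- The energy in a frequency shell decays exponentially. -/
lemma IsWeakSolutionWith.shell_decay (hw : IsWeakSolutionWith μ u₀ h₀ u h dtu dth Mh)
    (hℓ : 0 < ℓ) (hμ : Continuous μ) (hμ0 : ∀ ξ, 0 ≤ μ ξ) {a : ℝ} (ha : 0 < a) (m : ℕ)
    {k : SchwartzMap (Hor d) ℝ} (hk : ∀ x, k (-x) = k x)
    (hkm : ∀ ξ, 𝓕⁻ (fun x => (k x : ℂ)) ξ = shell d a ξ)
    {A B ν Ct Cp ε : ℝ} (hA : 0 ≤ A) (hB : 0 ≤ B) (hν : 0 ≤ ν) (hCt : 0 ≤ Ct) (hCp : 0 < Cp)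
    (hε : 0 < ε)
    (bA : ∀ f : L2Hor d, ‖toL2 d ℓ (lift hℓ ha m f)‖ ^ 2 ≤ A * ‖f‖ ^ 2)
    (bB : ∀ f : L2Hor d, dissip (lift hℓ ha m f) ≤ B * ‖f‖ ^ 2)
    (bν : ∀ ξ : Hor d, a / 2 ≤ ‖ξ‖ → 1 ≤ ν * μ ξ)
    (bt : ∀ (v : solenoidal d ℓ) τ, IsTopTrace v τ → ‖τ‖ ≤ Ct * √(dissip v))
    (bp : ∀ v : solenoidal d ℓ, ‖toL2 d ℓ v‖ ^ 2 ≤ Cp * dissip v)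
    (c1 : ε * (B * ν) ≤ 1) (c2 : 8 * ε * (√A * Ct * √Cp) ≤ 1) (c3 : 4 * ε ^ 2 * (A * ν) ≤ 1) :
    ∀ᵐ t ∂posTimes, ‖slabConv ℓ (Vel d) k (toL2 d ℓ (u t))‖ ^ 2 + ‖surfL hμ ha (h t)‖ ^ 2
      ≤ 3 * (‖slabConv ℓ (Vel d) k u₀‖ ^ 2 + ‖surfL hμ ha h₀‖ ^ 2)
        * Real.exp (-(2 / 3 * min (1 / (2 * Cp)) ε) * t) := by
  set K := solConv (d := d) ℓ k with hK
  set Φ := lift (d := d) hℓ ha m with hΦ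
  -- The outer K can be moved onto u (`hinner`), so every estimate of the cross term involves only
  -- localised quantities.
  set Ψ : L2Hor d →L[ℝ] solenoidal d ℓ := K.comp (Φ.comp (horConv k)) with hΨ
  have ev1 := hw.evolution
  have ev2 := ev1.solConv hk
  have ev3 : IsEvolution (toL2 d ℓ) (fun t => Ψ (h t)) (fun t => rieszDual (toL2 d ℓ) (Ψ (dth t))) :=
    isEvolution_of_weakTimeDeriv _ (hw.memL2Loc_h.clm Ψ) (hw.memL2Loc_dth.clm Ψ)
      (hw.deriv_h.clm Ψ hw.memL2Loc_h.memL1Loc hw.memL2Loc_dth.memL1Loc)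
  have ev4 : IsEvolution (surfL hμ ha) h (fun t => rieszDual (surfL hμ ha) (dth t)) :=
    isEvolution_of_weakTimeDeriv _ hw.memL2Loc_h hw.memL2Loc_dth hw.deriv_h
  obtain ⟨_, p1⟩ := ev2.exists_isPrimitive_normSq
  obtain ⟨_, p2⟩ := ev4.exists_isPrimitive_normSq
  obtain ⟨_, p3⟩ := ev1.exists_isPrimitive_inner ev3
  have m1 := ((memL1Loc_apply ev2.memL2Loc ev2.memL2Loc_deriv).const_smul 2).const_smul (1 / 2)
  have m2 := ((memL1Loc_apply ev4.memL2Loc ev4.memL2Loc_deriv).const_smul 2).const_smul (1 / 2)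
  have m3 := (ev1.memL1Loc_inner ev3).const_smul ε
  have p := ((p1.const_smul (1 / 2)).add m1 m2 (p2.const_smul (1 / 2))).add (m1.add m2) m3
    (p3.const_smul ε)
  have hBν : 0 ≤ B * ν := mul_nonneg hB hν
  have hAν : 0 ≤ A * ν := mul_nonneg hA hν
  have hinner : ∀ (v : solenoidal d ℓ) (f : L2Hor d), (inner ℝ (toL2 d ℓ v) (toL2 d ℓ (Ψ f)) : ℝ)
      = inner ℝ (slabConv ℓ (Vel d) k (toL2 d ℓ v)) (toL2 d ℓ (Φ (horConv k f))) := fun v f => by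
    rw [inner_slabConv hk, ← toL2_solConv]; rfl
  have hκ : ∀ f, ‖horConv k f‖ ≤ √ν * ‖surfL hμ ha f‖ := fun f => by
    refine le_of_sq_le ?_ (by positivity)
    rw [mul_pow, Real.sq_sqrt hν]
    exact norm_horConv_sq_le hμ ha hkm hν bν f
  have hΦA : ∀ f, ‖toL2 d ℓ (Φ f)‖ ≤ √A * ‖f‖ := fun f => by
    refine le_of_sq_le ?_ (by positivity)
    rw [mul_pow, Real.sq_sqrt hA]
    exact bA f
  have hΦB : ∀ f, √(dissip (Φ f)) ≤ √B * ‖f‖ := fun f => by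
    refine Real.sqrt_le_iff.2 ⟨by positivity, ?_⟩
    rw [mul_pow, Real.sq_sqrt hB]
    exact bB f
  have hZ : ∀ (v : L2Slab d ℓ) (f : L2Hor d), |(inner ℝ v (toL2 d ℓ (Φ (horConv k f))) : ℝ)|
      ≤ √(A * ν) * ‖surfL hμ ha f‖ * ‖v‖ := fun v f => by
    refine (abs_real_inner_le_norm _ _).trans ?_
    rw [Real.sqrt_mul hA, mul_comm]
    gcongr
    refine (hΦA _).trans ?_
    rw [mul_assoc]
    gcongr
    exact hκ f
  -- To be used with v = u, f = h, g = ∂ₜh. Since the localised ∂ₜh is the trace of Ku, its lift is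
  -- bounded by the dissipation of Ku; no bound by h enters.
  have hbounds : ∀ (v : solenoidal d ℓ) (f g : L2Hor d), IsTopTrace v g →
      |symGradInner (K v) (Φ (horConv k f))| ≤ √(dissip (K v)) * (√(B * ν) * ‖surfL hμ ha f‖) ∧
      |(inner ℝ (slabConv ℓ (Vel d) k (toL2 d ℓ v)) (toL2 d ℓ (Φ (horConv k g))) : ℝ)|
        ≤ √A * Ct * √Cp * √(dissip (K v)) ^ 2 ∧
      ‖slabConv ℓ (Vel d) k (toL2 d ℓ v)‖ ^ 2 ≤ Cp * √(dissip (K v)) ^ 2 := fun v f g hg => by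
    have hp : ‖slabConv ℓ (Vel d) k (toL2 d ℓ v)‖ ^ 2 ≤ Cp * √(dissip (K v)) ^ 2 := by
      rw [← toL2_solConv, Real.sq_sqrt (dissip_nonneg _)]
      exact bp _
    refine ⟨(abs_symGradInner_le _ _).trans ?_, (abs_real_inner_le_norm _ _).trans ?_, hp⟩
    · rw [Real.sqrt_mul hB]
      gcongr
      refine (hΦB _).trans ?_
      rw [mul_assoc]
      gcongr
      exact hκ f
    · have hp' : ‖slabConv ℓ (Vel d) k (toL2 d ℓ v)‖ ≤ √Cp * √(dissip (K v)) := by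
        refine le_of_sq_le ?_ (by positivity)
        rwa [mul_pow, Real.sq_sqrt hCp.le]
      have ht : ‖toL2 d ℓ (Φ (horConv k g))‖ ≤ √A * (Ct * √(dissip (K v))) := by
        refine (hΦA _).trans ?_
        gcongr
        exact bt _ _ (hg.conv k)
      calc _ ≤ (√Cp * √(dissip (K v))) * (√A * (Ct * √(dissip (K v)))) := by gcongr
        _ = _ := by ring
  have hle := p.le_exp (lam := 2 / 3 * min (1 / (2 * Cp)) ε) ((m1.add m2).add m3)
    (p₀ := (1 / 2 : ℝ) • ‖slabConv ℓ (Vel d) k u₀‖ ^ 2 + (1 / 2 : ℝ) • ‖surfL hμ ha h₀‖ ^ 2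
      + ε • (inner ℝ u₀ (toL2 d ℓ (Ψ h₀)) : ℝ)) ?_ ?_
  · filter_upwards [hle, hw.kinematic] with t h1 h2
    obtain ⟨b1, b2, b3⟩ := hbounds (u t) (h t) _ h2
    obtain ⟨r1, -⟩ := shell_rate_le (norm_nonneg (surfL hμ ha (h t)))
      (norm_nonneg (slabConv ℓ (Vel d) k (toL2 d ℓ (u t)))) hCp hε c1 c2 c3
      hBν hAν b1 b2 (hZ _ (h t)) b3
    have hZ0 := hZ (slabConv ℓ (Vel d) k u₀) h₀
    have hin0 : (inner ℝ u₀ (toL2 d ℓ (Ψ h₀)) : ℝ)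
        = inner ℝ (slabConv ℓ (Vel d) k u₀) (toL2 d ℓ (Φ (horConv k h₀))) := by
      rw [inner_slabConv hk, ← toL2_solConv]; rfl
    have r0 : |ε * (inner ℝ u₀ (toL2 d ℓ (Ψ h₀)) : ℝ)|
        ≤ 1 / 4 * (‖slabConv ℓ (Vel d) k u₀‖ ^ 2 + ‖surfL hμ ha h₀‖ ^ 2) := by
      rw [hin0]
      -- Only the comparability of functional and energy is wanted at time 0, so G and W are zero
      -- and s is chosen to satisfy the Korn hypothesis with equality.
      exact (shell_rate_le (G := 0) (W := 0) (s := √(‖slabConv ℓ (Vel d) k u₀‖ ^ 2 / Cp))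
        (norm_nonneg (surfL hμ ha h₀)) (norm_nonneg (slabConv ℓ (Vel d) k u₀))
        hCp hε c1 c2 c3 hBν hAν (by rw [abs_zero]; positivity) (by rw [abs_zero]; positivity) hZ0 (by
          rw [Real.sq_sqrt (by positivity)]; field_simp; rfl)).1
    rw [hinner] at h1
    simp only [smul_eq_mul, ContinuousLinearMap.comp_apply] at h1
    rw [toL2_solConv] at h1
    exact energy_le_of_lyapunov_le h1 r1 r0 (Real.exp_pos _)
  -- Two test fields. KKu gives minus half the dissipation, its surface work cancelling the
  -- derivative of the surface energy; Ψh gives the damping of h and the viscous error.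
  · filter_upwards [hw.momentum_ae (ev1.memL2Loc.clm (K.comp K)), hw.momentum_ae ev3.memL2Loc,
      hw.kinematic, hw.multiplier] with t h1 h2 h3 h4
    have e1 := h1 _ ((h3.conv k).conv k)
    have e2 := h2 _ ((isTopTrace_lift hℓ ha m (horConv k (h t))).conv k)
    rw [inner_multiplier_lift hμ hμ0 ha hk hkm h4] at e2
    rw [← inner_horConv hk, inner_horConv_multiplier hμ hμ0 ha hkm h4] at e1
    have e3 : symGradInner (u t) (K (K (u t))) = √(dissip (K (u t))) ^ 2 := by
      rw [symGradInner_solConv hk, symGradInner_self, Real.sq_sqrt (dissip_nonneg _)]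
    have e4 : symGradInner (u t) (Ψ (h t)) = symGradInner (K (u t)) (Φ (horConv k (h t))) :=
      symGradInner_solConv hk _ _
    obtain ⟨b1, b2, b3⟩ := hbounds (u t) (h t) _ h3
    obtain ⟨-, r2⟩ := shell_rate_le (norm_nonneg (surfL hμ ha (h t)))
      (norm_nonneg (slabConv ℓ (Vel d) k (toL2 d ℓ (u t)))) hCp hε c1 c2 c3
      hBν hAν b1 b2 (hZ _ (h t)) b3
    refine (le_of_eq ?_).trans (r2.trans (le_of_eq ?_))
    · simp only [ContinuousLinearMap.comp_apply] at e1
      rw [e3] at e1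
      rw [e4] at e2
      rw [rieszDual_apply, rieszDual_apply, real_inner_comm (toL2 d ℓ (u t)), hinner,
        real_inner_comm (surfL hμ ha (h t)), e2]
      simp only [ContinuousLinearMap.comp_apply, smul_eq_mul]
      rw [e1]
      ring
    · rw [hinner]
      simp only [ContinuousLinearMap.comp_apply, smul_eq_mul]
      rw [toL2_solConv]
  · have t1 : Tendsto (fun t => toL2 d ℓ (u t)) initialFilter (𝓝 u₀) := hw.initial_u
    have t2 : Tendsto h initialFilter (𝓝 h₀) := hw.initial_h
    have l1 : Tendsto (fun t => ‖slabConv ℓ (Vel d) k (toL2 d ℓ (u t))‖ ^ 2) initialFilter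
        (𝓝 (‖slabConv ℓ (Vel d) k u₀‖ ^ 2)) := (((slabConv ℓ (Vel d) k).continuous.tendsto u₀).comp t1).norm.pow 2
    have l2 : Tendsto (fun t => ‖surfL hμ ha (h t)‖ ^ 2) initialFilter
        (𝓝 (‖surfL hμ ha h₀‖ ^ 2)) := (((surfL hμ ha).continuous.tendsto h₀).comp t2).norm.pow 2
    have l3 : Tendsto (fun t => (inner ℝ (toL2 d ℓ (u t)) (toL2 d ℓ (Ψ (h t))) : ℝ)) initialFilter
        (𝓝 (inner ℝ u₀ (toL2 d ℓ (Ψ h₀)))) :=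
      Tendsto.inner (𝕜 := ℝ) t1 ((((toL2 d ℓ).comp Ψ).continuous.tendsto h₀).comp t2)
    have l4 := ((l1.const_mul (1 / 2)).add (l2.const_mul (1 / 2))).add (l3.const_mul ε)
    simp only [smul_eq_mul]
    refine l4.congr fun t => ?_
    rw [show ((toL2 d ℓ).comp (solConv ℓ k)) (u t) = slabConv ℓ (Vel d) k (toL2 d ℓ (u t)) from
      toL2_solConv k (u t)]

end ShellDecay

/-! ### The decay rate as a function of the frequency -/

section Rate

variable {d : ℕ} {ℓ : ℝ}

/-- With m = ⌈a⌉, m + 2 lies between a and a + 3: a bounded profile at low frequency and a layer of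
width ~ 1/a at high frequency, which balances horizontal against vertical derivatives. -/
lemma lift_constants_le (hℓ : 0 < ℓ) {a : ℝ} (ha : 0 < a) :
    ℓ / ((⌈a⌉₊ : ℝ) + 2) + d * (((⌈a⌉₊ : ℝ) + 2) / ℓ * (1 / a) ^ 2)
      ≤ (ℓ + 3 * d / ℓ) * (1 / a ^ 2 + 1 / a) ∧
    liftBound ℓ a ⌈a⌉₊ ≤ (1024 * ℓ + 4 / ℓ + 64 / ℓ ^ 3) * (1 / a ^ 2 + a) := by
  have hn0 : a ≤ (⌈a⌉₊ : ℝ) := Nat.le_ceil a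
  have hn1 : (⌈a⌉₊ : ℝ) ≤ a + 1 := (Nat.ceil_lt_add_one ha.le).le
  set n : ℝ := (⌈a⌉₊ : ℝ) + 2 with hn
  have h1 : a ≤ n := by linarith
  have h2 : n ≤ a + 3 := by linarith
  have hnp : 0 < n := by linarith
  have hd : (0 : ℝ) ≤ d := Nat.cast_nonneg d
  have q1 : ℓ / n ≤ ℓ * (1 / a) := by
    rw [mul_one_div]; exact div_le_div_of_nonneg_left hℓ.le ha h1
  have i2 : 0 < 1 / a ^ 2 := by positivity
  have i1 : 0 < 1 / a := by positivity
  constructor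
  · have q2 : n / ℓ * (1 / a) ^ 2 ≤ 3 / ℓ * (1 / a ^ 2 + 1 / a) := by
      have e : 3 / ℓ * (1 / a ^ 2 + 1 / a) = (3 * a + 3) / ℓ * (1 / a) ^ 2 := by field_simp; ring
      rw [e]
      gcongr
      linarith
    have q3 : (d : ℝ) * (n / ℓ * (1 / a) ^ 2) ≤ d * (3 / ℓ * (1 / a ^ 2 + 1 / a)) := by gcongr
    have e : (ℓ + 3 * d / ℓ) * (1 / a ^ 2 + 1 / a)
        = ℓ * (1 / a) + ℓ * (1 / a ^ 2) + d * (3 / ℓ * (1 / a ^ 2 + 1 / a)) := by ring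
    rw [e]
    have : 0 < ℓ * (1 / a ^ 2) := by positivity
    linarith
  · unfold liftBound
    have hone : 1 ≤ 1 / a ^ 2 + a := by
      rcases le_total a 1 with h | h
      · have : 1 ≤ 1 / a ^ 2 := by
          rw [le_div_iff₀ (by positivity), one_mul]
          exact pow_le_one₀ ha.le h
        linarith
      · linarith
    have q2 : ℓ / n * (32 * a) ^ 2 ≤ 1024 * ℓ * (1 / a ^ 2 + a) := by
      calc ℓ / n * (32 * a) ^ 2 ≤ ℓ * (1 / a) * (32 * a) ^ 2 := by gcongr
        _ = 1024 * ℓ * a := by field_simp; norm_num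
        _ ≤ _ := by gcongr; linarith
    have q3 : n / ℓ ≤ 4 / ℓ * (1 / a ^ 2 + a) := by
      rw [div_mul_eq_mul_div]
      gcongr
      linarith
    have q4 : n ^ 3 / ℓ ^ 3 * (1 / a) ^ 2 ≤ 64 / ℓ ^ 3 * (1 / a ^ 2 + a) := by
      have e : 64 / ℓ ^ 3 * (1 / a ^ 2 + a) = (64 * (1 + a ^ 3)) / ℓ ^ 3 * (1 / a) ^ 2 := by
        field_simp
      rw [e]
      gcongr
      calc n ^ 3 ≤ (a + 3) ^ 3 := by gcongr
        _ ≤ _ := by nlinarith [sq_nonneg (a - 1), mul_nonneg ha.le (sq_nonneg (a - 1))]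
    have e : (1024 * ℓ + 4 / ℓ + 64 / ℓ ^ 3) * (1 / a ^ 2 + a) = 1024 * ℓ * (1 / a ^ 2 + a)
      + 4 / ℓ * (1 / a ^ 2 + a) + 64 / ℓ ^ 3 * (1 / a ^ 2 + a) := by ring
    rw [e]
    linarith

/-- The decay rate of the frequency `|ξ| = a`, up to a constant. -/
def rate (r a : ℝ) : ℝ := min (a ^ 2) (min 1 (a ^ (2 * r - 1)))

lemma rate_pos (r : ℝ) {a : ℝ} (ha : 0 < a) : 0 < rate r a :=
  lt_min (by positivity) (lt_min one_pos (Real.rpow_pos_of_pos ha _))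

/-- The rate is designed so that ε = ε₀·`rate` meets the smallness conditions uniformly in a: the
second bound handles dissipation of the lift against μ, the third its L² norm. -/
lemma rate_bounds {r : ℝ} {a : ℝ} (ha : 0 < a) :
    rate r a ≤ 1 ∧ rate r a * (1 / a ^ 2 + a) ≤ 1 + a ^ (2 * r) ∧
      rate r a ^ 2 * (1 / a ^ 2 + 1 / a) ≤ 2 := by
  have h0 := rate_pos r ha
  have h1 : rate r a ≤ a ^ 2 := min_le_left _ _
  have h2 : rate r a ≤ 1 := (min_le_right _ _).trans (min_le_left _ _)
  have h3 : rate r a ≤ a ^ (2 * r - 1) := (min_le_right _ _).trans (min_le_right _ _)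
  have h4 : rate r a * (1 / a ^ 2) ≤ 1 := by rw [mul_one_div, div_le_one (by positivity)]; exact h1
  refine ⟨h2, ?_, ?_⟩
  · have h5 : rate r a * a ≤ a ^ (2 * r) := by
      calc rate r a * a ≤ a ^ (2 * r - 1) * a := by gcongr
        _ = a ^ (2 * r) := by rw [Real.rpow_sub_one ha.ne']; field_simp
    rw [mul_add]; linarith
  · have h5 : rate r a ^ 2 * (1 / a ^ 2) ≤ 1 := by
      calc rate r a ^ 2 * (1 / a ^ 2) = rate r a * (rate r a * (1 / a ^ 2)) := by ring
        _ ≤ 1 * 1 := mul_le_mul h2 h4 (by positivity) zero_le_one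
        _ = 1 := one_mul 1
    have h6 : rate r a ^ 2 * (1 / a) ≤ 1 := by
      rw [mul_one_div, div_le_one ha]
      rcases le_total a 1 with h | h
      · calc rate r a ^ 2 = rate r a * rate r a := by ring
          _ ≤ 1 * a ^ 2 := mul_le_mul h2 h1 h0.le zero_le_one
          _ ≤ a := by nlinarith
      · calc rate r a ^ 2 ≤ 1 := pow_le_one₀ h0.le h2
          _ ≤ a := h
    rw [mul_add]; linarith

lemma continuous_symbol {g σ r : ℝ} (hr : 0 ≤ r) : Continuous (symbol d g σ r) := by
  unfold symbol
  have : Continuous fun ξ : Hor d => (2 * Real.pi * ‖ξ‖) ^ (2 * r) :=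
    Continuous.rpow_const (by fun_prop) fun _ => Or.inr (by positivity)
  fun_prop

lemma symbol_nonneg {g σ : ℝ} (hg : 0 < g) (hσ : 0 < σ) (r : ℝ) (ξ : Hor d) : 0 ≤ symbol d g σ r ξ := by
  have := Real.pi_pos
  unfold symbol; positivity

lemma symbol_ge {g σ r : ℝ} (hg : 0 < g) (hσ : 0 < σ) (hr : 0 ≤ r) {a : ℝ} (ha : 0 < a) {ξ : Hor d}
    (hξ : a / 2 ≤ ‖ξ‖) : 1 ≤ 1 / min g σ / (1 + a ^ (2 * r)) * symbol d g σ r ξ := by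
  have hm : 0 < min g σ := lt_min hg hσ
  have h1 : a ≤ 2 * Real.pi * ‖ξ‖ := by nlinarith [Real.pi_gt_three]
  have h2 : a ^ (2 * r) ≤ (2 * Real.pi * ‖ξ‖) ^ (2 * r) := Real.rpow_le_rpow ha.le h1 (by positivity)
  have h3 : 0 < a ^ (2 * r) := Real.rpow_pos_of_pos ha _
  have h4 : min g σ * (1 + a ^ (2 * r)) ≤ symbol d g σ r ξ := by
    unfold symbol
    rw [mul_add, mul_one]
    refine add_le_add (min_le_left _ _) ?_
    exact mul_le_mul (min_le_right _ _) h2 h3.le hσ.le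
  calc 1 = 1 / min g σ / (1 + a ^ (2 * r)) * (min g σ * (1 + a ^ (2 * r))) := by field_simp
    _ ≤ _ := by gcongr

/-- Exponential decay in every frequency shell, with explicit dependence of the rate on the scale. -/
lemma exists_shell_rate (d : ℕ) (hℓ : 0 < ℓ) {g σ r : ℝ} (hg : 0 < g) (hσ : 0 < σ) (hr : 0 ≤ r) :
    ∃ c : ℝ, 0 < c ∧ ∀ (u₀ : L2Slab d ℓ) (h₀ : L2Hor d) (u : ℝ → solenoidal d ℓ) (h : ℝ → L2Hor d)
      (dtu : ℝ → StrongDual ℝ (solenoidal d ℓ)) (dth Mh : ℝ → L2Hor d),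
      IsWeakSolutionWith (symbol d g σ r) u₀ h₀ u h dtu dth Mh →
      ∀ (a : ℝ) (ha : 0 < a) (k : SchwartzMap (Hor d) ℝ), (∀ x, k (-x) = k x) →
      (∀ ξ, 𝓕⁻ (fun x => (k x : ℂ)) ξ = shell d a ξ) →
      ∀ᵐ t ∂posTimes, ‖slabConv ℓ (Vel d) k (toL2 d ℓ (u t))‖ ^ 2
          + ‖surfL (continuous_symbol (g := g) (σ := σ) hr) ha (h t)‖ ^ 2
        ≤ 3 * (‖slabConv ℓ (Vel d) k u₀‖ ^ 2 + ‖surfL (continuous_symbol (g := g) (σ := σ) hr) ha h₀‖ ^ 2)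
          * Real.exp (-(c * rate r a) * t) := by
  obtain ⟨Ct, hCt, bt⟩ := exists_trace_bound d hℓ
  set Cp : ℝ := 16 * (d + 1) * ℓ ^ 2 with hCp
  have hCp0 : 0 < Cp := by positivity
  have hd : (0 : ℝ) ≤ d := Nat.cast_nonneg d
  set C₁ : ℝ := (ℓ + 3 * d / ℓ) + 4 * ((d : ℝ) + 1) ^ 2 * (1024 * ℓ + 4 / ℓ + 64 / ℓ ^ 3) with hC₁
  have hC₁0 : 0 < C₁ := by positivity
  set C₂ : ℝ := 1 / min g σ with hC₂
  have hm : 0 < min g σ := lt_min hg hσ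
  have hC₂0 : 0 < C₂ := by positivity
  -- One summand for each of `c1`, `c2`, `c3` of `shell_decay` after the a-dependence has cancelled,
  -- and a 1 so that ε₀ ≤ 1.
  set Γ : ℝ := 1 + C₁ * C₂ + 8 * (√(2 * C₁) * Ct * √Cp) + 8 * C₁ * C₂ with hΓ
  have hΓ1 : 1 ≤ Γ := by
    have : 0 ≤ C₁ * C₂ + 8 * (√(2 * C₁) * Ct * √Cp) + 8 * C₁ * C₂ := by positivity
    linarith
  have hΓ0 : 0 < Γ := by linarith
  set ε₀ : ℝ := 1 / Γ with hε₀
  have hε₀0 : 0 < ε₀ := by positivity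
  have hε₀1 : ε₀ ≤ 1 := by rw [hε₀, div_le_one hΓ0]; exact hΓ1
  have hε₀Γ : ∀ x, x ≤ Γ → ε₀ * x ≤ 1 := fun x hx => by
    rw [hε₀, one_div_mul_eq_div, div_le_one hΓ0]; exact hx
  refine ⟨2 / 3 * min (1 / (2 * Cp)) ε₀, by positivity, ?_⟩
  intro u₀ h₀ u h dtu dth Mh hw a ha k hk hkm
  obtain ⟨r1, r2, r3⟩ := rate_bounds (r := r) ha
  have r0 := rate_pos r ha
  obtain ⟨l1, l2⟩ := lift_constants_le (d := d) hℓ ha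
  set R := rate r a with hR
  have hpow : 0 < a ^ (2 * r) := Real.rpow_pos_of_pos ha _
  have hi2 : 0 < 1 / a ^ 2 := by positivity
  have hi1 : 0 < 1 / a := by positivity
  have hν : C₂ / (1 + a ^ (2 * r)) ≤ C₂ := div_le_self hC₂0.le (by linarith)
  have key := hw.shell_decay hℓ (continuous_symbol hr) (symbol_nonneg hg hσ r) ha ⌈a⌉₊ hk hkm
    (A := C₁ * (1 / a ^ 2 + 1 / a)) (B := C₁ * (1 / a ^ 2 + a)) (ν := C₂ / (1 + a ^ (2 * r)))
    (Ct := Ct) (Cp := Cp) (ε := ε₀ * R) (by positivity) (by positivity) (by positivity) hCt.le hCp0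
    (by positivity) (fun f => ?_) (fun f => ?_) (fun ξ hξ => symbol_ge hg hσ hr ha hξ) bt
    (norm_sq_le_dissip hℓ) ?_ ?_ ?_
  · filter_upwards [key, ae_restrict_mem measurableSet_Ioi] with t ht ht0
    -- R ≤ 1 lets it be pulled out of the minimum, so the decay exponent is a constant times the
    -- rate.
    have hR' : 2 / 3 * min (1 / (2 * Cp)) ε₀ * R ≤ 2 / 3 * min (1 / (2 * Cp)) (ε₀ * R) := by
      rw [mul_assoc]
      refine mul_le_mul_of_nonneg_left (le_min ?_ ?_) (by norm_num)
      · calc min (1 / (2 * Cp)) ε₀ * R ≤ 1 / (2 * Cp) * 1 :=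
              mul_le_mul (min_le_left _ _) r1 r0.le (by positivity)
          _ = _ := mul_one _
      · exact mul_le_mul_of_nonneg_right (min_le_right _ _) r0.le
    exact ht.trans (mul_le_mul_of_nonneg_left (Real.exp_le_exp.2
      (mul_le_mul_of_nonneg_right (neg_le_neg hR') (le_of_lt ht0))) (by positivity))
  · refine (norm_lift_sq_le hℓ ha _ f).trans ?_
    gcongr
    refine l1.trans ?_
    gcongr
    rw [hC₁]
    have : 0 ≤ 4 * ((d : ℝ) + 1) ^ 2 * (1024 * ℓ + 4 / ℓ + 64 / ℓ ^ 3) := by positivity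
    linarith
  · refine (dissip_lift_le hℓ ha _ f).trans (mul_le_mul_of_nonneg_right ?_ (sq_nonneg _))
    calc 4 * ((d : ℝ) + 1) ^ 2 * liftBound ℓ a ⌈a⌉₊
        ≤ 4 * ((d : ℝ) + 1) ^ 2 * ((1024 * ℓ + 4 / ℓ + 64 / ℓ ^ 3) * (1 / a ^ 2 + a)) := by gcongr
      _ = (4 * ((d : ℝ) + 1) ^ 2 * (1024 * ℓ + 4 / ℓ + 64 / ℓ ^ 3)) * (1 / a ^ 2 + a) := by ring
      _ ≤ _ := by
        gcongr
        rw [hC₁]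
        have : 0 ≤ ℓ + 3 * d / ℓ := by positivity
        linarith
  · calc ε₀ * R * (C₁ * (1 / a ^ 2 + a) * (C₂ / (1 + a ^ (2 * r))))
        = ε₀ * (C₁ * C₂) * ((R * (1 / a ^ 2 + a)) / (1 + a ^ (2 * r))) := by ring
      _ ≤ ε₀ * (C₁ * C₂) * 1 := by
          gcongr
          rw [div_le_one (by positivity)]
          exact r2
      _ = ε₀ * (C₁ * C₂) := mul_one _
      _ ≤ 1 := hε₀Γ _ (by
          have : 0 ≤ 8 * (√(2 * C₁) * Ct * √Cp) + 8 * C₁ * C₂ := by positivity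
          linarith)
  · have e : R * √(C₁ * (1 / a ^ 2 + 1 / a)) ≤ √(2 * C₁) := by
      refine Real.le_sqrt_of_sq_le ?_
      rw [mul_pow, Real.sq_sqrt (by positivity)]
      calc R ^ 2 * (C₁ * (1 / a ^ 2 + 1 / a)) = C₁ * (R ^ 2 * (1 / a ^ 2 + 1 / a)) := by ring
        _ ≤ C₁ * 2 := by gcongr
        _ = 2 * C₁ := mul_comm _ _
    calc 8 * (ε₀ * R) * (√(C₁ * (1 / a ^ 2 + 1 / a)) * Ct * √Cp)
        = ε₀ * (8 * ((R * √(C₁ * (1 / a ^ 2 + 1 / a))) * Ct * √Cp)) := by ring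
      _ ≤ ε₀ * (8 * (√(2 * C₁) * Ct * √Cp)) := by gcongr
      _ ≤ 1 := hε₀Γ _ (by
          have : 0 ≤ C₁ * C₂ := by positivity
          have : 0 ≤ 8 * C₁ * C₂ := by positivity
          linarith)
  · calc 4 * (ε₀ * R) ^ 2 * (C₁ * (1 / a ^ 2 + 1 / a) * (C₂ / (1 + a ^ (2 * r))))
        = 4 * ε₀ * ε₀ * C₁ * (R ^ 2 * (1 / a ^ 2 + 1 / a)) * (C₂ / (1 + a ^ (2 * r))) := by ring
      _ ≤ 4 * ε₀ * 1 * C₁ * 2 * C₂ := by gcongr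
      _ = ε₀ * (8 * C₁ * C₂) := by ring
      _ ≤ 1 := hε₀Γ _ (by
          have : 0 ≤ C₁ * C₂ := by positivity
          have : 0 ≤ 8 * (√(2 * C₁) * Ct * √Cp) := by positivity
          linarith)

end Rate

/-! ### From exponential decay in shells to weights in frequency -/

section Weights

variable {d : ℕ} {r : ℝ}

/-- The rate varies slowly, so its value at a shell may be replaced by its value at any frequency in
the shell; 16 comes from the quadratic branch with a > ρ/4. -/
lemma rate_div_le_rate (hr0 : 0 ≤ r) (hr1 : r ≤ 1) {a ρ : ℝ} (hρ : 0 < ρ) (h1 : ρ / 4 < a)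
    (h2 : a < 2 * ρ) : rate r ρ / 16 ≤ rate r a := by
  have ha : 0 < a := by linarith
  have h0 := rate_pos r hρ
  have e1 : rate r ρ ≤ ρ ^ 2 := min_le_left _ _
  have e2 : rate r ρ ≤ 1 := (min_le_right _ _).trans (min_le_left _ _)
  have e3 : rate r ρ ≤ ρ ^ (2 * r - 1) := (min_le_right _ _).trans (min_le_right _ _)
  have hp : 0 < ρ ^ (2 * r - 1) := Real.rpow_pos_of_pos hρ _
  refine le_min (by nlinarith) (le_min (by linarith) ?_)
  rcases le_total (0 : ℝ) (2 * r - 1) with h | h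
  · have h3 : (ρ / 4) ^ (2 * r - 1) ≤ a ^ (2 * r - 1) := Real.rpow_le_rpow (by positivity) h1.le h
    have h4 : (4 : ℝ) ^ (2 * r - 1) ≤ 4 ^ (1 : ℝ) :=
      Real.rpow_le_rpow_of_exponent_le (by norm_num) (by linarith)
    rw [Real.div_rpow hρ.le (by norm_num)] at h3
    rw [Real.rpow_one] at h4
    have h5 : ρ ^ (2 * r - 1) / 4 ≤ ρ ^ (2 * r - 1) / 4 ^ (2 * r - 1) :=
      div_le_div_of_nonneg_left hp.le (by positivity) h4
    linarith
  · have h3 : (2 * ρ) ^ (2 * r - 1) ≤ a ^ (2 * r - 1) :=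
      Real.rpow_le_rpow_of_nonpos ha h2.le h
    have h4 : (2 : ℝ) ^ (-1 : ℝ) ≤ 2 ^ (2 * r - 1) :=
      Real.rpow_le_rpow_of_exponent_le (by norm_num) (by linarith)
    rw [Real.mul_rpow (by norm_num) hρ.le] at h3
    rw [Real.rpow_neg_one] at h4
    have h5 : (2 : ℝ)⁻¹ * ρ ^ (2 * r - 1) ≤ 2 ^ (2 * r - 1) * ρ ^ (2 * r - 1) := by gcongr
    linarith

lemma exists_exp_neg_le (d : ℕ) {c : ℝ} (hc : 0 < c) :
    ∃ C : ℝ, 0 < C ∧ ∀ s : ℝ, 0 ≤ s → Real.exp (-(c * s)) ≤ C * (1 + s) ^ (-((d : ℝ) / 2)) := by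
  refine ⟨d.factorial * Real.exp c / c ^ d, by positivity, fun s hs => ?_⟩
  have h1 := Real.pow_div_factorial_le_exp (c * (1 + s)) (by positivity) d
  rw [div_le_iff₀ (by positivity), mul_pow] at h1
  have h2 : Real.exp (-(c * s)) * (1 + s) ^ d ≤ d.factorial * Real.exp c / c ^ d := by
    rw [le_div_iff₀ (by positivity)]
    calc Real.exp (-(c * s)) * (1 + s) ^ d * c ^ d
        = Real.exp (-(c * s)) * (c ^ d * (1 + s) ^ d) := by ring
      _ ≤ Real.exp (-(c * s)) * (Real.exp (c * (1 + s)) * d.factorial) := by gcongr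
      _ = d.factorial * (Real.exp (-(c * s)) * Real.exp (c * (1 + s))) := by ring
      _ = d.factorial * Real.exp c := by rw [← Real.exp_add]; ring_nf
  have h3 : (1 + s) ^ ((d : ℝ) / 2) ≤ (1 + s) ^ d := by
    rw [← Real.rpow_natCast]
    exact Real.rpow_le_rpow_of_exponent_le (by linarith) (by linarith [Nat.cast_nonneg (α := ℝ) d])
  rw [Real.rpow_neg (by linarith), ← div_eq_mul_inv, le_div_iff₀ (Real.rpow_pos_of_pos (by linarith) _)]
  exact (mul_le_mul_of_nonneg_left h3 (Real.exp_pos _).le).trans h2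

/-- The decay factor of a frequency is dominated by a heat kernel at low frequencies, and by an
algebraically decaying factor with loss of derivatives at high frequencies. -/
lemma exists_decay_weight (d : ℕ) (hr1 : r ≤ 1) {c p : ℝ} (hc : 0 < c) (hp0 : 0 ≤ p)
    (hp : (d : ℝ) / 2 * (1 / 2 - r) ≤ p) :
    ∃ C : ℝ, 0 < C ∧ ∀ t : ℝ, 0 ≤ t → ∀ ρ : ℝ, 0 < ρ →
      (ρ ≤ 1 → Real.exp (-(c * rate r ρ) * t) ≤ C * Real.exp (-(c * (1 + t)) * ρ ^ 2)) ∧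
      (1 ≤ ρ → Real.exp (-(c * rate r ρ) * t)
        ≤ C * ((1 + t) ^ (-((d : ℝ) / 2)) * (1 + ρ ^ 2) ^ p)) := by
  obtain ⟨C, hC, hexp⟩ := exists_exp_neg_le d hc
  have hd : (0 : ℝ) ≤ d := Nat.cast_nonneg d
  refine ⟨C + Real.exp c, by positivity, fun t ht ρ hρ => ⟨fun h1 => ?_, fun h1 => ?_⟩⟩
  · have hR : ρ ^ 2 ≤ rate r ρ := by
      refine le_min le_rfl (le_min (pow_le_one₀ hρ.le h1) ?_)
      rw [← Real.rpow_natCast]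
      exact Real.rpow_le_rpow_of_exponent_ge hρ h1 (by norm_num; linarith)
    -- Replacing t by 1 + t costs at most e^c since ρ ≤ 1; it keeps the Gaussian integrable down to
    -- t = 0.
    calc Real.exp (-(c * rate r ρ) * t) ≤ Real.exp (c + -(c * (1 + t)) * ρ ^ 2) := by
          refine Real.exp_le_exp.2 ?_
          have h2 : ρ ^ 2 ≤ 1 := pow_le_one₀ hρ.le h1
          have h3 : c * (ρ ^ 2 * t) ≤ c * (rate r ρ * t) := by gcongr
          have h4 : c * ρ ^ 2 ≤ c * 1 := by gcongr
          linarith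
      _ = Real.exp c * Real.exp (-(c * (1 + t)) * ρ ^ 2) := Real.exp_add _ _
      _ ≤ _ := by gcongr; linarith
  · have hR0 := rate_pos r hρ
    have hR1 : rate r ρ ≤ 1 := (min_le_right _ _).trans (min_le_left _ _)
    -- The derivative loss: where the rate is ρ^(2r-1), its power is ρ^(d(½-r)), and d(½-r) ≤ 2p.
    -- Below, 1 + Rt ≥ R(1+t) separates this factor from the decay in t.
    have hpow : (rate r ρ) ^ (-((d : ℝ) / 2)) ≤ (1 + ρ ^ 2) ^ p := by
      have hle : (1 : ℝ) ≤ (1 + ρ ^ 2) ^ p := Real.one_le_rpow (by nlinarith) hp0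
      have h2 : 1 ≤ ρ ^ 2 := one_le_pow₀ h1
      have h3 : rate r ρ = min 1 (ρ ^ (2 * r - 1)) := by
        rw [rate, min_eq_right ((min_le_left _ _).trans h2)]
      rcases le_total 1 (ρ ^ (2 * r - 1)) with h | h
      · rw [h3, min_eq_left h, Real.one_rpow]; exact hle
      · rw [h3, min_eq_right h, ← Real.rpow_mul hρ.le]
        calc ρ ^ ((2 * r - 1) * -((d : ℝ) / 2)) ≤ ρ ^ (2 * p) :=
              Real.rpow_le_rpow_of_exponent_le h1 (by linarith)
          _ = (ρ ^ 2) ^ p := by rw [Real.rpow_mul hρ.le]; norm_num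
          _ ≤ _ := Real.rpow_le_rpow (by positivity) (by linarith) hp0
    calc Real.exp (-(c * rate r ρ) * t) = Real.exp (-(c * (rate r ρ * t))) := by ring_nf
      _ ≤ C * (1 + rate r ρ * t) ^ (-((d : ℝ) / 2)) := hexp _ (by positivity)
      _ ≤ C * (rate r ρ * (1 + t)) ^ (-((d : ℝ) / 2)) := by
          refine mul_le_mul_of_nonneg_left ?_ hC.le
          exact Real.rpow_le_rpow_of_nonpos (by positivity) (by linarith) (by linarith)
      _ = C * ((1 + t) ^ (-((d : ℝ) / 2)) * rate r ρ ^ (-((d : ℝ) / 2))) := by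
          rw [Real.mul_rpow hR0.le (by linarith), mul_comm (rate r ρ ^ _)]
      _ ≤ _ := by gcongr; linarith [Real.exp_pos c]

lemma exists_symbol_le {g σ : ℝ} (hg : 0 < g) (hσ : 0 < σ) (hr0 : 0 ≤ r) :
    ∃ C : ℝ, 0 < C ∧ ∀ ξ : Hor d, symbol d g σ r ξ ≤ C * (1 + ‖ξ‖ ^ 2) ^ r := by
  have hπ := Real.pi_pos
  refine ⟨g + σ * (2 * Real.pi) ^ (2 * r), by positivity, fun ξ => ?_⟩
  have h1 : (1 : ℝ) ≤ (1 + ‖ξ‖ ^ 2) ^ r := Real.one_le_rpow (by nlinarith [norm_nonneg ξ]) hr0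
  have h2 : ‖ξ‖ ^ (2 * r) ≤ (1 + ‖ξ‖ ^ 2) ^ r := by
    calc ‖ξ‖ ^ (2 * r) = (‖ξ‖ ^ 2) ^ r := by rw [Real.rpow_mul (norm_nonneg _)]; norm_num
      _ ≤ _ := Real.rpow_le_rpow (by positivity) (by linarith) hr0
  unfold symbol
  rw [Real.mul_rpow (by positivity) (norm_nonneg _), add_mul]
  refine add_le_add (le_mul_of_one_le_right hg.le h1) ?_
  rw [mul_assoc]
  gcongr

end Weights

/-! ### Summation over the shells -/

section Sums

variable {d : ℕ} {ℓ : ℝ}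

/-- The weight on the Fourier side of a weighted sum over the frequency shells. -/
def shellWeight (d : ℕ) (c : ℤ → ℝ≥0∞) (ξ : Hor d) : ℝ≥0∞ :=
  ∑' j : ℤ, c j * ENNReal.ofReal (shell d (dyad j) ξ ^ 2)

lemma tsum_slabConv (c : ℤ → ℝ≥0∞) (f : L2Scalar d ℓ) :
    ∑' j : ℤ, c j * ENNReal.ofReal (‖slabConv ℓ ℝ (dyadKernel d j) f‖ ^ 2)
      = ∫⁻ y in Ioo 0 ℓ, ∫⁻ ξ, shellWeight d c ξ * ‖hat (fun x => f (x, y)) ξ‖ₑ ^ 2 := by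
  have h := fun j : ℤ => lintegral_slabConv (ℓ := ℓ) (dyadKernel_even (d := d) j) (memLp_shell _)
    (fourierInv_dyadKernel j) f
  simp only [fun j => (h j).2]
  simp only [← lintegral_const_mul'' _ (h _).1]
  rw [← lintegral_tsum fun j => (h j).1.const_mul _]
  refine lintegral_congr_ae ?_
  filter_upwards [ae_memLp_slice f] with y hy
  have hm : ∀ j : ℤ, AEMeasurable (fun ξ => ENNReal.ofReal (shell d (dyad j) ξ ^ 2)
      * ‖hat (fun x => f (x, y)) ξ‖ₑ ^ 2) volume := fun j =>
    (((contDiff_shell (d := d) (dyad j)).continuous.pow 2).measurable.ennreal_ofReal.aemeasurable).mul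
      ((aestronglyMeasurable_hat hy).enorm.pow_const 2)
  simp only [← lintegral_const_mul'' _ (hm _)]
  rw [← lintegral_tsum fun j => (hm j).const_mul _]
  refine lintegral_congr fun ξ => ?_
  rw [shellWeight, ← ENNReal.tsum_mul_right]
  simp only [mul_assoc]

lemma tsum_surfL {μ : Hor d → ℝ} (hμ : Continuous μ) (hμ0 : ∀ ξ, 0 ≤ μ ξ) (c : ℤ → ℝ≥0∞) (h : L2Hor d) :
    ∑' j : ℤ, c j * ENNReal.ofReal (‖surfL hμ (dyad_pos j) h‖ ^ 2)
      = ∫⁻ ξ, shellWeight d c ξ * (ENNReal.ofReal (μ ξ) * ‖hat h ξ‖ₑ ^ 2) := by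
  have hm : ∀ j : ℤ, AEMeasurable (fun ξ => ENNReal.ofReal (shell d (dyad j) ξ ^ 2)
      * (ENNReal.ofReal (μ ξ) * ‖hat h ξ‖ₑ ^ 2)) volume := fun j =>
    (((contDiff_shell (d := d) (dyad j)).continuous.pow 2).measurable.ennreal_ofReal.aemeasurable).mul
      (hμ.measurable.ennreal_ofReal.aemeasurable.mul
        ((aestronglyMeasurable_hat (Lp.memLp h)).enorm.pow_const 2))
  have h1 : ∀ j : ℤ, ENNReal.ofReal (‖surfL hμ (dyad_pos j) h‖ ^ 2)
      = ∫⁻ ξ, ENNReal.ofReal (shell d (dyad j) ξ ^ 2) * (ENNReal.ofReal (μ ξ) * ‖hat h ξ‖ₑ ^ 2) := fun j => by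
    rw [← lintegral_enorm_sq]
    refine lintegral_congr_ae ?_
    filter_upwards [coeFn_surfL hμ (dyad_pos j) h] with ξ h2
    rw [h2, hat_coe, enorm_mul, mul_pow, ← mul_assoc, ← ENNReal.ofReal_mul (sq_nonneg _)]
    congr 1
    rw [← ofReal_norm, Complex.norm_real, ← ENNReal.ofReal_pow (norm_nonneg _), Real.norm_eq_abs, sq_abs,
      mul_pow, Real.sq_sqrt (hμ0 ξ)]
  simp only [h1, ← lintegral_const_mul'' _ (hm _)]
  rw [← lintegral_tsum fun j => (hm j).const_mul _]
  refine lintegral_congr fun ξ => ?_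
  rw [shellWeight, ← ENNReal.tsum_mul_right]
  simp only [mul_assoc]

lemma ofReal_norm_sq_eq_sum (f : L2Slab d ℓ) :
    ENNReal.ofReal (‖f‖ ^ 2) = ∑ i, ENNReal.ofReal (‖compL d ℓ i f‖ ^ 2) := by
  rw [norm_sq_eq_sum_compL, ENNReal.ofReal_sum_of_nonneg fun i _ => sq_nonneg _]

lemma tsum_slabConv_vel (c : ℤ → ℝ≥0∞) (f : L2Slab d ℓ) :
    ∑' j : ℤ, c j * ENNReal.ofReal (‖slabConv ℓ (Vel d) (dyadKernel d j) f‖ ^ 2)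
      = ∑ i, ∫⁻ y in Ioo 0 ℓ, ∫⁻ ξ, shellWeight d c ξ * ‖hat (fun x => compL d ℓ i f (x, y)) ξ‖ₑ ^ 2 := by
  simp only [ofReal_norm_sq_eq_sum, compL_slabConv, Finset.mul_sum, ← tsum_slabConv]
  exact Summable.tsum_finsetSum fun i _ => ENNReal.summable

/-- The dyadic shells miss ξ = 0, which is negligible exactly because d ≥ 1. -/
lemma ae_ne_zero_hor (hd : 1 ≤ d) : ∀ᵐ ξ : Hor d, ξ ≠ 0 := by
  have : Nontrivial (Hor d) := by
    have : Nonempty (Fin d) := ⟨⟨0, hd⟩⟩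
    infer_instance
  exact Measure.ae_ne volume 0

/-- The energy is controlled by the sum of the energies in the frequency shells. -/
lemma energy_le_tsum (hd : 1 ≤ d) {μ : Hor d → ℝ} (hμ : Continuous μ) (hμ0 : ∀ ξ, 0 ≤ μ ξ)
    (f : L2Slab d ℓ) (h : L2Hor d) :
    energy μ f h ≤ ∑' j : ℤ, ENNReal.ofReal (‖slabConv ℓ (Vel d) (dyadKernel d j) f‖ ^ 2
      + ‖surfL hμ (dyad_pos j) h‖ ^ 2) := by
  have hw : ∀ᵐ ξ : Hor d, 1 ≤ shellWeight d 1 ξ := by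
    filter_upwards [ae_ne_zero_hor hd] with ξ hξ
    simpa [shellWeight] using one_le_tsum_shell hξ
  have h1 : ∫⁻ z in slab d ℓ, ‖f z‖ₑ ^ 2
      ≤ ∑' j : ℤ, ENNReal.ofReal (‖slabConv ℓ (Vel d) (dyadKernel d j) f‖ ^ 2) := by
    have e := tsum_slabConv_vel 1 f
    simp only [Pi.one_apply, one_mul] at e
    rw [e, lintegral_enorm_sq, ofReal_norm_sq_eq_sum]
    refine Finset.sum_le_sum fun i _ => ?_
    rw [lintegral_slice]
    refine lintegral_mono fun y => lintegral_mono_ae ?_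
    filter_upwards [hw] with ξ hξ
    exact le_mul_of_one_le_left' hξ
  have h2 : ∫⁻ ξ, ENNReal.ofReal (μ ξ) * ‖hat h ξ‖ₑ ^ 2
      ≤ ∑' j : ℤ, ENNReal.ofReal (‖surfL hμ (dyad_pos j) h‖ ^ 2) := by
    have e := tsum_surfL hμ hμ0 1 h
    simp only [Pi.one_apply, one_mul] at e
    rw [e]
    refine lintegral_mono_ae ?_
    filter_upwards [hw] with ξ hξ
    exact le_mul_of_one_le_left' hξ
  have h3 : (2⁻¹ : ℝ≥0∞) ≤ 1 := by simp
  unfold energy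
  simp only [ENNReal.ofReal_add (sq_nonneg _) (sq_nonneg _)]
  rw [ENNReal.tsum_add]
  exact add_le_add ((mul_le_of_le_one_left' h3).trans h1) ((mul_le_of_le_one_left' h3).trans h2)

/-- Upgrades the decay in each shell from almost every time to every t ≥ 0, for the continuous
representatives. -/
lemma le_of_ae_le {F G : ℝ → ℝ} (hF : ContinuousOn F (Ici 0)) (hG : ContinuousOn G (Ici 0))
    (h : ∀ᵐ t ∂posTimes, F t ≤ G t) {t : ℝ} (ht : 0 ≤ t) : F t ≤ G t := by
  by_contra! hlt
  have h1 : ∀ᶠ s in 𝓝[Ici 0] t, G s < F s := (hG t ht).eventually_lt (hF t ht) hlt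
  have h2 : ∀ᶠ s in 𝓝[>] t, G s < F s :=
    h1.filter_mono (nhdsWithin_mono t fun s hs => ht.trans (le_of_lt hs))
  obtain ⟨b, hb, hs⟩ := mem_nhdsGT_iff_exists_Ioo_subset.1 h2
  obtain ⟨s, hs1, hs2⟩ := exists_ae_mem_Ioo (G := {s | F s ≤ G s}) h ht hb
  have h3 : G s < F s := hs hs2
  exact absurd h3 (not_lt.2 hs1)

end Sums

/-! ### Gaussian and Sobolev bounds for the weighted data -/

section Bounds

variable {d : ℕ} {ℓ : ℝ}

lemma lintegral_gaussian {b : ℝ} (hb : 0 < b) :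
    ∫⁻ ξ : Hor d, ENNReal.ofReal (Real.exp (-b * ‖ξ‖ ^ 2))
      = ENNReal.ofReal ((Real.pi / b) ^ ((d : ℝ) / 2)) := by
  have hπ := Real.pi_pos
  have h := GaussianFourier.integral_rexp_neg_mul_sq_norm (V := Hor d) hb
  rw [finrank_euclideanSpace_fin] at h
  have hi : Integrable fun ξ : Hor d => Real.exp (-b * ‖ξ‖ ^ 2) :=
    Integrable.of_integral_ne_zero (by rw [h]; positivity)
  rw [← ofReal_integral_eq_lintegral_ofReal hi (Eventually.of_forall fun _ => (Real.exp_pos _).le), h]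

lemma enorm_hat_le {f : Hor d → ℝ} (hf : MemLp f 2 volume) :
    ∀ᵐ ξ, ‖hat f ξ‖ₑ ≤ ∫⁻ x, ‖f x‖ₑ := by
  by_cases h : ∫⁻ x, ‖f x‖ₑ = ⊤
  · exact Eventually.of_forall fun ξ => by rw [h]; exact le_top
  · rw [hat_toLp hf]
    exact norm_fourL_le_integral ⟨hf.1, lt_top_iff_ne_top.2 h⟩ hf

/-- A weighted `L²` norm on the Fourier side, estimated by the `L¹` norm where the weight is a heat kernel and
by a Sobolev norm elsewhere. -/
lemma lintegral_weight_le (hd : 1 ≤ d) {f : Hor d → ℝ} (hf : MemLp f 2 volume) {w : Hor d → ℝ≥0∞}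
    {A b κ p : ℝ} (hb : 0 < b)
    (hw : ∀ ξ, ξ ≠ 0 → w ξ ≤ ENNReal.ofReal A * ENNReal.ofReal (Real.exp (-b * ‖ξ‖ ^ 2))
      + ENNReal.ofReal κ * ENNReal.ofReal ((1 + ‖ξ‖ ^ 2) ^ p)) :
    ∫⁻ ξ, w ξ * ‖hat f ξ‖ₑ ^ 2
      ≤ ENNReal.ofReal A * ENNReal.ofReal ((Real.pi / b) ^ ((d : ℝ) / 2)) * (∫⁻ x, ‖f x‖ₑ) ^ 2
        + ENNReal.ofReal κ * sobolevSq p f := by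
  have hg : Measurable fun ξ : Hor d => ENNReal.ofReal (Real.exp (-b * ‖ξ‖ ^ 2)) :=
    Measurable.ennreal_ofReal (by fun_prop)
  calc ∫⁻ ξ, w ξ * ‖hat f ξ‖ₑ ^ 2
      ≤ ∫⁻ ξ, (ENNReal.ofReal A * (∫⁻ x, ‖f x‖ₑ) ^ 2 * ENNReal.ofReal (Real.exp (-b * ‖ξ‖ ^ 2))
        + ENNReal.ofReal κ * (ENNReal.ofReal ((1 + ‖ξ‖ ^ 2) ^ p) * ‖hat f ξ‖ₑ ^ 2)) := by
        refine lintegral_mono_ae ?_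
        filter_upwards [ae_ne_zero_hor hd, enorm_hat_le hf] with ξ h1 h2
        refine (mul_le_mul_left (hw ξ h1) _).trans ?_
        rw [add_mul, mul_assoc (ENNReal.ofReal κ)]
        refine add_le_add ?_ le_rfl
        calc _ ≤ ENNReal.ofReal A * ENNReal.ofReal (Real.exp (-b * ‖ξ‖ ^ 2)) * (∫⁻ x, ‖f x‖ₑ) ^ 2 := by
              gcongr
          _ = _ := by ring
    _ = _ := by
        rw [lintegral_add_left (hg.const_mul _), lintegral_const_mul _ hg,
          lintegral_const_mul' _ _ ENNReal.ofReal_ne_top, lintegral_gaussian hb, sobolevSq]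
        ring

/-- The data norm that controls the decay of one velocity component. -/
def slabData (ℓ p : ℝ) (f : L2Scalar d ℓ) : ℝ≥0∞ :=
  ∫⁻ y in Ioo 0 ℓ, ((∫⁻ x, ‖f (x, y)‖ₑ) ^ 2 + sobolevSq p (fun x => f (x, y)))

lemma gaussian_mass_eq (d : ℕ) {c t : ℝ} (hc : 0 < c) (ht : 0 ≤ t) :
    (Real.pi / (c * (1 + t))) ^ ((d : ℝ) / 2)
      = (Real.pi / c) ^ ((d : ℝ) / 2) * (1 + t) ^ (-((d : ℝ) / 2)) := by
  have hπ := Real.pi_pos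
  rw [← div_div, Real.div_rpow (by positivity) (by positivity), Real.rpow_neg (by positivity),
    div_eq_mul_inv]

/-- 9 is the factor 3 of the shell estimate times the overlap of three shells; c/16 is the slow
variation of the rate. -/
lemma shellWeight_le {r : ℝ} (hr0 : 0 ≤ r) (hr1 : r ≤ 1) {c : ℝ} (hc : 0 < c) {t : ℝ} (ht : 0 ≤ t)
    {ξ : Hor d} (hξ : ξ ≠ 0) :
    shellWeight d (fun j => ENNReal.ofReal (3 * Real.exp (-(c * rate r (dyad j)) * t))) ξ
      ≤ ENNReal.ofReal (9 * Real.exp (-(c / 16 * rate r ‖ξ‖) * t)) := by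
  have h := tsum_shell_le hξ (fun j => ENNReal.ofReal (3 * Real.exp (-(c * rate r (dyad j)) * t)))
    (ENNReal.ofReal (3 * Real.exp (-(c / 16 * rate r ‖ξ‖) * t))) fun j h1 h2 => by
      refine ENNReal.ofReal_le_ofReal ?_
      have h3 := rate_div_le_rate hr0 hr1 (norm_pos_iff.2 hξ) h1 h2
      have h4 : c * (rate r ‖ξ‖ / 16) * t ≤ c * rate r (dyad j) * t := by gcongr
      have h5 : Real.exp (-(c * rate r (dyad j)) * t) ≤ Real.exp (-(c / 16 * rate r ‖ξ‖) * t) :=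
        Real.exp_le_exp.2 (by linarith)
      linarith
  refine h.trans_eq ?_
  rw [show (3 : ℝ≥0∞) = ENNReal.ofReal 3 by simp, ← ENNReal.ofReal_mul (by norm_num)]
  congr 1; ring

/-- Decay of a weighted sum over the shells, for functions on the slab and on the surface. -/
lemma exists_weight_bounds (d : ℕ) (hd : 1 ≤ d) {g σ r : ℝ} (hg : 0 < g) (hσ : 0 < σ) (hr0 : 0 ≤ r)
    (hr1 : r ≤ 1) {c p q : ℝ} (hc : 0 < c) (hp0 : 0 ≤ p) (hp : (d : ℝ) / 2 * (1 / 2 - r) ≤ p)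
    (hq : p + r ≤ q) :
    ∃ C : ℝ, 0 < C ∧ ∀ t : ℝ, 0 ≤ t →
      (∀ f : L2Scalar d ℓ, ∫⁻ y in Ioo 0 ℓ, ∫⁻ ξ,
          shellWeight d (fun j => ENNReal.ofReal (3 * Real.exp (-(c * rate r (dyad j)) * t))) ξ
            * ‖hat (fun x => f (x, y)) ξ‖ₑ ^ 2
        ≤ ENNReal.ofReal (C * (1 + t) ^ (-((d : ℝ) / 2))) * slabData ℓ p f) ∧
      (∀ h : L2Hor d, ∫⁻ ξ,
          shellWeight d (fun j => ENNReal.ofReal (3 * Real.exp (-(c * rate r (dyad j)) * t))) ξ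
            * (ENNReal.ofReal (symbol d g σ r ξ) * ‖hat h ξ‖ₑ ^ 2)
        ≤ ENNReal.ofReal (C * (1 + t) ^ (-((d : ℝ) / 2)))
          * ((∫⁻ x, ‖h x‖ₑ) ^ 2 + sobolevSq q h)) := by
  have hπ := Real.pi_pos
  obtain ⟨C, hC, hdec⟩ := exists_decay_weight d hr1 (c := c / 16) (by positivity) hp0 hp
  obtain ⟨S, hS, hsym⟩ := exists_symbol_le (d := d) hg hσ hr0
  set G : ℝ := (Real.pi / (c / 16)) ^ ((d : ℝ) / 2) with hG
  have hG0 : 0 < G := by positivity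
  -- A common majorant of four coefficients: low and high frequencies, each for velocity and
  -- surface. For |ξ| ≤ 1 the symbol μ is at most 2S, and G is the Gaussian mass apart from its
  -- power of 1 + t.
  refine ⟨9 * C * (1 + 2 * S) * (1 + G), by positivity, fun t ht => ⟨fun f => ?_, fun h => ?_⟩⟩
  · have hτ : 0 < (1 + t) ^ (-((d : ℝ) / 2)) := Real.rpow_pos_of_pos (by linarith) _
    rw [slabData, ← lintegral_const_mul' _ _ ENNReal.ofReal_ne_top]
    refine lintegral_mono_ae ?_
    filter_upwards [ae_memLp_slice f] with y hy
    refine (lintegral_weight_le hd hy (A := 9 * C) (b := c / 16 * (1 + t))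
      (κ := 9 * C * (1 + t) ^ (-((d : ℝ) / 2))) (p := p) (by positivity) fun ξ hξ => ?_).trans ?_
    · refine (shellWeight_le hr0 hr1 hc ht hξ).trans ?_
      obtain ⟨h1, h2⟩ := hdec t ht ‖ξ‖ (norm_pos_iff.2 hξ)
      rcases le_total ‖ξ‖ 1 with h | h
      · refine le_add_right ?_
        rw [← ENNReal.ofReal_mul (by positivity)]
        refine ENNReal.ofReal_le_ofReal ?_
        linarith [h1 h]
      · refine le_add_left ?_
        rw [← ENNReal.ofReal_mul (by positivity)]
        refine ENNReal.ofReal_le_ofReal ?_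
        linarith [h2 h]
    · rw [gaussian_mass_eq d (by positivity) ht, ← hG, mul_add, ← ENNReal.ofReal_mul (by positivity)]
      gcongr ENNReal.ofReal ?_ * _ + ENNReal.ofReal ?_ * _
      · calc 9 * C * (G * (1 + t) ^ (-((d : ℝ) / 2)))
            = 9 * C * 1 * G * (1 + t) ^ (-((d : ℝ) / 2)) := by ring
          _ ≤ _ := by gcongr <;> linarith
      · calc 9 * C * (1 + t) ^ (-((d : ℝ) / 2))
            = 9 * C * 1 * 1 * (1 + t) ^ (-((d : ℝ) / 2)) := by ring
          _ ≤ _ := by gcongr <;> linarith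
  · have hτ : 0 < (1 + t) ^ (-((d : ℝ) / 2)) := Real.rpow_pos_of_pos (by linarith) _
    simp only [← mul_assoc]
    refine (lintegral_weight_le hd (Lp.memLp h) (A := 9 * C * (2 * S)) (b := c / 16 * (1 + t))
      (κ := 9 * C * S * (1 + t) ^ (-((d : ℝ) / 2))) (p := q) (by positivity) fun ξ hξ => ?_).trans ?_
    · have hone : (1 : ℝ) ≤ 1 + ‖ξ‖ ^ 2 := by nlinarith [norm_nonneg ξ]
      have hsp := symbol_nonneg (d := d) hg hσ r ξ
      refine (mul_le_mul_left (shellWeight_le hr0 hr1 hc ht hξ) _).trans ?_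
      rw [← ENNReal.ofReal_mul (by positivity)]
      obtain ⟨h1, h2⟩ := hdec t ht ‖ξ‖ (norm_pos_iff.2 hξ)
      rcases le_total ‖ξ‖ 1 with h | h
      · refine le_add_right ?_
        rw [← ENNReal.ofReal_mul (by positivity)]
        refine ENNReal.ofReal_le_ofReal ?_
        have h3 : (1 + ‖ξ‖ ^ 2) ^ r ≤ 2 := by
          calc (1 + ‖ξ‖ ^ 2) ^ r ≤ (1 + ‖ξ‖ ^ 2) ^ (1 : ℝ) :=
                Real.rpow_le_rpow_of_exponent_le hone hr1
            _ ≤ 2 := by rw [Real.rpow_one]; nlinarith [norm_nonneg ξ]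
        have h4 : symbol d g σ r ξ ≤ 2 * S := (hsym ξ).trans (by nlinarith)
        calc _ ≤ 9 * (C * Real.exp (-(c / 16 * (1 + t)) * ‖ξ‖ ^ 2)) * (2 * S) := by
              gcongr
              exact h1 h
          _ = _ := by ring
      · refine le_add_left ?_
        rw [← ENNReal.ofReal_mul (by positivity)]
        refine ENNReal.ofReal_le_ofReal ?_
        calc _ ≤ 9 * (C * ((1 + t) ^ (-((d : ℝ) / 2)) * (1 + ‖ξ‖ ^ 2) ^ p))
                * (S * (1 + ‖ξ‖ ^ 2) ^ r) := by
              gcongr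
              · exact h2 h
              · exact hsym ξ
          _ = 9 * C * S * (1 + t) ^ (-((d : ℝ) / 2)) * ((1 + ‖ξ‖ ^ 2) ^ p * (1 + ‖ξ‖ ^ 2) ^ r) := by
              ring
          _ ≤ _ := by
              rw [← Real.rpow_add (by linarith)]
              refine mul_le_mul_of_nonneg_left ?_ (by positivity)
              exact Real.rpow_le_rpow_of_exponent_le hone hq
    · rw [gaussian_mass_eq d (by positivity) ht, ← hG, mul_add, ← ENNReal.ofReal_mul (by positivity)]
      gcongr ENNReal.ofReal ?_ * _ + ENNReal.ofReal ?_ * _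
      · calc 9 * C * (2 * S) * (G * (1 + t) ^ (-((d : ℝ) / 2)))
            = 9 * C * (2 * S) * G * (1 + t) ^ (-((d : ℝ) / 2)) := by ring
          _ ≤ _ := by gcongr <;> linarith
      · calc 9 * C * S * (1 + t) ^ (-((d : ℝ) / 2))
            = 9 * C * S * 1 * (1 + t) ^ (-((d : ℝ) / 2)) := by ring
          _ ≤ _ := by gcongr <;> linarith

end Bounds

/-! ### Decay of the energy and finiteness of the data norms -/

section Decay

variable {d : ℕ} {ℓ : ℝ}

/-- Algebraic decay of the energy, with a constant that depends on the data only through norms. -/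
lemma exists_energy_decay (d : ℕ) (hd : 1 ≤ d) (hℓ : 0 < ℓ) {g σ r : ℝ} (hg : 0 < g) (hσ : 0 < σ)
    (hr0 : 0 ≤ r) (hr1 : r ≤ 1) {p q : ℝ} (hp0 : 0 ≤ p) (hp : (d : ℝ) / 2 * (1 / 2 - r) ≤ p)
    (hq : p + r ≤ q) :
    ∃ C : ℝ, 0 < C ∧ ∀ (u₀ : L2Slab d ℓ) (h₀ : L2Hor d) (u : ℝ → solenoidal d ℓ) (h : ℝ → L2Hor d),
      IsWeakSolution (symbol d g σ r) u₀ h₀ u h →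
      ∃ (U : ℝ → L2Slab d ℓ) (H : ℝ → L2Hor d),
        IsContinuousRepr (fun t => toL2 d ℓ (u t)) U ∧ IsContinuousRepr h H ∧ U 0 = u₀ ∧ H 0 = h₀ ∧
        ∀ t : ℝ, 0 ≤ t → energy (symbol d g σ r) (U t) (H t)
          ≤ ENNReal.ofReal (C * (1 + t) ^ (-((d : ℝ) / 2)))
            * (∑ i, slabData ℓ p (compL d ℓ i u₀) + ((∫⁻ x, ‖h₀ x‖ₑ) ^ 2 + sobolevSq q h₀)) := by
  obtain ⟨c, hc, hshell⟩ := exists_shell_rate d hℓ hg hσ hr0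
  obtain ⟨C, hC, hbound⟩ := exists_weight_bounds (ℓ := ℓ) d hd hg hσ hr0 hr1 hc hp0 hp hq
  refine ⟨C, hC, fun u₀ h₀ u h ⟨dtu, dth, Mh, hw⟩ => ?_⟩
  obtain ⟨U, hU, hU0⟩ := hw.evolution.exists_continuousRepr hw.initial_u
  obtain ⟨H, hH, hH0⟩ := (isEvolution_of_weakTimeDeriv (ContinuousLinearMap.id ℝ (L2Hor d))
    hw.memL2Loc_h hw.memL2Loc_dth hw.deriv_h).exists_continuousRepr hw.initial_h
  refine ⟨U, H, hU, hH, hU0, hH0, fun t ht => ?_⟩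
  have hμ : Continuous (symbol d g σ r) := continuous_symbol hr0
  have hμ0 := symbol_nonneg (d := d) hg hσ r
  -- The almost everywhere decay is moved to the given time t by continuity, shell by shell, before
  -- summing.
  have hj : ∀ j : ℤ, ‖slabConv ℓ (Vel d) (dyadKernel d j) (U t)‖ ^ 2
      + ‖surfL hμ (dyad_pos j) (H t)‖ ^ 2
      ≤ 3 * (‖slabConv ℓ (Vel d) (dyadKernel d j) u₀‖ ^ 2 + ‖surfL hμ (dyad_pos j) h₀‖ ^ 2)
          * Real.exp (-(c * rate r (dyad j)) * t) := fun j => by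
    refine le_of_ae_le (F := fun t => ‖slabConv ℓ (Vel d) (dyadKernel d j) (U t)‖ ^ 2
      + ‖surfL hμ (dyad_pos j) (H t)‖ ^ 2) (G := fun t => 3 * (‖slabConv ℓ (Vel d) (dyadKernel d j) u₀‖ ^ 2
        + ‖surfL hμ (dyad_pos j) h₀‖ ^ 2) * Real.exp (-(c * rate r (dyad j)) * t)) ?_ ?_ ?_ ht
    · exact (((slabConv ℓ (Vel d) (dyadKernel d j)).continuous.comp_continuousOn hU.1).norm.pow 2).add
        (((surfL hμ (dyad_pos j)).continuous.comp_continuousOn hH.1).norm.pow 2)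
    · fun_prop
    · filter_upwards [hshell u₀ h₀ u h dtu dth Mh hw (dyad j) (dyad_pos j) (dyadKernel d j)
        (dyadKernel_even j) (fourierInv_dyadKernel j), hU.2, hH.2] with s h1 h2 h3
      rw [h2, h3]
      exact h1
  refine (energy_le_tsum hd hμ hμ0 (U t) (H t)).trans ?_
  calc ∑' j : ℤ, ENNReal.ofReal (‖slabConv ℓ (Vel d) (dyadKernel d j) (U t)‖ ^ 2
        + ‖surfL hμ (dyad_pos j) (H t)‖ ^ 2)
      ≤ ∑' j : ℤ, (ENNReal.ofReal (3 * Real.exp (-(c * rate r (dyad j)) * t))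
          * ENNReal.ofReal (‖slabConv ℓ (Vel d) (dyadKernel d j) u₀‖ ^ 2)
        + ENNReal.ofReal (3 * Real.exp (-(c * rate r (dyad j)) * t))
          * ENNReal.ofReal (‖surfL hμ (dyad_pos j) h₀‖ ^ 2)) := by
        refine ENNReal.tsum_le_tsum fun j => ?_
        rw [← mul_add, ← ENNReal.ofReal_add (sq_nonneg _) (sq_nonneg _),
          ← ENNReal.ofReal_mul (by positivity)]
        refine ENNReal.ofReal_le_ofReal ((hj j).trans_eq ?_)
        ring
    _ = _ := ENNReal.tsum_add
    _ ≤ _ := by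
        rw [tsum_slabConv_vel (fun j : ℤ => ENNReal.ofReal (3 * Real.exp (-(c * rate r (dyad j)) * t))),
          tsum_surfL hμ hμ0 (fun j : ℤ => ENNReal.ofReal (3 * Real.exp (-(c * rate r (dyad j)) * t))),
          mul_add, Finset.mul_sum]
        exact add_le_add (Finset.sum_le_sum fun i _ => (hbound t ht).1 _) ((hbound t ht).2 _)

lemma ae_slice_compL (i : Fin (d + 1)) (f : L2Slab d ℓ) :
    ∀ᵐ y ∂(volume.restrict (Ioo 0 ℓ)),
      (fun x => compL d ℓ i f (x, y)) =ᵐ[(volume : Measure (Hor d))] fun x => f (x, y) i := by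
  have h := coeFn_compL i f
  generalize (compL d ℓ i f : Hor d × ℝ → ℝ) = F at h ⊢
  generalize (f : Hor d × ℝ → Vel d) = F' at h ⊢
  rw [slabVol_eq_prod] at h
  exact Measure.ae_ae_of_ae_prod (Measure.measurePreserving_swap.quasiMeasurePreserving.ae h)

lemma slabData_lt_top {p : ℝ} {u₀ : L2Slab d ℓ} (i : Fin (d + 1)) (h1 : mixedSq ℓ u₀ < ⊤)
    (h2 : ∫⁻ y in Ioo 0 ℓ, sobolevSq p (fun x => compL d ℓ i u₀ (x, y)) < ⊤) :
    slabData ℓ p (compL d ℓ i u₀) < ⊤ := by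
  have hm : AEMeasurable (fun y => (∫⁻ x, ‖compL d ℓ i u₀ (x, y)‖ₑ) ^ 2) (volume.restrict (Ioo 0 ℓ)) :=
    AEMeasurable.pow_const (memLp_prod (compL d ℓ i u₀)).1.enorm.lintegral_prod_left' 2
  rw [slabData, lintegral_add_left' hm]
  refine ENNReal.add_lt_top.2 ⟨lt_of_le_of_lt (lintegral_mono_ae ?_) h1, h2⟩
  filter_upwards [ae_slice_compL i u₀] with y hy
  refine pow_le_pow_left₀ (zero_le) (lintegral_mono_ae ?_) 2
  filter_upwards [hy] with x hx
  rw [hx, ← ofReal_norm, ← ofReal_norm]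
  exact ENNReal.ofReal_le_ofReal (PiLp.norm_apply_le _ _)

lemma lintegral_sobolevSq_compL_lt_top {p : ℝ} {u₀ : L2Slab d ℓ} (i : Fin (d + 1))
    (h : sobolevSlabSq ℓ p u₀ < ⊤) :
    ∫⁻ y in Ioo 0 ℓ, sobolevSq p (fun x => compL d ℓ i u₀ (x, y)) < ⊤ := by
  refine lt_of_le_of_lt (lintegral_mono_ae ?_) h
  filter_upwards [ae_slice_compL i u₀] with y hy
  rw [sobolevSq, hat_congr hy]
  exact Finset.single_le_sum (f := fun i => sobolevSq p (fun x => u₀ (x, y) i)) (fun _ _ => zero_le)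
    (Finset.mem_univ i)

/-- At p = 0 the Sobolev condition on the velocity is plain L², which is why r ≥ ½ asks no
regularity of u₀. -/
lemma lintegral_sobolevSq_zero (f : L2Scalar d ℓ) :
    ∫⁻ y in Ioo 0 ℓ, sobolevSq 0 (fun x => f (x, y)) = ENNReal.ofReal (‖f‖ ^ 2) := by
  rw [lintegral_slice]
  simp [sobolevSq]

end Decay

end FluidSlab

end

/-! ### The theorem: choice of Sobolev exponents -/

theorem theorem5p2 (N : ℕ) (hN : 2 ≤ N) (ℓ g σ r : ℝ) (hℓ : 0 < ℓ) (hg : 0 < g) (hσ : 0 < σ)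
    (hr0 : 0 ≤ r) (hr1 : r ≤ 1)
    (u₀ : FluidSlab.L2Slab (N - 1) ℓ) (h₀ : FluidSlab.L2Hor (N - 1))
    (hu₀_mixed : FluidSlab.mixedSq ℓ u₀ < ⊤)
    (hh₀_L1 : Integrable h₀ volume)
    (hhigh : 1 / 2 ≤ r → FluidSlab.sobolevSq r h₀ < ⊤)
    (hlow : r < 1 / 2 →
      FluidSlab.sobolevSlabSq ℓ (((N : ℝ) - 1) / 2 * (1 / 2 - r)) u₀ < ⊤ ∧
      FluidSlab.sobolevSq (((N : ℝ) - 1) / 4 + ((N : ℝ) + 1) / 2 * r) h₀ < ⊤) :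
    ∃ K : ℝ, ∀ (u : ℝ → FluidSlab.solenoidal (N - 1) ℓ) (h : ℝ → FluidSlab.L2Hor (N - 1)),
      FluidSlab.IsWeakSolution (FluidSlab.symbol (N - 1) g σ r) u₀ h₀ u h →
      ∃ (U : ℝ → FluidSlab.L2Slab (N - 1) ℓ) (H : ℝ → FluidSlab.L2Hor (N - 1)),
        FluidSlab.IsContinuousRepr (fun t => FluidSlab.toL2 (N - 1) ℓ (u t)) U ∧
        FluidSlab.IsContinuousRepr h H ∧
        U 0 = u₀ ∧ H 0 = h₀ ∧
        ∀ t : ℝ, 0 ≤ t →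
          FluidSlab.energy (FluidSlab.symbol (N - 1) g σ r) (U t) (H t)
            ≤ ENNReal.ofReal (K * (1 + t) ^ (-(((N : ℝ) - 1) / 2))) := by
  have hd : 1 ≤ N - 1 := by omega
  have hcast : ((N - 1 : ℕ) : ℝ) = (N : ℝ) - 1 := by
    rw [Nat.cast_sub (by omega), Nat.cast_one]
  have hN1 : (1 : ℝ) ≤ (N : ℝ) - 1 := by rw [← hcast]; exact_mod_cast hd
  -- For r < ½, p is the exact loss and q the given surface exponent; p + r ≤ q amounts to r ≤ Nr.
  -- For r ≥ ½ nothing is lost: p = 0, and q = r is the regularity already in the energy.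
  obtain ⟨p, q, hp0, hp, hq, hDp, hDq⟩ : ∃ p q : ℝ, 0 ≤ p ∧ ((N - 1 : ℕ) : ℝ) / 2 * (1 / 2 - r) ≤ p ∧
      p + r ≤ q ∧ (∀ i, ∫⁻ y in Ioo 0 ℓ,
        FluidSlab.sobolevSq p (fun x => FluidSlab.compL (N - 1) ℓ i u₀ (x, y)) < ⊤) ∧
      FluidSlab.sobolevSq q h₀ < ⊤ := by
    rcases lt_or_ge r (1 / 2) with hr | hr
    · obtain ⟨h1, h2⟩ := hlow hr
      refine ⟨((N : ℝ) - 1) / 2 * (1 / 2 - r), _, ?_, by rw [hcast], ?_,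
        fun i => FluidSlab.lintegral_sobolevSq_compL_lt_top i h1, h2⟩
      · exact mul_nonneg (by linarith) (by linarith)
      · nlinarith [mul_nonneg hr0 (sub_nonneg.2 hN1)]
    · refine ⟨0, r, le_rfl, ?_, by linarith, fun i => ?_, hhigh hr⟩
      · rw [hcast]
        exact mul_nonpos_of_nonneg_of_nonpos (by linarith) (by linarith)
      · rw [FluidSlab.lintegral_sobolevSq_zero]
        exact ENNReal.ofReal_lt_top
  obtain ⟨C, hC, hdecay⟩ :=
    FluidSlab.exists_energy_decay (N - 1) hd hℓ hg hσ hr0 hr1 hp0 hp hq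
  obtain ⟨D, hD⟩ : ∃ D : ℝ≥0∞, D = ∑ i, FluidSlab.slabData ℓ p (FluidSlab.compL (N - 1) ℓ i u₀)
      + ((∫⁻ x, ‖h₀ x‖ₑ) ^ 2 + FluidSlab.sobolevSq q h₀) := ⟨_, rfl⟩
  have hDtop : D ≠ ⊤ := by
    rw [hD]
    exact (ENNReal.add_lt_top.2 ⟨ENNReal.sum_lt_top.2 fun i _ =>
      FluidSlab.slabData_lt_top i hu₀_mixed (hDp i),
      ENNReal.add_lt_top.2 ⟨ENNReal.pow_lt_top hh₀_L1.2, hDq⟩⟩).ne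
  refine ⟨C * D.toReal, fun u h huh => ?_⟩
  obtain ⟨U, H, hU, hH, hU0, hH0, hE⟩ := hdecay u₀ h₀ u h huh
  refine ⟨U, H, hU, hH, hU0, hH0, fun t ht => (hE t ht).trans_eq ?_⟩
  rw [← hD, ← ENNReal.ofReal_toReal hDtop,
    ← ENNReal.ofReal_mul (mul_nonneg hC.le (Real.rpow_nonneg (by linarith) _)), hcast,
    ENNReal.toReal_ofReal ENNReal.toReal_nonneg]
  congr 1; ring
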